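/- Let $d\ge 2$ and let $E$ be the set of nearest-neighbour edges of $\mathbb Z^d$. Let $\nu$ be a probability measure on $\mathbb R_+=[0,\infty)$, let $\mu=\nu^{\otimes E}$ be the product measure on $\mathbb R_+^E$, and for $x\in\mathbb R_+^E$ and $u,v\in\mathbb Z^d$ let $$d_x(u,v)=\inf_{\alpha}\sum_{e\in\alpha}x_e ,$$ the infimum being over all finite nearest-neighbour paths $\alpha$ from $u$ to $v$. Write $|v|=\sum_{i=1}^d|v_i|$. Let $g$ and $G$ be the density and the distribution function of the standard Gaussian law on $\mathbb R$, with the convention that $g\circ G^{-1}$ is extended to $[0,1]$ by its limits $g\circ G^{-1}(0)=g\circ G^{-1}(1)=0$. Call $\nu$ *nearly gamma* if it is absolutely continuous with respect to the Lebesgue measure and has a density $h\ge 0$ such that, with $H(t)=\int_0^t h(u)\,du$ and $I=\{t\ge 0: h(t)>0\}$: (i) $I$ is an interval; (ii) the restriction of $h$ to $I$ is continuous; (iii) there is $A>0$ such that $\dfrac{g(G^{-1}(H(y)))}{h(y)}\le A\sqrt y$ for all $y\in I$. **Theorem.** Suppose that $\nu$ is nearly gamma and that $\int e^{\delta x}\,d\nu(x)<\infty$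 for some $\delta>0$. Then there are constants $C_1,C_2>0$ (depending only on $d$ and $\nu$) such that, for every $v\in\mathbb Z^d$ with $|v|\ge 2$, the function $x\mapsto d_x(0,v)$ is $\mu$-integrable and, for every real $t$ with $0<t\le |v|$, $$\mu\left(\left|d_x(0,v)-\int d_y(0,v)\,d\mu(y)\right|>t\sqrt{\frac{|v|}{\log|v|}}\right)\le C_1e^{-C_2t}.$$ -/

import Mathlib

open MeasureTheory ProbabilityTheory
open scoped NNReal ENNReal

noncomputable section

namespace FPP

/-- The `L¹`-norm `|v|` of a vertex of `ℤ^d`. -/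
def l1norm {d : ℕ} (v : Fin d → ℤ) : ℕ := ∑ i, (v i).natAbs

/-- The nearest-neighbour graph on `ℤ^d`: `u` and `v` are joined when `|u - v| = 1`. -/
def lattice (d : ℕ) : SimpleGraph (Fin d → ℤ) where
  Adj u v := l1norm (u - v) = 1
  symm := ⟨by
    intro u v h
    rw [← h]
    simp only [l1norm, Pi.sub_apply]
    exact Finset.sum_congr rfl fun i _ => by omega⟩
  loopless := ⟨by intro u h; simp [l1norm] at h⟩

/-- The set `E` of (undirected) edges of `ℤ^d`. -/
abbrev Edge (d : ℕ) : Type := (lattice d).edgeSet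

/-- Configurations of nonnegative edge times, `ℝ₊^E`. -/
abbrev Config (d : ℕ) : Type := Edge d → ℝ≥0

/-- The total time `∑_{e ∈ α} x_e` along a finite nearest-neighbour path `α` from `u` to `v`. -/
def pathTime {d : ℕ} (x : Config d) {u v : Fin d → ℤ} (α : (lattice d).Walk u v) : ℝ :=
  (α.darts.map fun a => (x ⟨a.edge, a.edge_mem⟩ : ℝ)).sum

/-- The first passage time `d_x(u,v)`, the infimum of the total times of the paths
from `u` to `v`. -/
def passageTime {d : ℕ} (x : Config d) (u v : Fin d → ℤ) : ℝ :=
  ⨅ α : (lattice d).Walk u v, pathTime x α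

/-- The product measure `μ = ν^{⊗E}`. -/
def edgeLaw (d : ℕ) (ν : Measure ℝ≥0) [IsProbabilityMeasure ν] : Measure (Config d) :=
  Measure.infinitePi fun _ : Edge d => ν

/-- The standard Gaussian density `g`. -/
def gaussDensity (x : ℝ) : ℝ := gaussianPDFReal 0 1 x

/-- The standard Gaussian distribution function `G`. -/
def gaussCDF (x : ℝ) : ℝ := cdf (gaussianReal 0 1) x

open Classical in
/-- The function `g ∘ G⁻¹` on `[0,1]`. Since `G` is a bijection of `ℝ` onto `(0,1)`, the inverse is
the genuine one there; at the end points (`G⁻¹(0) = -∞`, `G⁻¹(1) = +∞`) the value is the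
limit `0`. -/
def gaussProfile (u : ℝ) : ℝ :=
  if 0 < u ∧ u < 1 then gaussDensity (Function.invFun gaussCDF u) else 0

/-- The distribution function `H(t) = ∫₀ᵗ h(u) du` of a density `h` on `ℝ₊`. -/
def distFun (h : ℝ → ℝ) (t : ℝ) : ℝ := ∫ u in (0 : ℝ)..t, h u

/-- The set `I = {t ≥ 0 : h(t) > 0}`. -/
def posSet (h : ℝ → ℝ) : Set ℝ := {t | 0 ≤ t ∧ 0 < h t}

/-- The function `ψ(y) = g(G⁻¹(H(y))) / h(y)`, of interest for `y ∈ I`. -/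
def psi (h : ℝ → ℝ) (y : ℝ) : ℝ := gaussProfile (distFun h y) / h y

/-- `h` is a density of `ν` with respect to the Lebesgue measure of `ℝ₊`. -/
structure IsDensity (ν : Measure ℝ≥0) (h : ℝ → ℝ) : Prop where
  measurable : Measurable h
  nonneg : ∀ t, 0 ≤ h t
  map_eq : ν.map (fun x : ℝ≥0 => (x : ℝ)) =
    (volume.restrict (Set.Ici (0 : ℝ))).withDensity fun t => ENNReal.ofReal (h t)

/-- `ν` is nearly gamma: it has a density `h` such that `I` is an interval, `h` restricted to `I` is
continuous, and `ψ(y) ≤ A √y` on `I` for some `A > 0`. -/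
def IsNearlyGamma (ν : Measure ℝ≥0) : Prop :=
  ∃ h : ℝ → ℝ, IsDensity ν h ∧
    (posSet h).OrdConnected ∧
    ContinuousOn h (posSet h) ∧
    ∃ A : ℝ, 0 < A ∧ ∀ y ∈ posSet h, psi h y ≤ A * Real.sqrt y

end FPP

end

/-!
A nearly gamma law is the law of `R²` for a Lipschitz function `R ≥ 0` of a standard Gaussian: the
bound `ψ(y) ≤ A √y` says precisely that the square root of the monotone transport has bounded slope.
A Gaussian is the limit of normalized sums of random signs, so the logarithmic Sobolev inequality of
the discrete cube, applied to martingale differences as by Falik and Samorodnitsky, passes to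
products of such laws. It gains a factor of order `log n` in the variance of `exp (θ F / 2)` when
every single edge has a small influence on `F`. The energy itself is at most a constant times
`θ² n` times the mean of `exp (θ F)`, because the factor `√y` in the bound on `ψ` weights the slope
of `F` in each edge by the time of that edge, and a geodesic has total time at most of order `n`.

To make the influences small, the passage time is replaced, as by Benjamini, Kalai and Schramm, by
its average `F` over the translations by a box of side about `n ^ (1/4)`, which on the exponential
scale costs less than `√(n / log n)`. The variance inequality
`Var (exp (θ F / 2)) ≤ C θ² n / log n * E (exp (θ F))` is then iterated, halving `θ` each time, and
gives the exponential concentration of `F`, hence of the passage time, on the scale `√(n / log n)`.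
-/

namespace FPP

open Filter Function
open scoped BigOperators Topology

/-! ### Logarithmic Sobolev inequalities on finite products -/

section Cube

variable {Ω β κ ι : Type*} [Fintype Ω]

/-- The entropy `Ent(u) = 𝔼 u log u - 𝔼 u log 𝔼 u` of a function on a finite set with its uniform
probability. -/
noncomputable def ent (u : Ω → ℝ) : ℝ :=
  (𝔼 x, u x * Real.log (u x)) - (𝔼 x, u x) * Real.log (𝔼 x, u x)

/-- The energy of `f` along the move `T` of a finite set with its uniform probability. -/
noncomputable def energy (T : Ω → Ω) (f : Ω → ℝ) : ℝ := 𝔼 x, (f (T x) - f x) ^ 2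

/-- The logarithmic Sobolev inequality `Ent(f²) ≤ ∑ₖ energy (τ k) f` for a family of moves `τ`,
with the constant `1`. -/
def LogSobolev [Fintype β] [Fintype κ] (τ : κ → β → β) : Prop :=
  ∀ f : β → ℝ, ent (fun x => f x ^ 2) ≤ ∑ k, energy (τ k) f

lemma energy_nonneg (T : Ω → Ω) (f : Ω → ℝ) : 0 ≤ energy T f :=
  Finset.expect_nonneg fun _ _ => sq_nonneg _

lemma ent_const [Nonempty Ω] (c : ℝ) : ent (fun _ : Ω => c) = 0 := by
  simp only [ent, Fintype.expect_const, sub_self]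

lemma expect_sq_mul_le (u v : Ω → ℝ) :
    (𝔼 x, u x * v x) ^ 2 ≤ (𝔼 x, u x ^ 2) * 𝔼 x, v x ^ 2 := by
  simp only [Fintype.expect_eq_sum_div_card]
  rw [div_pow, div_mul_div_comm, ← sq]
  gcongr
  exact Finset.sum_mul_sq_le_sq_mul_sq _ _ _

lemma sqrt_expect_sub_sq_le (u v : Ω → ℝ) :
    (√(𝔼 x, u x ^ 2) - √(𝔼 x, v x ^ 2)) ^ 2 ≤ 𝔼 x, (u x - v x) ^ 2 := by
  have hu : 0 ≤ 𝔼 x, u x ^ 2 := Finset.expect_nonneg fun _ _ => sq_nonneg _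
  have hv : 0 ≤ 𝔼 x, v x ^ 2 := Finset.expect_nonneg fun _ _ => sq_nonneg _
  have hexpand : 𝔼 x, (u x - v x) ^ 2 =
      (𝔼 x, u x ^ 2) + (𝔼 x, v x ^ 2) - 2 * 𝔼 x, u x * v x := by
    rw [Finset.mul_expect, ← Finset.expect_add_distrib, ← Finset.expect_sub_distrib]
    exact Finset.expect_congr rfl fun x _ => by ring
  have hcauchy : 𝔼 x, u x * v x ≤ √(𝔼 x, u x ^ 2) * √(𝔼 x, v x ^ 2) := by
    rw [← Real.sqrt_mul hu]
    exact Real.le_sqrt_of_sq_le (expect_sq_mul_le u v)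
  rw [hexpand, sub_sq, Real.sq_sqrt hu, Real.sq_sqrt hv]
  linarith

lemma mul_log_le {u m : ℝ} (hu : 0 ≤ u) (hm : 0 < m) :
    u * Real.log u ≤ u * Real.log m + u * (u / m - 1) := by
  rcases hu.eq_or_lt with rfl | hu
  · simp
  rw [← mul_add]
  refine mul_le_mul_of_nonneg_left ?_ hu.le
  have := Real.log_le_sub_one_of_pos (div_pos hu hm)
  rw [Real.log_div hu.ne' hm.ne'] at this
  linarith

lemma logSobolev_two_point (a b : ℝ) :
    (a ^ 2 * Real.log (a ^ 2) + b ^ 2 * Real.log (b ^ 2)) / 2 -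
      (a ^ 2 + b ^ 2) / 2 * Real.log ((a ^ 2 + b ^ 2) / 2) ≤ (a - b) ^ 2 := by
  set m := (a ^ 2 + b ^ 2) / 2 with hm
  have hm_nonneg : 0 ≤ m := by positivity
  rcases hm_nonneg.eq_or_lt with hzero | hpos
  · have ha : a = 0 := by nlinarith [sq_nonneg a, sq_nonneg b]
    have hb : b = 0 := by nlinarith [sq_nonneg a, sq_nonneg b]
    simp [ha, hb, ← hzero]
  have hquad : a ^ 2 * (a ^ 2 / m - 1) + b ^ 2 * (b ^ 2 / m - 1) ≤ 2 * (a - b) ^ 2 := by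
    have : a ^ 2 * (a ^ 2 / m - 1) + b ^ 2 * (b ^ 2 / m - 1)
        = (a ^ 4 + b ^ 4 - (a ^ 2 + b ^ 2) * m) / m := by field_simp; ring
    rw [this, div_le_iff₀ hpos, hm]
    nlinarith [sq_nonneg ((a - b) ^ 2), mul_nonneg (sq_nonneg (a - b)) (sq_nonneg (a - b))]
  have hmean : a ^ 2 * Real.log m + b ^ 2 * Real.log m = 2 * (m * Real.log m) := by
    rw [hm]; ring
  linarith [mul_log_le (sq_nonneg a) hpos, mul_log_le (sq_nonneg b) hpos]

lemma logSobolev_bool : LogSobolev fun (_ : Unit) => Bool.not := by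
  intro f
  have hexpect (u : Bool → ℝ) : 𝔼 x, u x = (u true + u false) / 2 := by
    rw [Fintype.expect_eq_sum_div_card]; simp
  simp only [ent, energy, hexpect, Finset.univ_unique, Finset.sum_const, Finset.card_singleton,
    one_smul, Bool.not_true, Bool.not_false]
  linarith [logSobolev_two_point (f true) (f false)]

lemma sq_mul_log_sq_ge (a : ℝ) {r : ℝ} (hr : 0 < r) :
    a ^ 2 * (Real.log r + 2) - 2 * (√r * |a|) ≤ a ^ 2 * Real.log (a ^ 2) := by
  rcases eq_or_ne a 0 with rfl | h
  · simp
  have ha : 0 < |a| := abs_pos.2 h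
  have hlog := Real.log_le_sub_one_of_pos (div_pos (Real.sqrt_pos.2 hr) ha)
  rw [Real.log_div (Real.sqrt_pos.2 hr).ne' ha.ne', Real.log_sqrt hr.le] at hlog
  have hmul := mul_le_mul_of_nonneg_left hlog (sq_nonneg |a|)
  have hcancel : |a| ^ 2 * (√r / |a| - 1) = √r * |a| - |a| ^ 2 := by field_simp
  rw [hcancel, sq_abs] at hmul
  rw [Real.log_pow, ← Real.log_abs a]
  push_cast
  linarith

lemma le_ent_sq [Nonempty Ω] (u : Ω → ℝ) {σ : ℝ} (hσ : 0 < σ) :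
    (𝔼 x, u x ^ 2) * (1 - Real.log σ) - σ⁻¹ * (𝔼 x, |u x|) ^ 2 ≤ ent fun x => u x ^ 2 := by
  set q := 𝔼 x, u x ^ 2 with hq
  have hq_nonneg : 0 ≤ q := Finset.expect_nonneg fun _ _ => sq_nonneg _
  rcases hq_nonneg.eq_or_lt with hzero | hq_pos
  · have hu (x : Ω) : u x = 0 := pow_eq_zero_iff two_ne_zero |>.1 <|
      (Finset.expect_eq_zero_iff_of_nonneg fun x _ => sq_nonneg (u x)).1
        (hq.symm.trans hzero.symm) x (Finset.mem_univ x)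
    simp [ent, ← hzero, hu]
  set p := 𝔼 x, |u x|
  have hmean : q * (Real.log (q / σ) + 2) - 2 * (√(q / σ) * p) ≤
      𝔼 x, u x ^ 2 * Real.log (u x ^ 2) := by
    have := Finset.expect_le_expect fun x (_ : x ∈ Finset.univ) =>
      sq_mul_log_sq_ge (u x) (div_pos hq_pos hσ)
    rwa [Finset.expect_sub_distrib, ← Finset.expect_mul, ← Finset.mul_expect,
      ← Finset.mul_expect] at this
  have hamgm : 2 * (√(q / σ) * p) ≤ q + σ⁻¹ * p ^ 2 := by
    have hsq : √(q / σ) ^ 2 * σ = q := by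
      rw [Real.sq_sqrt (by positivity), div_mul_cancel₀ _ hσ.ne']
    have : 0 ≤ σ⁻¹ * (√(q / σ) * σ - p) ^ 2 := by positivity
    have hexpand : σ⁻¹ * (√(q / σ) * σ - p) ^ 2 =
        √(q / σ) ^ 2 * σ + σ⁻¹ * p ^ 2 - 2 * (√(q / σ) * p) := by field_simp; ring
    linarith
  rw [Real.log_div hq_pos.ne' hσ.ne'] at hmean
  simp only [ent, ← hq]
  linarith

variable [DecidableEq ι]

/-- The move of a product set that applies `τ p.2` to the coordinate `p.1`. -/
def coordMove (τ : κ → β → β) (p : ι × κ) (x : ι → β) : ι → β :=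
  update x p.1 (τ p.2 (x p.1))

lemma update_coordMove_of_ne {a j : ι} (h : j ≠ a) (τ : κ → β → β) (k : κ) (x : ι → β) (y : β) :
    update (coordMove τ (j, k) x) a y = coordMove τ (j, k) (update x a y) := by
  simp only [coordMove, update_of_ne h, update_comm h]

variable [Fintype β]

/-- The average of `f` over the coordinate `a`. -/
noncomputable def avg (a : ι) (f : (ι → β) → ℝ) (x : ι → β) : ℝ := 𝔼 y, f (update x a y)

/-- The quadratic mean of `f` over the coordinate `a`. -/
noncomputable def quadAvg (a : ι) (f : (ι → β) → ℝ) (x : ι → β) : ℝ := √(avg a (fun y => f y ^ 2) x)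

lemma quadAvg_sq (a : ι) (f : (ι → β) → ℝ) (x : ι → β) :
    quadAvg a f x ^ 2 = avg a (fun y => f y ^ 2) x :=
  Real.sq_sqrt (Finset.expect_nonneg fun _ _ => sq_nonneg _)

lemma avg_update_self (a : ι) (f : (ι → β) → ℝ) (x : ι → β) (y : β) :
    avg a f (update x a y) = avg a f x := by simp only [avg, update_idem]

lemma avg_avg_self [Nonempty β] (a : ι) (f : (ι → β) → ℝ) : avg a (avg a f) = avg a f := by
  funext x
  simp only [avg, update_idem, Fintype.expect_const]

lemma avg_sub (a : ι) (f g : (ι → β) → ℝ) (x : ι → β) :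
    avg a (fun y => f y - g y) x = avg a f x - avg a g x :=
  Finset.expect_sub_distrib ..

lemma avg_comm {a j : ι} (h : j ≠ a) (f : (ι → β) → ℝ) (x : ι → β) :
    avg j (avg a f) x = avg a (avg j f) x := by
  simp only [avg]
  rw [Finset.expect_comm]
  simp only [update_comm h]

lemma avg_coordMove_self (τ : κ → β → β) (a : ι) (k : κ) (f : (ι → β) → ℝ) (x : ι → β) :
    avg a f (coordMove τ (a, k) x) = avg a f x :=
  avg_update_self ..

lemma avg_coordMove_of_ne {a j : ι} (h : j ≠ a) (τ : κ → β → β) (k : κ) (f : (ι → β) → ℝ)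
    (x : ι → β) :
    avg a f (coordMove τ (j, k) x) = avg a (fun y => f (coordMove τ (j, k) y)) x := by
  simp only [avg, update_coordMove_of_ne h]

lemma dependsOn_avg {a : ι} {s : Set ι} {f : (ι → β) → ℝ} (hf : DependsOn f (insert a s)) :
    DependsOn (avg a f) s := by
  intro x y hxy
  refine Finset.expect_congr rfl fun z _ => hf fun i hi => ?_
  rcases eq_or_ne i a with rfl | hia
  · simp
  · rw [update_of_ne hia, update_of_ne hia, hxy i (hi.resolve_left hia)]

variable [Fintype ι]

lemma expect_expect_update_swap (a : ι) (Φ : (ι → β) → β → ℝ) :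
    𝔼 x, 𝔼 y, Φ (update x a y) (x a) = 𝔼 x, 𝔼 y, Φ x y := by
  have hprod (Ψ : (ι → β) × β → ℝ) := Finset.expect_product (Finset.univ : Finset (ι → β))
    (Finset.univ : Finset β) Ψ
  rw [← hprod fun p => Φ (update p.1 a p.2) (p.1 a), ← hprod fun p => Φ p.1 p.2]
  refine Finset.expect_nbij' (fun p => (update p.1 a p.2, p.1 a))
    (fun p => (update p.1 a p.2, p.1 a)) ?_ ?_ ?_ ?_ ?_ <;> simp

variable [Nonempty β]

lemma expect_avg (a : ι) (f : (ι → β) → ℝ) : 𝔼 x, avg a f x = 𝔼 x, f x := by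
  simpa only [avg, Fintype.expect_const] using expect_expect_update_swap a fun x (_ : β) => f x

lemma expect_abs_avg_le (a : ι) (f : (ι → β) → ℝ) : 𝔼 x, |avg a f x| ≤ 𝔼 x, |f x| := by
  rw [← expect_avg a fun x => |f x|]
  exact Finset.expect_le_expect fun x _ => Finset.abs_expect_le _ _

lemma expect_sub_avg_sq (a : ι) (f : (ι → β) → ℝ) :
    𝔼 x, (f x - avg a f x) ^ 2 = (𝔼 x, f x ^ 2) - 𝔼 x, avg a f x ^ 2 := by
  have hinner : 𝔼 x, f x * avg a f x = 𝔼 x, avg a f x ^ 2 := by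
    rw [← expect_avg a fun x => f x * avg a f x]
    refine Finset.expect_congr rfl fun x _ => ?_
    simp only [avg, update_idem]
    rw [← Finset.expect_mul, sq]
  have hexpand : 𝔼 x, (f x - avg a f x) ^ 2 =
      (𝔼 x, f x ^ 2) - 2 * (𝔼 x, f x * avg a f x) + 𝔼 x, avg a f x ^ 2 := by
    rw [Finset.mul_expect, ← Finset.expect_sub_distrib, ← Finset.expect_add_distrib]
    exact Finset.expect_congr rfl fun x _ => by ring
  rw [hexpand, hinner]; ring

lemma ent_eq_expect_ent_add_ent_avg (a : ι) (u : (ι → β) → ℝ) :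
    ent u = (𝔼 x, ent fun y => u (update x a y)) + ent (avg a u) := by
  have hmean : 𝔼 x, 𝔼 y, u (update x a y) * Real.log (u (update x a y))
      = 𝔼 x, u x * Real.log (u x) := expect_avg a fun x => u x * Real.log (u x)
  simp only [ent, Finset.expect_sub_distrib, hmean, expect_avg]
  simp only [avg]
  ring

lemma energy_coordMove_quadAvg_le (τ : κ → β → β) (a : ι) (p : ι × κ) (f : (ι → β) → ℝ) :
    energy (coordMove τ p) (quadAvg a f) ≤ energy (coordMove τ p) f := by
  obtain ⟨j, k⟩ := p
  rcases eq_or_ne j a with rfl | hj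
  · simpa only [energy, quadAvg, avg_coordMove_self, sub_self, ne_eq, OfNat.ofNat_ne_zero,
      not_false_eq_true, zero_pow, Finset.expect_const_zero] using energy_nonneg _ f
  · unfold energy
    rw [← expect_avg a fun x => (f (coordMove τ (j, k) x) - f x) ^ 2]
    refine Finset.expect_le_expect fun x _ => ?_
    simp only [quadAvg, avg, update_coordMove_of_ne hj]
    exact sqrt_expect_sub_sq_le _ _

lemma energy_coordMove_sub_avg (τ : κ → β → β) (a : ι) (p : ι × κ) (f : (ι → β) → ℝ) :
    energy (coordMove τ p) (fun x => f x - avg a f x) =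
      energy (coordMove τ p) f - energy (coordMove τ p) (avg a f) := by
  obtain ⟨j, k⟩ := p
  rcases eq_or_ne j a with rfl | hj
  · simp [energy, avg_coordMove_self]
  · simp only [energy, avg_coordMove_of_ne hj, ← avg_sub]
    rw [← expect_sub_avg_sq]
    refine Finset.expect_congr rfl fun x _ => ?_
    rw [avg_sub]
    ring

variable [Fintype κ]

lemma LogSobolev.ent_sq_le_add_ent_quadAvg {τ : κ → β → β} (hτ : LogSobolev τ) (a : ι)
    (f : (ι → β) → ℝ) :
    ent (fun x => f x ^ 2) ≤
      (∑ k, energy (coordMove τ (a, k)) f) + ent fun x => quadAvg a f x ^ 2 := by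
  rw [ent_eq_expect_ent_add_ent_avg a]
  simp only [quadAvg_sq]
  gcongr
  calc (𝔼 x, ent fun y => f (update x a y) ^ 2)
      ≤ 𝔼 x : ι → β, ∑ k, energy (τ k) fun y => f (update x a y) :=
        Finset.expect_le_expect fun x _ => hτ fun y => f (update x a y)
    _ = ∑ k, 𝔼 x, avg a (fun x => (f (coordMove τ (a, k) x) - f x) ^ 2) x := by
        rw [Finset.expect_sum_comm]
        simp only [energy, avg, coordMove, update_self, update_idem]
    _ = ∑ k, energy (coordMove τ (a, k)) f := by
        simp only [expect_avg, energy]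

/-- The logarithmic Sobolev inequality tensorizes: the coordinates are averaged out one by one, in
quadratic mean, which decreases the energies. -/
theorem LogSobolev.pi {τ : κ → β → β} (hτ : LogSobolev τ) :
    LogSobolev (coordMove τ : ι × κ → (ι → β) → (ι → β)) := by
  suffices h : ∀ (s : Finset ι) (f : (ι → β) → ℝ), DependsOn f s →
      ent (fun x => f x ^ 2) ≤ ∑ j ∈ s, ∑ k, energy (coordMove τ (j, k)) f by
    intro f
    have := h Finset.univ f (by simpa using dependsOn_univ f)
    rwa [← Fintype.sum_prod_type'] at this
  intro s
  induction s using Finset.induction_on with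
  | empty =>
    intro f hf
    have hconst : (fun x => f x ^ 2) = fun _ => f (Classical.arbitrary _) ^ 2 := by
      funext x
      rw [hf (x := x) (y := Classical.arbitrary _) (by simp)]
    simpa only [hconst, ent_const] using
      Finset.sum_nonneg fun j _ => Finset.sum_nonneg fun k _ => energy_nonneg _ f
  | insert a s ha ih =>
    intro f hf
    have hdep : DependsOn (quadAvg a f) s := fun x y hxy => congrArg Real.sqrt <|
      dependsOn_avg (s := s) (fun x y h => congrArg (· ^ 2) (hf (by simpa using h))) hxy
    have hle : ∑ j ∈ s, ∑ k, energy (coordMove τ (j, k)) (quadAvg a f) ≤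
        ∑ j ∈ s, ∑ k, energy (coordMove τ (j, k)) f :=
      Finset.sum_le_sum fun j _ => Finset.sum_le_sum fun k _ =>
        energy_coordMove_quadAvg_le τ a (j, k) f
    rw [Finset.sum_insert ha]
    linarith [hτ.ent_sq_le_add_ent_quadAvg a f, ih _ hdep]

lemma LogSobolev.expect_sq_sub_expect_avg_sq_le {τ : κ → β → β} (hτ : LogSobolev τ) (a : ι)
    (f : (ι → β) → ℝ) {σ : ℝ} (hσ : 0 < σ) :
    ((𝔼 x, f x ^ 2) - 𝔼 x, avg a f x ^ 2) * (1 - Real.log σ) -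
        σ⁻¹ * (𝔼 x, |f x - avg a f x|) ^ 2 ≤
      (∑ p : ι × κ, energy (coordMove τ p) f) - ∑ p : ι × κ, energy (coordMove τ p) (avg a f) := by
  have := (le_ent_sq (fun x => f x - avg a f x) hσ).trans (hτ.pi _)
  simpa only [expect_sub_avg_sq, energy_coordMove_sub_avg, Finset.sum_sub_distrib] using this

lemma expect_abs_avg_sub_avg_avg_le (a j : ι) (f : (ι → β) → ℝ) :
    𝔼 x, |avg a f x - avg j (avg a f) x| ≤ 𝔼 x, |f x - avg j f x| := by
  rcases eq_or_ne j a with rfl | hj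
  · simpa [avg_avg_self] using Finset.expect_nonneg fun x _ => abs_nonneg (f x - avg j f x)
  · simp only [avg_comm hj, ← avg_sub]
    exact expect_abs_avg_le a _

lemma expect_abs_sub_avg_le (j : ι) (f : (ι → β) → ℝ) :
    𝔼 x, |f x - avg j f x| ≤ 𝔼 x, 𝔼 y, |f x - f (update x j y)| := by
  refine Finset.expect_le_expect fun x _ => ?_
  have : f x - avg j f x = 𝔼 y, (f x - f (update x j y)) := by
    rw [Finset.expect_sub_distrib, Fintype.expect_const, avg]
  exact this ▸ Finset.abs_expect_le _ _

/-- The Falik–Samorodnitsky inequality: `Ent(Δ²) ≤ ∑ₚ energy Δ` is summed over the martingale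
differences `Δ` of `f`, and `le_ent_sq` bounds each entropy from below. The parameter `σ` is to be
optimized by the user. -/
theorem LogSobolev.variance_le {τ : κ → β → β} (hτ : LogSobolev τ) (f : (ι → β) → ℝ) {σ : ℝ}
    (hσ : 0 < σ) :
    ((𝔼 x, f x ^ 2) - (𝔼 x, f x) ^ 2) * (1 - Real.log σ) -
      σ⁻¹ * ∑ j, (𝔼 x, 𝔼 y, |f x - f (update x j y)|) ^ 2 ≤
    ∑ p : ι × κ, energy (coordMove τ p) f := by
  suffices h : ∀ (s : Finset ι) (f : (ι → β) → ℝ), DependsOn f s →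
      ((𝔼 x, f x ^ 2) - (𝔼 x, f x) ^ 2) * (1 - Real.log σ) -
        σ⁻¹ * ∑ j ∈ s, (𝔼 x, |f x - avg j f x|) ^ 2 ≤ ∑ p : ι × κ, energy (coordMove τ p) f by
    refine le_trans ?_ (h Finset.univ f (by simpa using dependsOn_univ f))
    gcongr ?_ - _ * ∑ j, ?_ ^ 2 with j
    exact expect_abs_sub_avg_le j f
  intro s
  induction s using Finset.induction_on with
  | empty =>
    intro f hf
    have hconst : f = fun _ => f (Classical.arbitrary _) := by
      funext x
      exact hf (by simp)
    rw [hconst]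
    simpa using Finset.sum_nonneg fun p _ => energy_nonneg _ _
  | insert a s ha ih =>
    intro f hf
    have havg := ih (avg a f) (dependsOn_avg (by simpa using hf))
    have hstep := hτ.expect_sq_sub_expect_avg_sq_le a f hσ
    have hle : σ⁻¹ * ∑ j ∈ s, (𝔼 x, |avg a f x - avg j (avg a f) x|) ^ 2 ≤
        σ⁻¹ * ∑ j ∈ s, (𝔼 x, |f x - avg j f x|) ^ 2 := by
      gcongr _ * ∑ j ∈ s, ?_ ^ 2 with j
      exact expect_abs_avg_sub_avg_avg_le a j f
    rw [expect_avg] at havg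
    rw [Finset.sum_insert ha, mul_add]
    linarith

end Cube

/-! ### From random signs to Gaussian variables -/

section SignSums

variable {α β ι : Type*} [Fintype α] [MeasurableSpace α] [MeasurableSingletonClass α]
  [MeasurableSpace β] [MeasurableSingletonClass β] [Fintype ι]

lemma integral_uniformOn_univ (f : α → ℝ) : ∫ a, f a ∂uniformOn Set.univ = 𝔼 a, f a := by
  rw [uniformOn, ProbabilityTheory.cond, Measure.restrict_univ, integral_smul_measure,
    integral_countable .of_finite, tsum_fintype, Fintype.expect_eq_sum_div_card, div_eq_inv_mul]
  simp

lemma pi_uniformOn_univ [Finite β] [Nonempty β] :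
    Measure.pi (fun _ : ι => uniformOn (Set.univ : Set β)) =
      uniformOn (Set.univ : Set (ι → β)) := by
  classical
  have := Fintype.ofFinite β
  refine Measure.ext_of_singleton fun a => ?_
  simp [Measure.pi_singleton, uniformOn_univ, ENNReal.inv_pow]

/-- The sign `±1` of a bit. -/
noncomputable def bitSign (b : Bool) : ℝ := if b then 1 else -1

/-- The normalized sum `n^{-1/2} ∑ᵢ ±1` of the signs of `n` bits. -/
noncomputable def signSum (n : ℕ) (b : Fin n → Bool) : ℝ := (√n)⁻¹ * ∑ i, bitSign (b i)

/-- The law of the normalized sum of `n` independent uniform signs. -/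
noncomputable def signSumLaw (n : ℕ) : ProbabilityMeasure ℝ :=
  ⟨(uniformOn Set.univ).map (signSum n),
    Measure.isProbabilityMeasure_map (measurable_of_finite _).aemeasurable⟩

/-- The standard Gaussian law as a point of the space of probability measures, in whose topology the
central limit theorem takes place. -/
noncomputable def stdGaussian : ProbabilityMeasure ℝ := ⟨gaussianReal 0 1, inferInstance⟩

lemma charFun_signSumLaw (n : ℕ) (t : ℝ) :
    charFun (signSumLaw n : Measure ℝ) t =
      charFun ((uniformOn Set.univ).map bitSign) ((√n)⁻¹ * t) ^ n := by
  change charFun ((uniformOn Set.univ).map (signSum n)) t = _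
  have hprod := integral_fintype_prod_eq_pow (ι := Fin n) (μ := uniformOn (Set.univ : Set Bool))
    fun b => Complex.exp (((√n)⁻¹ * t : ℝ) * (bitSign b : ℂ) * Complex.I)
  rw [Fintype.card_fin] at hprod
  rw [charFun_apply_real, charFun_apply_real,
    integral_map (measurable_of_finite _).aemeasurable (by fun_prop),
    integral_map (measurable_of_finite _).aemeasurable (by fun_prop), ← pi_uniformOn_univ, ← hprod]
  congr with b
  rw [← Complex.exp_sum]
  simp only [signSum, ← Finset.sum_mul, ← Finset.mul_sum]
  push_cast
  ring_nf

lemma tendsto_signSumLaw : Tendsto signSumLaw atTop (𝓝 stdGaussian) := by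
  refine ProbabilityMeasure.tendsto_iff_tendsto_charFun.2 fun t => ?_
  have hmean : ∫ b, bitSign b ∂uniformOn Set.univ = 0 := by
    rw [integral_uniformOn_univ, Fintype.expect_eq_sum_div_card]
    simp [bitSign]
  have hvar : ∫ b, (bitSign ^ 2) b ∂uniformOn Set.univ = 1 := by
    rw [integral_uniformOn_univ, Fintype.expect_eq_sum_div_card]
    simp [bitSign]
  have hgauss : charFun (stdGaussian : Measure ℝ) t = Complex.exp (-(t : ℂ) ^ 2 / 2) := by
    change charFun (gaussianReal 0 1) t = _
    rw [charFun_gaussianReal]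
    push_cast
    ring_nf
  simp only [hgauss, charFun_signSumLaw]
  exact tendsto_charFun_inv_sqrt_mul_pow (measurable_of_finite _).aemeasurable hmean hvar t

lemma abs_bitSign_not_sub_le (b : Bool) : |bitSign (!b) - bitSign b| ≤ 2 := by
  cases b <;> norm_num [bitSign]

/-- The moves of the discrete cube that flip one bit. The factor `Unit` only makes them an instance
of `coordMove`. -/
def flipBit (n : ℕ) : Fin n × Unit → (Fin n → Bool) → (Fin n → Bool) :=
  coordMove fun _ => Bool.not

lemma logSobolev_flipBit (n : ℕ) : LogSobolev (flipBit n) := logSobolev_bool.pi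

lemma flipBit_flipBit (n : ℕ) (k : Fin n × Unit) (b : Fin n → Bool) :
    flipBit n k (flipBit n k b) = b := by
  simp [flipBit, coordMove]

lemma abs_signSum_flipBit_sub_le (n : ℕ) (k : Fin n × Unit) (b : Fin n → Bool) :
    |signSum n (flipBit n k b) - signSum n b| ≤ 2 * (√n)⁻¹ := by
  have hsum : ∑ i, bitSign (flipBit n k b i) - ∑ i, bitSign (b i)
      = bitSign (!(b k.1)) - bitSign (b k.1) := by
    rw [← Finset.sum_sub_distrib, Finset.sum_eq_single k.1]
    · simp [flipBit, coordMove]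
    · intro j _ hj
      simp [flipBit, coordMove, update_of_ne hj]
    · simp
  rw [signSum, signSum, ← mul_sub, hsum, abs_mul, abs_of_nonneg (by positivity), mul_comm]
  gcongr
  exact abs_bitSign_not_sub_le _

end SignSums

section CubeLimit

variable {ι : Type*}

/-- The configuration with coordinates `T (signSum n (ω e))`, which turns independent uniform bits
into approximately independent copies of `T` of a standard Gaussian. -/
noncomputable def cubeConfig (T : ℝ → ℝ≥0) (n : ℕ) (ω : ι → Fin n → Bool) (e : ι) : ℝ≥0 :=
  T (signSum n (ω e))

lemma cubeConfig_update [DecidableEq ι] (T : ℝ → ℝ≥0) (n : ℕ) (ω : ι → Fin n → Bool) (e : ι)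
    (b : Fin n → Bool) :
    cubeConfig T n (update ω e b) = update (cubeConfig T n ω) e (T (signSum n b)) := by
  funext j
  rcases eq_or_ne j e with rfl | hj
  · simp [cubeConfig]
  · simp [cubeConfig, update_of_ne hj]

/-- The law of `T` of a standard Gaussian. -/
noncomputable def gaussImage (T : C(ℝ, ℝ≥0)) : ProbabilityMeasure ℝ≥0 :=
  stdGaussian.map (f := T) T.continuous.measurable.aemeasurable

/-- The law of `T` of the normalized sum of `n` signs. -/
noncomputable def signSumImage (T : C(ℝ, ℝ≥0)) (n : ℕ) : ProbabilityMeasure ℝ≥0 :=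
  (signSumLaw n).map (f := T) T.continuous.measurable.aemeasurable

lemma tendsto_signSumImage (T : C(ℝ, ℝ≥0)) :
    Tendsto (signSumImage T) atTop (𝓝 (gaussImage T)) :=
  ProbabilityMeasure.tendsto_map_of_tendsto_of_continuous _ _ tendsto_signSumLaw T.continuous

lemma toMeasure_signSumImage (T : C(ℝ, ℝ≥0)) (n : ℕ) :
    (signSumImage T n : Measure ℝ≥0) = (uniformOn Set.univ).map fun b => T (signSum n b) :=
  Measure.map_map T.continuous.measurable (measurable_of_finite _)

variable [Fintype ι]

lemma pi_signSumImage (T : C(ℝ, ℝ≥0)) (n : ℕ) :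
    Measure.pi (fun _ : ι => (signSumImage T n : Measure ℝ≥0)) =
      (uniformOn Set.univ).map (cubeConfig T n) := by
  rw [toMeasure_signSumImage, ← Measure.pi_map_pi fun _ => (measurable_of_finite _).aemeasurable,
    pi_uniformOn_univ]
  rfl

variable [DecidableEq ι]

lemma integral_pi_prod_signSumImage (T : C(ℝ, ℝ≥0)) (n : ℕ) {Φ : (ι → ℝ≥0) × ℝ≥0 → ℝ}
    (hΦ : Continuous Φ) :
    ∫ x, ∫ y, Φ (x, y) ∂(signSumImage T n : Measure ℝ≥0)
        ∂(Measure.pi fun _ : ι => (signSumImage T n : Measure ℝ≥0)) =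
      𝔼 ω : ι → Fin n → Bool, 𝔼 b, Φ (cubeConfig T n ω, T (signSum n b)) := by
  rw [pi_signSumImage, integral_map (measurable_of_finite _).aemeasurable
    hΦ.stronglyMeasurable.integral_prod_right'.aestronglyMeasurable, integral_uniformOn_univ]
  refine Finset.expect_congr rfl fun ω _ => ?_
  have hsection : Continuous fun y => Φ (cubeConfig T n ω, y) := by fun_prop
  rw [toMeasure_signSumImage, integral_map (measurable_of_finite _).aemeasurable
    hsection.aestronglyMeasurable, integral_uniformOn_univ]

lemma tendsto_expect_expect_cubeConfig (T : C(ℝ, ℝ≥0)) {Φ : (ι → ℝ≥0) × ℝ≥0 → ℝ}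
    (hΦ : Continuous Φ) {C : ℝ} (hC : ∀ p, |Φ p| ≤ C) :
    Tendsto (fun n : ℕ => 𝔼 ω : ι → Fin n → Bool, 𝔼 b : Fin n → Bool,
      Φ (cubeConfig T n ω, T (signSum n b))) atTop
      (𝓝 (∫ x, ∫ y, Φ (x, y) ∂(gaussImage T : Measure ℝ≥0)
        ∂(Measure.pi fun _ : ι => (gaussImage T : Measure ℝ≥0)))) := by
  have hpi : Tendsto (fun n => ProbabilityMeasure.pi fun _ : ι => signSumImage T n) atTop
      (𝓝 (ProbabilityMeasure.pi fun _ : ι => gaussImage T)) :=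
    (ProbabilityMeasure.continuous_pi.tendsto _).comp
      (tendsto_pi_nhds.2 fun _ => tendsto_signSumImage T)
  have hprod := (ProbabilityMeasure.continuous_prod.tendsto
    (ProbabilityMeasure.pi (fun _ : ι => gaussImage T), gaussImage T)).comp
      (hpi.prodMk_nhds (tendsto_signSumImage T))
  let Ψ := BoundedContinuousFunction.ofNormedAddCommGroup Φ hΦ C hC
  have hfubini (ρ : ProbabilityMeasure ℝ≥0) :
      ∫ p, Ψ p ∂((ProbabilityMeasure.pi fun _ : ι => ρ).prod ρ : Measure _) =
        ∫ x, ∫ y, Φ (x, y) ∂(ρ : Measure ℝ≥0) ∂(Measure.pi fun _ : ι => (ρ : Measure ℝ≥0)) := by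
    rw [ProbabilityMeasure.toMeasure_prod, ProbabilityMeasure.toMeasure_pi]
    exact integral_prod _ (Ψ.integrable _)
  have hlim := ProbabilityMeasure.tendsto_iff_forall_integral_tendsto.1 hprod Ψ
  simp only [comp_apply, hfubini] at hlim
  exact hlim.congr fun n => integral_pi_prod_signSumImage T n hΦ

lemma tendsto_expect_cubeConfig (T : C(ℝ, ℝ≥0)) {Φ : (ι → ℝ≥0) → ℝ} (hΦ : Continuous Φ)
    {C : ℝ} (hC : ∀ p, |Φ p| ≤ C) :
    Tendsto (fun n : ℕ => 𝔼 ω : ι → Fin n → Bool, Φ (cubeConfig T n ω)) atTop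
      (𝓝 (∫ x, Φ x ∂(Measure.pi fun _ : ι => (gaussImage T : Measure ℝ≥0)))) := by
  simpa using tendsto_expect_expect_cubeConfig T (Φ := fun p : (ι → ℝ≥0) × ℝ≥0 => Φ p.1)
    (hΦ.comp continuous_fst) fun p => hC p.1

end CubeLimit

section UpperGradient

variable {ι : Type*} [DecidableEq ι]

/-- `G` is monotone, and `w x e ∈ [0, 1]` bounds its slope at `x` in the upward direction `e`; the
slope vanishes in the directions `e` with `x e > M`. -/
structure UpperGradient (G : (ι → ℝ≥0) → ℝ) (w : (ι → ℝ≥0) → ι → ℝ) (M : ℝ) : Prop where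
  nonneg : ∀ x e, 0 ≤ w x e
  le_one : ∀ x e, w x e ≤ 1
  le_bound : ∀ x e, w x e ≠ 0 → (x e : ℝ) ≤ M
  mono : ∀ x e y, x e ≤ y → G x ≤ G (update x e y)
  le_add : ∀ x e y, x e ≤ y → G (update x e y) ≤ G x + w x e * (y - x e)

lemma abs_exp_sub_one_le_mul_exp (t : ℝ) : |Real.exp t - 1| ≤ |t| * Real.exp |t| := by
  rcases le_total 0 t with ht | ht
  · rw [abs_of_nonneg ht, abs_of_nonneg (sub_nonneg.2 (Real.one_le_exp ht))]
    have h := mul_le_mul_of_nonneg_left (Real.add_one_le_exp (-t)) (Real.exp_pos t).le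
    rw [← Real.exp_add, add_neg_cancel, Real.exp_zero] at h
    linarith
  · rw [abs_of_nonpos ht, abs_of_nonpos (sub_nonpos.2 (Real.exp_le_one_iff.2 ht))]
    have h := le_mul_of_one_le_right (neg_nonneg.2 ht) (Real.one_le_exp (neg_nonneg.2 ht))
    linarith [Real.add_one_le_exp t]

lemma abs_exp_sub_exp_le (a b : ℝ) :
    |Real.exp b - Real.exp a| ≤ |b - a| * Real.exp |b - a| * Real.exp a := by
  have hfactor : Real.exp b - Real.exp a = (Real.exp (b - a) - 1) * Real.exp a := by
    rw [sub_mul, ← Real.exp_add, sub_add_cancel, one_mul]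
  rw [hfactor, abs_mul, abs_of_pos (Real.exp_pos a)]
  gcongr
  exact abs_exp_sub_one_le_mul_exp _

/-- The increment of `f` when the coordinate `e` of `x` is raised to `y`; it is `0` if `y ≤ x e`. -/
def upIncr (f : (ι → ℝ≥0) → ℝ) (x : ι → ℝ≥0) (e : ι) (y : ℝ≥0) : ℝ :=
  f (update x e (max y (x e))) - f x

lemma upIncr_of_le {f : (ι → ℝ≥0) → ℝ} {x : ι → ℝ≥0} {e : ι} {y : ℝ≥0} (h : y ≤ x e) :
    upIncr f x e y = 0 := by
  simp [upIncr, max_eq_right h]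

lemma upIncr_of_ge {f : (ι → ℝ≥0) → ℝ} {x : ι → ℝ≥0} {e : ι} {y : ℝ≥0} (h : x e ≤ y) :
    upIncr f x e y = f (update x e y) - f x := by
  simp only [upIncr, max_eq_left h]

lemma abs_sub_eq_abs_upIncr_add (f : (ι → ℝ≥0) → ℝ) (x : ι → ℝ≥0) (e : ι) (y : ℝ≥0) :
    |f (update x e y) - f x| = |upIncr f x e y| + |upIncr f (update x e y) e (x e)| := by
  rcases le_total (x e) y with h | h
  · simp [upIncr_of_ge h, upIncr_of_le, h]
  · simp [upIncr_of_le h, upIncr_of_ge, h, abs_sub_comm]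

lemma sub_sq_eq_upIncr_sq_add (f : (ι → ℝ≥0) → ℝ) (x : ι → ℝ≥0) (e : ι) (y : ℝ≥0) :
    (f (update x e y) - f x) ^ 2 = upIncr f x e y ^ 2 + upIncr f (update x e y) e (x e) ^ 2 := by
  rcases le_total (x e) y with h | h
  · simp [upIncr_of_ge h, upIncr_of_le, h]
  · simp [upIncr_of_le h, upIncr_of_ge, h, sub_sq_comm]

lemma UpperGradient.abs_upIncr_exp_le {G : (ι → ℝ≥0) → ℝ} {w : (ι → ℝ≥0) → ι → ℝ} {M : ℝ}
    (h : UpperGradient G w M) (θ : ℝ) (x : ι → ℝ≥0) (e : ι) (y : ℝ≥0) {δ : ℝ} (hδ_nonneg : 0 ≤ δ)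
    (hδ : (y : ℝ) - x e ≤ δ) :
    |upIncr (fun x => Real.exp (θ / 2 * G x)) x e y| ≤
      |θ| / 2 * (w x e * δ) * Real.exp (|θ| / 2 * δ) * Real.exp (θ / 2 * G x) := by
  have hw : 0 ≤ w x e := h.nonneg x e
  rcases le_total y (x e) with hy | hy
  · rw [upIncr_of_le hy, abs_zero]
    positivity
  have hincrement : |θ / 2 * G (update x e y) - θ / 2 * G x| ≤ |θ| / 2 * (w x e * δ) := by
    rw [← mul_sub, abs_mul, abs_div, abs_two, abs_of_nonneg (sub_nonneg.2 (h.mono x e y hy))]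
    gcongr
    linarith [h.le_add x e y hy, mul_le_mul_of_nonneg_left hδ hw]
  have hslope : |θ| / 2 * (w x e * δ) ≤ |θ| / 2 * δ := by
    gcongr
    exact mul_le_of_le_one_left hδ_nonneg (h.le_one x e)
  rw [upIncr_of_ge hy]
  refine (abs_exp_sub_exp_le _ _).trans ?_
  gcongr
  exact hincrement.trans hslope

end UpperGradient

/-! ### The variance inequality under Gaussian images -/

section GaussianVariance

/-- `ν` is the law of the square of an `L`-Lipschitz function `R ≥ 0` of a standard Gaussian. -/
def IsLipschitzSqGaussian (L : ℝ≥0) (ν : Measure ℝ≥0) : Prop :=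
  ∃ R : ℝ → ℝ≥0, LipschitzWith L R ∧ ν = (gaussianReal 0 1).map fun s => R s ^ 2

variable {ι : Type*} [DecidableEq ι]

lemma UpperGradient.upIncr_exp_sq_le {G : (ι → ℝ≥0) → ℝ} {w : (ι → ℝ≥0) → ι → ℝ} {M : ℝ}
    (h : UpperGradient G w M) {θ : ℝ} (hθ : |θ| ≤ 1) {ε : ℝ} (hε : 0 ≤ ε)
    (hεM : ε * (2 * √M + ε) ≤ 1) {x : ι → ℝ≥0} {e : ι} {y : ℝ≥0} (hy : √y ≤ √(x e) + ε) :
    upIncr (fun x => Real.exp (θ / 2 * G x)) x e y ^ 2 ≤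
      6 * θ ^ 2 * ε ^ 2 * (w x e * (x e + ε ^ 2) * Real.exp (θ / 2 * G x) ^ 2) := by
  set r := √(x e : ℝ)
  have hxr : (x e : ℝ) = r ^ 2 := (Real.sq_sqrt (x e).2).symm
  have hyr : (y : ℝ) ≤ (r + ε) ^ 2 :=
    (Real.sq_sqrt y.2).symm.trans_le (pow_le_pow_left₀ (Real.sqrt_nonneg _) hy 2)
  set δ := ε * (2 * r + ε) with hδ
  have hincrement : (y : ℝ) - x e ≤ δ := by linarith
  have hbound := h.abs_upIncr_exp_le θ x e y (by positivity) hincrement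
  have hw := h.nonneg x e
  rcases eq_or_ne (w x e) 0 with hw0 | hw0
  · have hzero : upIncr (fun x => Real.exp (θ / 2 * G x)) x e y = 0 := by
      simpa [hw0] using hbound
    simp [hzero, hw0]
  have hδ_le_one : δ ≤ 1 := by
    have hr : r ≤ √M := Real.sqrt_le_sqrt (h.le_bound x e hw0)
    exact hεM.trans' (by rw [hδ]; gcongr)
  have hexp : Real.exp (|θ| / 2 * δ) ^ 2 ≤ 3 := by
    rw [← Real.exp_nat_mul]
    refine le_trans (Real.exp_le_exp.2 (?_ : _ ≤ (1 : ℝ))) Real.exp_one_lt_three.le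
    push_cast
    nlinarith [abs_nonneg θ]
  have hδ_sq : δ ^ 2 ≤ ε ^ 2 * (8 * x e + 2 * ε ^ 2) := by
    rw [hδ, hxr, mul_pow]
    gcongr
    nlinarith [sq_nonneg (2 * r - ε)]
  set f := Real.exp (θ / 2 * G x)
  calc upIncr (fun x => Real.exp (θ / 2 * G x)) x e y ^ 2
      ≤ (|θ| / 2 * (w x e * δ) * Real.exp (|θ| / 2 * δ) * f) ^ 2 := by
        rw [← sq_abs (upIncr ..)]
        gcongr
    _ = θ ^ 2 / 4 * (w x e * w x e) * δ ^ 2 * Real.exp (|θ| / 2 * δ) ^ 2 * f ^ 2 := by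
        rw [← sq_abs θ]; ring
    _ ≤ θ ^ 2 / 4 * (w x e * 1) * (ε ^ 2 * (8 * x e + 2 * ε ^ 2)) * 3 * f ^ 2 := by
        gcongr
        exact h.le_one x e
    _ ≤ 6 * θ ^ 2 * ε ^ 2 * (w x e * (x e + ε ^ 2) * f ^ 2) := by
        have : 0 ≤ θ ^ 2 * w x e * ε ^ 2 * ε ^ 2 * f ^ 2 := by positivity
        linarith

variable [Fintype ι]

lemma expect_coordMove_flipBit (n : ℕ) (p : ι × Fin n × Unit) (Φ : (ι → Fin n → Bool) → ℝ) :
    𝔼 ω, Φ (coordMove (flipBit n) p ω) = 𝔼 ω, Φ ω := by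
  refine Finset.expect_nbij' (coordMove (flipBit n) p) (coordMove (flipBit n) p) ?_ ?_ ?_ ?_ ?_ <;>
    simp [coordMove, flipBit_flipBit]

-- Exchanging the old and the new value of a coordinate preserves the uniform law, so the downward
-- increments contribute as much as the upward ones.
lemma expect_expect_abs_sub_cubeConfig_update (T : ℝ → ℝ≥0) (n : ℕ) (f : (ι → ℝ≥0) → ℝ) (e : ι) :
    𝔼 ω : ι → Fin n → Bool, 𝔼 b, |f (cubeConfig T n ω) - f (cubeConfig T n (update ω e b))| =
      2 * 𝔼 ω : ι → Fin n → Bool, 𝔼 b : Fin n → Bool,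
        |upIncr f (cubeConfig T n ω) e (T (signSum n b))| := by
  let Φ (ω : ι → Fin n → Bool) (b : Fin n → Bool) : ℝ :=
    |upIncr f (cubeConfig T n ω) e (T (signSum n b))|
  have hsplit (ω b) : |f (cubeConfig T n ω) - f (cubeConfig T n (update ω e b))| =
      Φ ω b + Φ (update ω e b) (ω e) := by
    rw [abs_sub_comm]
    simp only [Φ, cubeConfig_update]
    exact abs_sub_eq_abs_upIncr_add f _ e _
  simp only [hsplit, Finset.expect_add_distrib, expect_expect_update_swap]
  exact (two_mul _).symm

lemma energy_coordMove_flipBit (T : ℝ → ℝ≥0) (n : ℕ) (f : (ι → ℝ≥0) → ℝ) (e : ι)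
    (k : Fin n × Unit) :
    energy (coordMove (flipBit n) (e, k)) (fun ω => f (cubeConfig T n ω)) =
      2 * 𝔼 ω, upIncr f (cubeConfig T n ω) e (T (signSum n (flipBit n k (ω e)))) ^ 2 := by
  let Φ (ω : ι → Fin n → Bool) : ℝ :=
    upIncr f (cubeConfig T n ω) e (T (signSum n (flipBit n k (ω e)))) ^ 2
  have hsplit (ω) : (f (cubeConfig T n (coordMove (flipBit n) (e, k) ω)) - f (cubeConfig T n ω)) ^ 2
      = Φ ω + Φ (coordMove (flipBit n) (e, k) ω) := by
    simp only [Φ, coordMove, cubeConfig_update, update_self, flipBit_flipBit]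
    exact sub_sq_eq_upIncr_sq_add f _ e _
  simp only [energy, hsplit, Finset.expect_add_distrib, expect_coordMove_flipBit n (e, k) Φ]
  exact (two_mul _).symm

variable {L : ℝ≥0} {R : ℝ → ℝ≥0} {G : (ι → ℝ≥0) → ℝ} {w : (ι → ℝ≥0) → ι → ℝ} {M : ℝ}

lemma UpperGradient.energy_exp_le (h : UpperGradient G w M) (hR : LipschitzWith L R) {θ : ℝ}
    (hθ : |θ| ≤ 1) {n : ℕ} {ε : ℝ} (hε : ε = 2 * L * (√n)⁻¹) (hεM : ε * (2 * √M + ε) ≤ 1)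
    (e : ι) (k : Fin n × Unit) :
    energy (coordMove (flipBit n) (e, k))
        (fun ω => Real.exp (θ / 2 * G (cubeConfig (fun s => R s ^ 2) n ω))) ≤
      12 * θ ^ 2 * ε ^ 2 * 𝔼 ω, w (cubeConfig (fun s => R s ^ 2) n ω) e *
        (cubeConfig (fun s => R s ^ 2) n ω e + ε ^ 2) *
        Real.exp (θ / 2 * G (cubeConfig (fun s => R s ^ 2) n ω)) ^ 2 := by
  rw [energy_coordMove_flipBit _ n (fun x => Real.exp (θ / 2 * G x)),
    show 12 * θ ^ 2 * ε ^ 2 = 2 * (6 * θ ^ 2 * ε ^ 2) by ring, mul_assoc 2]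
  gcongr 2 * ?_
  rw [Finset.mul_expect]
  refine Finset.expect_le_expect fun ω _ => ?_
  refine h.upIncr_exp_sq_le hθ (by rw [hε]; positivity) hεM ?_
  have hstep : |(R (signSum n (flipBit n k (ω e))) : ℝ) - R (signSum n (ω e))| ≤ ε := by
    rw [hε, mul_comm 2 (L : ℝ), mul_assoc]
    refine (hR.dist_le_mul _ _).trans ?_
    gcongr
    exact abs_signSum_flipBit_sub_le n k (ω e)
  simp only [cubeConfig, NNReal.coe_pow, Real.sqrt_sq NNReal.zero_le_coe]
  linarith [le_abs_self ((R (signSum n (flipBit n k (ω e))) : ℝ) - R (signSum n (ω e)))]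

lemma UpperGradient.sum_energy_exp_le (h : UpperGradient G w M) (hR : LipschitzWith L R)
    (hsum : ∀ x, ∑ e, w x e * x e ≤ G x) {θ : ℝ} (hθ : |θ| ≤ 1) {n : ℕ} {ε : ℝ}
    (hε : ε = 2 * L * (√n)⁻¹) (hεM : ε * (2 * √M + ε) ≤ 1) :
    ∑ p : ι × Fin n × Unit, energy (coordMove (flipBit n) p)
        (fun ω => Real.exp (θ / 2 * G (cubeConfig (fun s => R s ^ 2) n ω))) ≤
      48 * θ ^ 2 * L ^ 2 * 𝔼 ω : ι → Fin n → Bool,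
        (G (cubeConfig (fun s => R s ^ 2) n ω) + Fintype.card ι * ε ^ 2) *
          Real.exp (θ / 2 * G (cubeConfig (fun s => R s ^ 2) n ω)) ^ 2 := by
  have hscale : (n : ℝ) * ε ^ 2 ≤ 4 * (L : ℝ) ^ 2 :=
    calc (n : ℝ) * ε ^ 2 = 4 * (L : ℝ) ^ 2 * (n * (n : ℝ)⁻¹) := by
          rw [hε, mul_pow, inv_pow, Real.sq_sqrt n.cast_nonneg]; ring
      _ ≤ 4 * (L : ℝ) ^ 2 := mul_le_of_le_one_right (by positivity) mul_inv_le_one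
  have hweights (x : ι → ℝ≥0) : ∑ e, w x e * (x e + ε ^ 2) ≤ G x + Fintype.card ι * ε ^ 2 := by
    simp only [mul_add, Finset.sum_add_distrib, ← Finset.sum_mul]
    gcongr
    · exact hsum x
    · simpa using Finset.sum_le_card_nsmul Finset.univ (w x) 1 fun e _ => h.le_one x e
  let x (ω : ι → Fin n → Bool) : ι → ℝ≥0 := cubeConfig (fun s => R s ^ 2) n ω
  calc ∑ p : ι × Fin n × Unit, energy (coordMove (flipBit n) p)
        (fun ω => Real.exp (θ / 2 * G (x ω)))
      ≤ ∑ p : ι × Fin n × Unit, 12 * θ ^ 2 * ε ^ 2 *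
          𝔼 ω, w (x ω) p.1 * (x ω p.1 + ε ^ 2) * Real.exp (θ / 2 * G (x ω)) ^ 2 :=
        Finset.sum_le_sum fun p _ => h.energy_exp_le hR hθ hε hεM p.1 p.2
    _ = 12 * θ ^ 2 * (n * ε ^ 2) *
          𝔼 ω, (∑ e, w (x ω) e * (x ω e + ε ^ 2)) * Real.exp (θ / 2 * G (x ω)) ^ 2 := by
        simp only [Fintype.sum_prod_type, Finset.sum_const, Finset.card_univ, Fintype.card_prod,
          Fintype.card_fin, Fintype.card_unit, mul_one, nsmul_eq_mul, ← Finset.mul_sum,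
          Finset.sum_mul, Finset.expect_sum_comm]
        ring
    _ ≤ 12 * θ ^ 2 * (4 * L ^ 2) * 𝔼 ω, (G (x ω) + Fintype.card ι * ε ^ 2) *
          Real.exp (θ / 2 * G (x ω)) ^ 2 := by
        gcongr with ω
        · exact Finset.expect_nonneg fun ω _ => mul_nonneg
            (Finset.sum_nonneg fun e _ => mul_nonneg (h.nonneg _ e) (by positivity)) (sq_nonneg _)
        · exact hweights (x ω)
    _ = 48 * θ ^ 2 * L ^ 2 * 𝔼 ω, (G (x ω) + Fintype.card ι * ε ^ 2) *
          Real.exp (θ / 2 * G (x ω)) ^ 2 := by ring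

/-- The variance inequality for `exp (θ G / 2)` under a product of squares of Lipschitz functions of
a Gaussian, in the discrete form before the limit in the number `n` of bits. -/
lemma UpperGradient.variance_exp_cubeConfig_le (h : UpperGradient G w M) (hR : LipschitzWith L R)
    (hsum : ∀ x, ∑ e, w x e * x e ≤ G x) {θ : ℝ} (hθ : |θ| ≤ 1) {σ : ℝ} (hσ : 0 < σ) {n : ℕ}
    {ε : ℝ} (hε : ε = 2 * L * (√n)⁻¹) (hεM : ε * (2 * √M + ε) ≤ 1)
    {x : (ι → Fin n → Bool) → ι → ℝ≥0} (hx : x = cubeConfig (fun s => R s ^ 2) n) :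
    ((𝔼 ω, Real.exp (θ / 2 * G (x ω)) ^ 2) - (𝔼 ω, Real.exp (θ / 2 * G (x ω))) ^ 2) *
        (1 - Real.log σ) -
      σ⁻¹ * ∑ e, (2 * 𝔼 ω, 𝔼 b, |upIncr (fun x => Real.exp (θ / 2 * G x)) (x ω) e
        (R (signSum n b) ^ 2)|) ^ 2 ≤
    48 * θ ^ 2 * L ^ 2 * ((𝔼 ω, G (x ω) * Real.exp (θ / 2 * G (x ω)) ^ 2) +
      Fintype.card ι * ε ^ 2 * 𝔼 ω, Real.exp (θ / 2 * G (x ω)) ^ 2) := by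
  have hvar := (logSobolev_flipBit n).variance_le (fun ω => Real.exp (θ / 2 * G (x ω))) hσ
  subst hx
  simp only [expect_expect_abs_sub_cubeConfig_update _ n fun x => Real.exp (θ / 2 * G x)] at hvar
  refine hvar.trans ((h.sum_energy_exp_le hR hsum hθ hε hεM).trans_eq ?_)
  simp only [add_mul, Finset.expect_add_distrib, ← Finset.mul_expect]

lemma tendsto_const_mul_inv_sqrt (c : ℝ) : Tendsto (fun n : ℕ => c * (√n)⁻¹) atTop (𝓝 0) := by
  simpa using (tendsto_inv_atTop_zero.comp
    (Real.tendsto_sqrt_atTop.comp tendsto_natCast_atTop_atTop)).const_mul c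

lemma abs_exp_half_mul_le {θ g : ℝ} (hθ : |θ| ≤ 1) (hg : 0 ≤ g) (hgM : g ≤ M) :
    |Real.exp (θ / 2 * g)| ≤ Real.exp M := by
  rw [Real.abs_exp, Real.exp_le_exp]
  nlinarith [(abs_le.1 hθ).2]

theorem UpperGradient.variance_exp_le {ν : Measure ℝ≥0} (hν : IsLipschitzSqGaussian L ν)
    (hG : Continuous G) (hG_nonneg : ∀ x, 0 ≤ G x) (hG_le : ∀ x, G x ≤ M)
    (h : UpperGradient G w M) (hsum : ∀ x, ∑ e, w x e * x e ≤ G x) {θ : ℝ} (hθ : |θ| ≤ 1)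
    {σ : ℝ} (hσ : 0 < σ) :
    ((∫ x, Real.exp (θ / 2 * G x) ^ 2 ∂(Measure.pi fun _ : ι => ν)) -
        (∫ x, Real.exp (θ / 2 * G x) ∂(Measure.pi fun _ : ι => ν)) ^ 2) * (1 - Real.log σ) -
      σ⁻¹ * ∑ e, (2 * ∫ x, ∫ y, |upIncr (fun x => Real.exp (θ / 2 * G x)) x e y| ∂ν
        ∂(Measure.pi fun _ : ι => ν)) ^ 2 ≤
    48 * θ ^ 2 * L ^ 2 *
      ∫ x, G x * Real.exp (θ / 2 * G x) ^ 2 ∂(Measure.pi fun _ : ι => ν) := by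
  obtain ⟨R, hR, rfl⟩ := hν
  let T : C(ℝ, ℝ≥0) := ⟨fun s => R s ^ 2, hR.continuous.pow 2⟩
  have hf : Continuous fun x => Real.exp (θ / 2 * G x) := by fun_prop
  have hf_le (x) := abs_exp_half_mul_le hθ (hG_nonneg x) (hG_le x)
  have hf_sq_le (x) : |Real.exp (θ / 2 * G x) ^ 2| ≤ Real.exp M ^ 2 :=
    (abs_pow _ 2).trans_le (pow_le_pow_left₀ (abs_nonneg _) (hf_le x) 2)
  have hGf_le (x) : |G x * Real.exp (θ / 2 * G x) ^ 2| ≤ M * Real.exp M ^ 2 := by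
    rw [abs_mul, abs_of_nonneg (hG_nonneg x)]
    exact mul_le_mul (hG_le x) (hf_sq_le x) (abs_nonneg _) ((hG_nonneg x).trans (hG_le x))
  have hincr_le (p : (ι → ℝ≥0) × ℝ≥0) (e : ι) :
      |(|upIncr (fun x => Real.exp (θ / 2 * G x)) p.1 e p.2|)| ≤ Real.exp M + Real.exp M :=
    (abs_abs _).trans_le ((abs_sub _ _).trans (add_le_add (hf_le _) (hf_le _)))
  have hlim_sq := tendsto_expect_cubeConfig T (hf.pow 2) hf_sq_le
  have hlim_mean := tendsto_expect_cubeConfig T hf hf_le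
  have hlim_incr (e : ι) := tendsto_expect_expect_cubeConfig T
    (Φ := fun p => |upIncr (fun x => Real.exp (θ / 2 * G x)) p.1 e p.2|)
    (by unfold upIncr; fun_prop) fun p => hincr_le p e
  have hlim_rhs := tendsto_expect_cubeConfig T (hG.mul (hf.pow 2)) hGf_le
  have hlim_ε := tendsto_const_mul_inv_sqrt (2 * L)
  have hlim_left := ((hlim_sq.sub (hlim_mean.pow 2)).mul_const (1 - Real.log σ)).sub
    ((tendsto_finsetSum Finset.univ fun e _ => ((hlim_incr e).const_mul 2).pow 2).const_mul σ⁻¹)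
  have hlim_right := (hlim_rhs.add (((hlim_ε.pow 2).const_mul (Fintype.card ι : ℝ)).mul
    hlim_sq)).const_mul (48 * θ ^ 2 * L ^ 2)
  have hsmall : ∀ᶠ n : ℕ in atTop, 2 * L * (√n)⁻¹ * (2 * √M + 2 * L * (√n)⁻¹) ≤ 1 := by
    have hlim := hlim_ε.mul (hlim_ε.const_add (2 * √M))
    rw [zero_mul] at hlim
    exact hlim.eventually_le_const one_pos
  have hlimit := le_of_tendsto_of_tendsto hlim_left hlim_right
    (hsmall.mono fun n hn => h.variance_exp_cubeConfig_le hR hsum hθ hσ rfl hn rfl)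
  simp only [ne_eq, OfNat.ofNat_ne_zero, not_false_eq_true, zero_pow, mul_zero, zero_mul,
    add_zero] at hlimit
  exact hlimit

end GaussianVariance

/-! ### Nearly gamma laws as images of a Gaussian -/

section Transport

lemma gaussDensity_pos (x : ℝ) : 0 < gaussDensity x := gaussianPDFReal_pos 0 1 x one_ne_zero

lemma gaussCDF_eq_integral (x : ℝ) : gaussCDF x = ∫ t in Set.Iic x, gaussDensity t := by
  rw [gaussCDF, cdf_eq_real, measureReal_def, gaussianReal_apply_eq_integral 0 one_ne_zero,
    ENNReal.toReal_ofReal]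
  · rfl
  · exact setIntegral_nonneg measurableSet_Iic fun t _ => gaussianPDFReal_nonneg 0 1 t

lemma hasDerivAt_gaussCDF (x : ℝ) : HasDerivAt gaussCDF (gaussDensity x) x := by
  have hint : Integrable gaussDensity := integrable_gaussianPDFReal 0 1
  have hcont : Continuous gaussDensity := by
    unfold gaussDensity; rw [gaussianPDFReal_def]; fun_prop
  have hFTC : gaussCDF = fun y => gaussCDF 0 + ∫ t in (0 : ℝ)..y, gaussDensity t := by
    funext y
    rw [gaussCDF_eq_integral y, gaussCDF_eq_integral 0,
      ← intervalIntegral.integral_Iic_sub_Iic hint.integrableOn hint.integrableOn]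
    ring
  rw [hFTC]
  exact (intervalIntegral.integral_hasDerivAt_right hint.intervalIntegrable
    (hcont.stronglyMeasurableAtFilter _ _) hcont.continuousAt).const_add _

lemma continuous_gaussCDF : Continuous gaussCDF :=
  continuous_iff_continuousAt.2 fun x => (hasDerivAt_gaussCDF x).continuousAt

lemma strictMono_gaussCDF : StrictMono gaussCDF :=
  strictMono_of_deriv_pos fun x => by
    rw [(hasDerivAt_gaussCDF x).deriv]; exact gaussDensity_pos x

lemma gaussCDF_pos (x : ℝ) : 0 < gaussCDF x :=
  (cdf_nonneg _ (x - 1)).trans_lt (strictMono_gaussCDF (sub_one_lt x))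

lemma gaussCDF_lt_one (x : ℝ) : gaussCDF x < 1 :=
  (strictMono_gaussCDF (lt_add_one x)).trans_le (cdf_le_one _ (x + 1))

lemma exists_cdf_eq {ρ : Measure ℝ} (hρ : Continuous (cdf ρ)) {u : ℝ} (hu_pos : 0 < u)
    (hu_lt : u < 1) : ∃ y, cdf ρ y = u := by
  obtain ⟨a, ha⟩ := ((tendsto_cdf_atBot ρ).eventually_lt_const hu_pos).exists
  obtain ⟨b, hb⟩ := ((tendsto_cdf_atTop ρ).eventually_const_lt hu_lt).exists
  exact mem_range_of_exists_le_of_exists_ge hρ ⟨a, ha.le⟩ ⟨b, hb.le⟩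

lemma gaussCDF_invFun {u : ℝ} (hu_pos : 0 < u) (hu_lt : u < 1) :
    gaussCDF (invFun gaussCDF u) = u :=
  invFun_eq (exists_cdf_eq continuous_gaussCDF hu_pos hu_lt)

lemma invFun_gaussCDF (s : ℝ) : invFun gaussCDF (gaussCDF s) = s :=
  leftInverse_invFun strictMono_gaussCDF.injective s

lemma hasDerivAt_invFun_gaussCDF {u : ℝ} (hu_pos : 0 < u) (hu_lt : u < 1) :
    HasDerivAt (invFun gaussCDF) (gaussDensity (invFun gaussCDF u))⁻¹ u := by
  have hinv : ∀ᶠ v in 𝓝 u, gaussCDF (invFun gaussCDF v) = v := by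
    filter_upwards [Ioo_mem_nhds hu_pos hu_lt] with v hv
    exact gaussCDF_invFun hv.1 hv.2
  have hrange : (Set.range gaussCDF).OrdConnected :=
    (isPreconnected_range continuous_gaussCDF).ordConnected
  have hcont : ContinuousAt (invFun gaussCDF) u := by
    rw [(strictMono_gaussCDF.isEmbedding_of_ordConnected hrange).continuousAt_iff]
    exact continuousAt_id.congr (hinv.mono fun v hv => hv.symm)
  exact HasDerivAt.of_local_left_inverse hcont (hasDerivAt_gaussCDF _)
    (gaussDensity_pos _).ne' hinv

lemma strictMono_of_cdf_comp_eq {ρ : Measure ℝ} {T : ℝ → ℝ}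
    (hT : ∀ s, cdf ρ (T s) = gaussCDF s) : StrictMono T := fun s s' hs =>
  (monotone_cdf ρ).reflect_lt (by rw [hT, hT]; exact strictMono_gaussCDF hs)

lemma map_gaussianReal_eq_of_cdf_comp_eq {ρ : Measure ℝ} [IsProbabilityMeasure ρ] {T : ℝ → ℝ}
    (hT : ∀ s, cdf ρ (T s) = gaussCDF s) : (gaussianReal 0 1).map T = ρ := by
  have hTm : Measurable T := (strictMono_of_cdf_comp_eq hT).monotone.measurable
  have : IsProbabilityMeasure ((gaussianReal 0 1).map T) :=
    Measure.isProbabilityMeasure_map hTm.aemeasurable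
  have : NullSingletonClass (gaussianReal 0 1) := nullSingletonClass_gaussianReal one_ne_zero
  have hle {u y : ℝ} (h : T u ≤ y) : gaussCDF u ≤ cdf ρ y := hT u ▸ monotone_cdf ρ h
  have hlt {u y : ℝ} (h : gaussCDF u < cdf ρ y) : T u < y :=
    (monotone_cdf ρ).reflect_lt (by rwa [hT])
  refine Measure.eq_of_cdf _ _ ?_
  ext y
  rw [cdf_eq_real, map_measureReal_apply hTm measurableSet_Iic]
  rcases (cdf_nonneg ρ y).eq_or_lt with hy_pos | hy_pos
  · have hempty : T ⁻¹' Set.Iic y = ∅ :=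
      Set.eq_empty_of_forall_notMem fun u hu => ((gaussCDF_pos u).trans_le (hle hu)).ne hy_pos
    simp [hempty, ← hy_pos]
  rcases (cdf_le_one ρ y).eq_or_lt with hy_lt | hy_lt
  · have huniv : T ⁻¹' Set.Iic y = Set.univ :=
      Set.eq_univ_of_forall fun u => (hlt (hy_lt ▸ gaussCDF_lt_one u)).le
    simp [huniv, hy_lt]
  obtain ⟨s, hs⟩ : ∃ s, gaussCDF s = cdf ρ y := exists_cdf_eq continuous_gaussCDF hy_pos hy_lt
  have hlower : Set.Iio s ⊆ T ⁻¹' Set.Iic y := fun u hu =>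
    (hlt (hs ▸ strictMono_gaussCDF hu)).le
  have hupper : T ⁻¹' Set.Iic y ⊆ Set.Iic s := fun u hu =>
    strictMono_gaussCDF.le_iff_le.1 ((hle hu).trans_eq hs.symm)
  have hae : T ⁻¹' Set.Iic y =ᵐ[gaussianReal 0 1] Set.Iic s :=
    (LE.le.eventuallyLE hupper).antisymm
      (Iio_ae_eq_Iic.symm.le.trans (LE.le.eventuallyLE hlower))
  rw [measureReal_congr hae, ← cdf_eq_real, ← hs, gaussCDF]

/-- The law of `ν` seen on the real line. -/
noncomputable abbrev realLaw (ν : Measure ℝ≥0) : Measure ℝ := ν.map fun x : ℝ≥0 => (x : ℝ)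

variable {ν : Measure ℝ≥0} {h : ℝ → ℝ}

instance isProbabilityMeasure_realLaw [IsProbabilityMeasure ν] :
    IsProbabilityMeasure (realLaw ν) :=
  Measure.isProbabilityMeasure_map (by fun_prop)

lemma map_toNNReal_realLaw (ν : Measure ℝ≥0) : (realLaw ν).map Real.toNNReal = ν := by
  rw [realLaw, Measure.map_map (by fun_prop) (by fun_prop)]
  convert Measure.map_id
  ext x
  simp

lemma IsDensity.exists_mem_posSet (hd : IsDensity ν h) {s : Set ℝ} (hs : MeasurableSet s)
    (hs_ne : realLaw ν s ≠ 0) : ∃ t ∈ s, t ∈ posSet h := by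
  contrapose! hs_ne
  rw [realLaw, hd.map_eq, withDensity_apply _ hs, Measure.restrict_restrict hs,
    setLIntegral_congr_fun (hs.inter measurableSet_Ici) (g := fun _ => 0), lintegral_zero]
  intro t ht
  have hle : h t ≤ 0 := not_lt.1 fun hpos => hs_ne t ht.1 ⟨ht.2, hpos⟩
  simpa using hle

lemma IsDensity.integrableOn [IsProbabilityMeasure ν] (hd : IsDensity ν h) :
    IntegrableOn h (Set.Ici 0) := by
  refine ⟨hd.measurable.aestronglyMeasurable, ?_⟩
  have hmass : realLaw ν Set.univ = 1 := measure_univ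
  rw [realLaw, hd.map_eq, withDensity_apply _ MeasurableSet.univ, Measure.restrict_univ] at hmass
  rw [hasFiniteIntegral_iff_ofReal (ae_of_all _ hd.nonneg), hmass]
  exact ENNReal.one_lt_top

lemma IsDensity.nullSingletonClass (hd : IsDensity ν h) : NullSingletonClass (realLaw ν) := by
  refine ⟨fun x => ?_⟩
  rw [realLaw, hd.map_eq]
  exact withDensity_absolutelyContinuous _ _ (by simp)

lemma IsNearlyGamma.measure_zero (hν : IsNearlyGamma ν) : ν {0} = 0 := by
  obtain ⟨h, hd, -⟩ := hν
  have := hd.nullSingletonClass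
  have hreal : realLaw ν {0} = 0 := measure_singleton 0
  rw [realLaw, Measure.map_apply (by fun_prop) (MeasurableSet.singleton _)] at hreal
  convert hreal using 2
  ext x
  simp

variable [IsProbabilityMeasure ν]

lemma IsDensity.cdf_eq (hd : IsDensity ν h) {y : ℝ} (hy : 0 ≤ y) :
    cdf (realLaw ν) y = distFun h y := by
  rw [cdf_eq_real, measureReal_def, realLaw, hd.map_eq, withDensity_apply _ measurableSet_Iic,
    Measure.restrict_restrict measurableSet_Iic, distFun, intervalIntegral.integral_of_le hy,
    ← integral_Icc_eq_integral_Ioc, integral_eq_lintegral_of_nonneg_ae (ae_of_all _ hd.nonneg)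
      hd.measurable.aestronglyMeasurable, Set.inter_comm, Set.Ici_inter_Iic]

lemma IsDensity.continuous_cdf (hd : IsDensity ν h) : Continuous (cdf (realLaw ν)) := by
  have := hd.nullSingletonClass
  refine continuous_iff_continuousAt.2 fun x => ?_
  have hatom : (cdf (realLaw ν)).measure {x} = 0 := by
    rw [measure_cdf]; exact measure_singleton x
  rw [StieltjesFunction.measure_singleton, ENNReal.ofReal_eq_zero, sub_nonpos] at hatom
  refine (cdf (realLaw ν)).mono.continuousAt_iff_leftLim_eq_rightLim.2 ?_
  rw [StieltjesFunction.rightLim_eq]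
  exact le_antisymm ((cdf (realLaw ν)).mono.leftLim_le le_rfl) hatom

lemma cdf_realLaw_of_neg {y : ℝ} (hy : y < 0) : cdf (realLaw ν) y = 0 := by
  have hempty : (fun x : ℝ≥0 => (x : ℝ)) ⁻¹' Set.Iic y = ∅ :=
    Set.eq_empty_of_forall_notMem fun x hx => (hy.trans_le x.2).not_ge hx
  rw [cdf_eq_real, map_measureReal_apply (by fun_prop) measurableSet_Iic, hempty,
    measureReal_empty]

lemma IsDensity.pos_of_cdf_pos (hd : IsDensity ν h) {y : ℝ} (hy : 0 < cdf (realLaw ν) y) :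
    0 < y := by
  contrapose! hy
  rcases hy.eq_or_lt with rfl | hneg
  · simp [hd.cdf_eq le_rfl, distFun]
  · exact (cdf_realLaw_of_neg hneg).le

lemma IsDensity.posSet_mem_nhds (hd : IsDensity ν h) (hI : (posSet h).OrdConnected) {y : ℝ}
    (hy_pos : 0 < cdf (realLaw ν) y) (hy_lt : cdf (realLaw ν) y < 1) : posSet h ∈ 𝓝 y := by
  have := hd.nullSingletonClass
  have hbelow : realLaw ν (Set.Iio y) ≠ 0 := by
    rw [measure_congr (Iio_ae_eq_Iic (μ := realLaw ν)), ← ofReal_cdf]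
    simpa using hy_pos
  have habove : realLaw ν (Set.Ioi y) ≠ 0 := by
    rw [← Set.compl_Iic, prob_compl_eq_one_sub measurableSet_Iic, ← ofReal_cdf]
    simpa [tsub_eq_zero_iff_le] using hy_lt
  obtain ⟨a, hay, haI⟩ := hd.exists_mem_posSet measurableSet_Iio hbelow
  obtain ⟨b, hyb, hbI⟩ := hd.exists_mem_posSet measurableSet_Ioi habove
  exact mem_of_superset (Icc_mem_nhds hay hyb) (hI.out haI hbI)

lemma IsDensity.hasDerivAt_cdf (hd : IsDensity ν h) (hI : (posSet h).OrdConnected)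
    (hc : ContinuousOn h (posSet h)) {y : ℝ} (hy_pos : 0 < cdf (realLaw ν) y)
    (hy_lt : cdf (realLaw ν) y < 1) : HasDerivAt (cdf (realLaw ν)) (h y) y := by
  have hy := hd.pos_of_cdf_pos hy_pos
  have hderiv : HasDerivAt (distFun h) (h y) y :=
    intervalIntegral.integral_hasDerivAt_right
      ((intervalIntegrable_iff_integrableOn_Icc_of_le hy.le).2
        (hd.integrableOn.mono_set Set.Icc_subset_Ici_self))
      hd.measurable.stronglyMeasurable.stronglyMeasurableAtFilter
      (hc.continuousAt (hd.posSet_mem_nhds hI hy_pos hy_lt))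
  refine hderiv.congr_of_eventuallyEq ?_
  filter_upwards [Ioi_mem_nhds hy] with u hu
  exact hd.cdf_eq (le_of_lt hu)

lemma two_div_mul_deriv_sqrt_le_of_psi_le (hd : IsDensity ν h) {A y : ℝ} (hA : 0 < A)
    (hψ : psi h y ≤ A * √y) (hy : y ∈ posSet h) (hy_pos : 0 < cdf (realLaw ν) y)
    (hy_lt : cdf (realLaw ν) y < 1) :
    2 / A * (1 / (2 * √y)) ≤ (gaussDensity (invFun gaussCDF (cdf (realLaw ν) y)))⁻¹ * h y := by
  rw [psi, ← hd.cdf_eq hy.1, gaussProfile, if_pos ⟨hy_pos, hy_lt⟩] at hψ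
  calc 2 / A * (1 / (2 * √y)) = (A * √y)⁻¹ := by field_simp
    _ ≤ (gaussDensity (invFun gaussCDF (cdf (realLaw ν) y)) / h y)⁻¹ :=
        inv_anti₀ (div_pos (gaussDensity_pos _) hy.2) hψ
    _ = _ := by rw [inv_div, div_eq_inv_mul]

/-- The bound on `ψ` says that the derivative of `G⁻¹ ∘ H` dominates that of `(2 / A) √u`. -/
lemma IsDensity.mul_sqrt_sub_sqrt_le (hd : IsDensity ν h) (hI : (posSet h).OrdConnected)
    (hc : ContinuousOn h (posSet h)) {A : ℝ} (hA : 0 < A)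
    (hψ : ∀ y ∈ posSet h, psi h y ≤ A * √y) {y y' : ℝ} (hyy' : y ≤ y')
    (hy_pos : 0 < cdf (realLaw ν) y) (hy'_lt : cdf (realLaw ν) y' < 1) :
    2 / A * (√y' - √y) ≤
      invFun gaussCDF (cdf (realLaw ν) y') - invFun gaussCDF (cdf (realLaw ν) y) := by
  have hpos {u : ℝ} (hu : u ∈ Set.Icc y y') : 0 < cdf (realLaw ν) u :=
    hy_pos.trans_le (monotone_cdf _ hu.1)
  have hlt {u : ℝ} (hu : u ∈ Set.Icc y y') : cdf (realLaw ν) u < 1 :=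
    (monotone_cdf _ hu.2).trans_lt hy'_lt
  have hderiv {u : ℝ} (hu : u ∈ Set.Icc y y') :
      HasDerivAt (fun u => invFun gaussCDF (cdf (realLaw ν) u) - 2 / A * √u)
        ((gaussDensity (invFun gaussCDF (cdf (realLaw ν) u)))⁻¹ * h u -
          2 / A * (1 / (2 * √u))) u :=
    ((hasDerivAt_invFun_gaussCDF (hpos hu) (hlt hu)).comp u
      (hd.hasDerivAt_cdf hI hc (hpos hu) (hlt hu))).sub
      ((Real.hasDerivAt_sqrt (hd.pos_of_cdf_pos (hpos hu)).ne').const_mul (2 / A))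
  have hmono : MonotoneOn (fun u => invFun gaussCDF (cdf (realLaw ν) u) - 2 / A * √u)
      (Set.Icc y y') := by
    refine monotoneOn_of_deriv_nonneg (convex_Icc _ _)
      (fun u hu => (hderiv hu).continuousAt.continuousWithinAt)
      (fun u hu => (hderiv (interior_subset hu)).differentiableAt.differentiableWithinAt)
      fun u hu => ?_
    have hu := interior_subset hu
    have hmem := mem_of_mem_nhds (hd.posSet_mem_nhds hI (hpos hu) (hlt hu))
    rw [(hderiv hu).deriv, sub_nonneg]
    exact two_div_mul_deriv_sqrt_le_of_psi_le hd hA (hψ u hmem) hmem (hpos hu) (hlt hu)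
  linarith [hmono (Set.left_mem_Icc.2 hyy') (Set.right_mem_Icc.2 hyy') hyy']

lemma IsDensity.lipschitzWith_sqrt_transport (hd : IsDensity ν h) (hI : (posSet h).OrdConnected)
    (hc : ContinuousOn h (posSet h)) {A : ℝ} (hA : 0 < A)
    (hψ : ∀ y ∈ posSet h, psi h y ≤ A * √y) {T : ℝ → ℝ}
    (hT : ∀ s, cdf (realLaw ν) (T s) = gaussCDF s) :
    LipschitzWith (A / 2).toNNReal fun s => √(T s) := by
  have hTmono := (strictMono_of_cdf_comp_eq hT).monotone
  refine LipschitzWith.of_le_add_mul' _ fun s s' => ?_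
  rcases le_total s s' with hss' | hss'
  · exact (Real.sqrt_le_sqrt (hTmono hss')).trans (le_add_of_nonneg_right (by positivity))
  have hbound := hd.mul_sqrt_sub_sqrt_le hI hc hA hψ (hTmono hss')
    (hT s' ▸ gaussCDF_pos s') (hT s ▸ gaussCDF_lt_one s)
  rw [hT, hT, invFun_gaussCDF, invFun_gaussCDF] at hbound
  have hscaled : √(T s) - √(T s') ≤ A / 2 * (s - s') :=
    calc √(T s) - √(T s') = A / 2 * (2 / A * (√(T s) - √(T s'))) := by field_simp
      _ ≤ A / 2 * (s - s') := mul_le_mul_of_nonneg_left hbound (by positivity)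
  rw [Real.dist_eq, abs_of_nonneg (sub_nonneg.2 hss')]
  linarith

theorem IsNearlyGamma.exists_isLipschitzSqGaussian (hν : IsNearlyGamma ν) :
    ∃ L, IsLipschitzSqGaussian L ν := by
  obtain ⟨h, hd, hI, hc, A, hA, hψ⟩ := hν
  choose T hT using fun s => exists_cdf_eq hd.continuous_cdf (gaussCDF_pos s) (gaussCDF_lt_one s)
  refine ⟨(A / 2).toNNReal, fun s => (√(T s)).toNNReal, ?_, ?_⟩
  · simpa [comp_def] using Real.lipschitzWith_toNNReal.comp
      (hd.lipschitzWith_sqrt_transport hI hc hA hψ hT)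
  · rw [← map_toNNReal_realLaw ν, ← map_gaussianReal_eq_of_cdf_comp_eq hT,
      Measure.map_map (by fun_prop) (strictMono_of_cdf_comp_eq hT).monotone.measurable]
    congr 1
    funext s
    have hTs : 0 ≤ T s := (hd.pos_of_cdf_pos (hT s ▸ gaussCDF_pos s)).le
    rw [← Real.toNNReal_pow (Real.sqrt_nonneg _), Real.sq_sqrt hTs, comp_apply]

end Transport

/-! ### Infinite products -/

section InfiniteProduct

variable {ι : Type*} [DecidableEq ι]

/-- Extension by `0` of a configuration on the finite set `s`. It embeds the finite product in the
infinite one, as a right inverse of the restriction to `s`. -/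
noncomputable def extendZero (s : Finset ι) (x : s → ℝ≥0) (i : ι) : ℝ≥0 :=
  if h : i ∈ s then x ⟨i, h⟩ else 0

variable {s : Finset ι}

@[fun_prop]
lemma continuous_extendZero (s : Finset ι) : Continuous (extendZero s) := by
  refine continuous_pi fun i => ?_
  by_cases hi : i ∈ s <;> simp only [extendZero, hi, dite_true, dite_false] <;> fun_prop

lemma extendZero_apply (x : s → ℝ≥0) (e : s) : extendZero s x e = x e := by
  simp [extendZero]

lemma extendZero_update (x : s → ℝ≥0) (e : s) (y : ℝ≥0) :
    extendZero s (update x e y) = update (extendZero s x) e y := by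
  funext i
  by_cases hi : i ∈ s
  · lift i to s using hi
    simp only [extendZero_apply, update_apply, Subtype.coe_inj]
  · have hie : i ≠ e := fun h => hi (h ▸ e.2)
    simp [extendZero, hi, hie]

lemma extendZero_restrict_of_mem (x : ι → ℝ≥0) {i : ι} (hi : i ∈ s) :
    extendZero s (s.restrict x) i = x i := by
  simp [extendZero, hi]

variable {F : (ι → ℝ≥0) → ℝ}

lemma apply_extendZero_restrict (hF : DependsOn F s) (x : ι → ℝ≥0) :
    F (extendZero s (s.restrict x)) = F x :=
  hF fun _ hi => extendZero_restrict_of_mem x hi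

lemma upIncr_extendZero_restrict (hF : DependsOn F s) (x : ι → ℝ≥0) (e : s) (y : ℝ≥0) :
    upIncr (fun x => F (extendZero s x)) (s.restrict x) e y = upIncr F x e y := by
  simp only [upIncr, extendZero_update, apply_extendZero_restrict hF]
  congr 1
  refine hF fun i hi => ?_
  simp only [update_apply]
  split_ifs
  · rfl
  · exact extendZero_restrict_of_mem x hi

lemma measurable_of_continuous_of_dependsOn {ι : Type*} {s : Finset ι} {F : (ι → ℝ≥0) → ℝ}
    (hF : Continuous F) (hs : DependsOn F s) : Measurable F := by
  classical
  have hfactor : F = (fun x => F (extendZero s x)) ∘ s.restrict :=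
    funext fun x => (apply_extendZero_restrict hs x).symm
  rw [hfactor]
  exact (hF.comp (continuous_extendZero s)).measurable.comp (Finset.measurable_restrict s)

variable {G : (ι → ℝ≥0) → ℝ} {w : (ι → ℝ≥0) → ι → ℝ} {M : ℝ}

lemma UpperGradient.comp_extendZero (h : UpperGradient G w M) :
    UpperGradient (fun x => G (extendZero s x)) (fun x e => w (extendZero s x) e) M where
  nonneg x e := h.nonneg _ e
  le_one x e := h.le_one _ e
  le_bound x e hw := extendZero_apply x e ▸ h.le_bound _ _ hw
  mono x e y hy := by
    rw [extendZero_update]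
    exact h.mono _ _ _ (by rwa [extendZero_apply])
  le_add x e y hy := by
    rw [extendZero_update]
    simpa only [extendZero_apply] using h.le_add (extendZero s x) e y (by rwa [extendZero_apply])

variable {ν : Measure ℝ≥0} {L : ℝ≥0}

theorem UpperGradient.variance_exp_infinitePi_le [IsProbabilityMeasure ν]
    (hν : IsLipschitzSqGaussian L ν)
    (hG : Continuous G) (hG_nonneg : ∀ x, 0 ≤ G x) (hG_le : ∀ x, G x ≤ M) (hs : DependsOn G s)
    (h : UpperGradient G w M) (hsum : ∀ x, ∑ e ∈ s, w x e * x e ≤ G x) {θ : ℝ} (hθ : |θ| ≤ 1)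
    {σ : ℝ} (hσ : 0 < σ) {μ : Measure (ι → ℝ≥0)} (hμ : μ = Measure.infinitePi fun _ => ν) :
    ((∫ x, Real.exp (θ / 2 * G x) ^ 2 ∂μ) - (∫ x, Real.exp (θ / 2 * G x) ∂μ) ^ 2) *
        (1 - Real.log σ) -
      σ⁻¹ * ∑ e ∈ s, (2 * ∫ x, ∫ y, |upIncr (fun x => Real.exp (θ / 2 * G x)) x e y| ∂ν ∂μ) ^ 2 ≤
    48 * θ ^ 2 * L ^ 2 * ∫ x, G x * Real.exp (θ / 2 * G x) ^ 2 ∂μ := by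
  have hG' : Continuous fun x : s → ℝ≥0 => G (extendZero s x) :=
    hG.comp (continuous_extendZero s)
  have hfinite := h.comp_extendZero.variance_exp_le hν hG' (fun _ => hG_nonneg _)
    (fun _ => hG_le _) (fun x => by
      simpa only [← Finset.sum_coe_sort s, extendZero_apply] using hsum (extendZero s x)) hθ hσ
  have htransfer (Φ : (s → ℝ≥0) → ℝ) (hΦ : StronglyMeasurable Φ) :
      ∫ x, Φ x ∂(Measure.pi fun _ : s => ν) = ∫ x, Φ (s.restrict x) ∂μ :=
    hμ ▸ (integral_restrict_infinitePi (fun _ : ι => ν) hΦ.aestronglyMeasurable).symm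
  have hincr (e : s) : StronglyMeasurable fun x => ∫ y,
      |upIncr (fun x => Real.exp (θ / 2 * G (extendZero s x))) x e y| ∂ν := by
    have hcont : Continuous fun p : (s → ℝ≥0) × ℝ≥0 =>
        |upIncr (fun x => Real.exp (θ / 2 * G (extendZero s x))) p.1 e p.2| := by
      unfold upIncr; fun_prop
    exact hcont.stronglyMeasurable.integral_prod_right'
  have hexp : DependsOn (fun x => Real.exp (θ / 2 * G x)) s := fun x y hxy => by
    simp only [hs hxy]
  rw [htransfer _ (Continuous.stronglyMeasurable (by fun_prop)),
    htransfer _ (Continuous.stronglyMeasurable (by fun_prop)),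
    htransfer _ (Continuous.stronglyMeasurable (by fun_prop))] at hfinite
  simpa only [htransfer _ (hincr _), upIncr_extendZero_restrict hexp,
    apply_extendZero_restrict hs, Finset.sum_coe_sort s fun e => (2 * ∫ x, ∫ y,
      |upIncr (fun x => Real.exp (θ / 2 * G x)) x e y| ∂ν ∂μ) ^ 2] using hfinite

lemma sq_integral_mul_le {Ω : Type*} [MeasurableSpace Ω] {μ : Measure Ω} {w f : Ω → ℝ}
    (hw_nonneg : ∀ x, 0 ≤ w x) (hw : Integrable w μ) (hwf : Integrable (fun x => w x * f x) μ)
    (hwf_sq : Integrable (fun x => w x * f x ^ 2) μ) :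
    (∫ x, w x * f x ∂μ) ^ 2 ≤ (∫ x, w x ∂μ) * ∫ x, w x * f x ^ 2 ∂μ := by
  have hquadratic (t : ℝ) : 0 ≤ (∫ x, w x ∂μ) * (t * t) + (-2 * ∫ x, w x * f x ∂μ) * t +
      ∫ x, w x * f x ^ 2 ∂μ :=
    calc 0 ≤ ∫ x, w x * (f x - t) ^ 2 ∂μ :=
          integral_nonneg fun x => mul_nonneg (hw_nonneg x) (sq_nonneg _)
      _ = ∫ x, (w x * (t * t) + -2 * (w x * f x) * t) + w x * f x ^ 2 ∂μ := by
          congr with x; ring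
      _ = _ := by
          rw [integral_add _ hwf_sq, integral_add (hw.mul_const _), integral_mul_const,
            integral_mul_const, integral_const_mul]
          · exact (hwf.const_mul _).mul_const _
          · exact (hw.mul_const _).add ((hwf.const_mul _).mul_const _)
  have hdiscrim := discrim_le_zero hquadratic
  rw [discrim] at hdiscrim
  linarith

lemma exp_half_mul_le {θ g : ℝ} (hθ : |θ| ≤ 1) (hg : 0 ≤ g) (hgM : g ≤ M) :
    Real.exp (θ / 2 * g) ≤ Real.exp M :=
  (le_abs_self _).trans (abs_exp_half_mul_le hθ hg hgM)

lemma UpperGradient.abs_upIncr_exp_le_mul_exp (h : UpperGradient G w M) {θ a : ℝ}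
    (hθ : |θ| / 2 ≤ a) (x : ι → ℝ≥0) (e : ι) (y : ℝ≥0) :
    |upIncr (fun x => Real.exp (θ / 2 * G x)) x e y| ≤
      |θ| / 2 * (w x e * Real.exp (θ / 2 * G x)) * (y * Real.exp (a * y)) := by
  have hw := h.nonneg x e
  calc |upIncr (fun x => Real.exp (θ / 2 * G x)) x e y|
      ≤ |θ| / 2 * (w x e * y) * Real.exp (|θ| / 2 * y) * Real.exp (θ / 2 * G x) :=
        h.abs_upIncr_exp_le θ x e y y.2 (sub_le_self _ (x e).2)
    _ ≤ |θ| / 2 * (w x e * y) * Real.exp (a * y) * Real.exp (θ / 2 * G x) := by gcongr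
    _ = _ := by ring

variable {μ : Measure (ι → ℝ≥0)} {D a θ : ℝ}

lemma UpperGradient.integral_abs_upIncr_exp_le (h : UpperGradient G w M)
    (hD_int : Integrable (fun y : ℝ≥0 => (y : ℝ) * Real.exp (a * y)) ν)
    (hD : ∫ y : ℝ≥0, (y : ℝ) * Real.exp (a * y) ∂ν ≤ D) (hθ : |θ| / 2 ≤ a) {e : ι}
    (hwf : Integrable (fun x => w x e * Real.exp (θ / 2 * G x)) μ) :
    ∫ x, ∫ y, |upIncr (fun x => Real.exp (θ / 2 * G x)) x e y| ∂ν ∂μ ≤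
      |θ| / 2 * D * ∫ x, w x e * Real.exp (θ / 2 * G x) ∂μ := by
  rw [← integral_const_mul]
  refine integral_mono_of_nonneg (ae_of_all _ fun x => integral_nonneg fun y => abs_nonneg _)
    (hwf.const_mul _) (ae_of_all _ fun x => ?_)
  have hwf_nonneg : 0 ≤ w x e * Real.exp (θ / 2 * G x) :=
    mul_nonneg (h.nonneg x e) (Real.exp_nonneg _)
  calc ∫ y, |upIncr (fun x => Real.exp (θ / 2 * G x)) x e y| ∂ν
      ≤ ∫ y : ℝ≥0, |θ| / 2 * (w x e * Real.exp (θ / 2 * G x)) *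
          ((y : ℝ) * Real.exp (a * y)) ∂ν :=
        integral_mono_of_nonneg (ae_of_all _ fun y => abs_nonneg _) (hD_int.const_mul _)
          (ae_of_all _ (h.abs_upIncr_exp_le_mul_exp hθ x e))
    _ = |θ| / 2 * (w x e * Real.exp (θ / 2 * G x)) *
          ∫ y : ℝ≥0, (y : ℝ) * Real.exp (a * y) ∂ν := integral_const_mul _ _
    _ ≤ |θ| / 2 * (w x e * Real.exp (θ / 2 * G x)) * D := by gcongr
    _ = |θ| / 2 * D * (w x e * Real.exp (θ / 2 * G x)) := by ring

/-- By Cauchy–Schwarz, each squared `L¹`-influence gains a factor `η`, the mean of the weight. -/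
lemma UpperGradient.sum_sq_integral_abs_upIncr_exp_le [IsProbabilityMeasure μ]
    (h : UpperGradient G w M) (hG : Measurable G) (hG_nonneg : ∀ x, 0 ≤ G x) (hG_le : ∀ x, G x ≤ M)
    (hw : ∀ e, Measurable fun x => w x e) {η W : ℝ}
    (hD_int : Integrable (fun y : ℝ≥0 => (y : ℝ) * Real.exp (a * y)) ν)
    (hD : ∫ y : ℝ≥0, (y : ℝ) * Real.exp (a * y) ∂ν ≤ D)
    (hη_nonneg : 0 ≤ η) (hη : ∀ e, ∫ x, w x e ∂μ ≤ η) (hW : ∀ x, ∑ e ∈ s, w x e ≤ W)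
    (hθ : |θ| ≤ 1) (hθa : |θ| / 2 ≤ a) :
    ∑ e ∈ s, (2 * ∫ x, ∫ y, |upIncr (fun x => Real.exp (θ / 2 * G x)) x e y| ∂ν ∂μ) ^ 2 ≤
      θ ^ 2 * D ^ 2 * (η * (W * ∫ x, Real.exp (θ / 2 * G x) ^ 2 ∂μ)) := by
  let f (x : ι → ℝ≥0) : ℝ := Real.exp (θ / 2 * G x)
  have hf_le (x) : f x ≤ Real.exp M := exp_half_mul_le hθ (hG_nonneg x) (hG_le x)
  have hw_pow (k : ℕ) (e : ι) : Integrable (fun x => w x e * f x ^ k) μ := by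
    refine Integrable.of_mem_Icc 0 (1 * Real.exp M ^ k) (by fun_prop)
      (ae_of_all _ fun x => ⟨?_, ?_⟩)
    · exact mul_nonneg (h.nonneg x e) (by positivity)
    · exact mul_le_mul (h.le_one x e) (pow_le_pow_left₀ (Real.exp_nonneg _) (hf_le x) k)
        (by positivity) zero_le_one
  have hf_sq : Integrable (fun x => f x ^ 2) μ :=
    Integrable.of_mem_Icc 0 (Real.exp M ^ 2) (by fun_prop) (ae_of_all _ fun x =>
      ⟨sq_nonneg _, pow_le_pow_left₀ (Real.exp_nonneg _) (hf_le x) 2⟩)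
  have hwf (e : ι) : Integrable (fun x => w x e * f x) μ := by simpa using hw_pow 1 e
  have hterm (e : ι) : (2 * ∫ x, ∫ y, |upIncr f x e y| ∂ν ∂μ) ^ 2 ≤
      θ ^ 2 * D ^ 2 * (η * ∫ x, w x e * f x ^ 2 ∂μ) :=
    calc (2 * ∫ x, ∫ y, |upIncr f x e y| ∂ν ∂μ) ^ 2
        ≤ (2 * (|θ| / 2 * D * ∫ x, w x e * f x ∂μ)) ^ 2 := by
          gcongr
          exact h.integral_abs_upIncr_exp_le hD_int hD hθa (hwf e)
      _ = θ ^ 2 * D ^ 2 * (∫ x, w x e * f x ∂μ) ^ 2 := by rw [← sq_abs θ]; ring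
      _ ≤ θ ^ 2 * D ^ 2 * ((∫ x, w x e ∂μ) * ∫ x, w x e * f x ^ 2 ∂μ) := by
          gcongr
          exact sq_integral_mul_le (fun x => h.nonneg x e) (by simpa using hw_pow 0 e) (hwf e)
            (hw_pow 2 e)
      _ ≤ θ ^ 2 * D ^ 2 * (η * ∫ x, w x e * f x ^ 2 ∂μ) := by
          gcongr
          · exact integral_nonneg fun x => mul_nonneg (h.nonneg x e) (sq_nonneg _)
          · exact hη e
  refine (Finset.sum_le_sum fun e _ => hterm e).trans ?_
  rw [← Finset.mul_sum, ← Finset.mul_sum, ← integral_finsetSum _ fun e _ => hw_pow 2 e,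
    ← integral_const_mul W]
  gcongr θ ^ 2 * D ^ 2 * (η * ?_)
  refine integral_mono (integrable_finsetSum _ fun e _ => hw_pow 2 e) (hf_sq.const_mul W)
    fun x => ?_
  simp only [← Finset.sum_mul]
  exact mul_le_mul_of_nonneg_right (hW x) (sq_nonneg _)

theorem UpperGradient.variance_exp_le_of_influence [IsProbabilityMeasure ν]
    (hν : IsLipschitzSqGaussian L ν)
    (hG : Continuous G) (hG_nonneg : ∀ x, 0 ≤ G x) (hG_le : ∀ x, G x ≤ M) (hs : DependsOn G s)
    (h : UpperGradient G w M) (hsum : ∀ x, ∑ e ∈ s, w x e * x e ≤ G x)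
    (hw : ∀ e, Measurable fun x => w x e) (hμ : μ = Measure.infinitePi fun _ => ν) {η W : ℝ}
    (hD_int : Integrable (fun y : ℝ≥0 => (y : ℝ) * Real.exp (a * y)) ν)
    (hD : ∫ y : ℝ≥0, (y : ℝ) * Real.exp (a * y) ∂ν ≤ D)
    (hη_nonneg : 0 ≤ η) (hη : ∀ e, ∫ x, w x e ∂μ ≤ η) (hW : ∀ x, ∑ e ∈ s, w x e ≤ W)
    (hθ : |θ| ≤ 1) (hθa : |θ| / 2 ≤ a) {σ : ℝ} (hσ : 0 < σ) :
    ((∫ x, Real.exp (θ / 2 * G x) ^ 2 ∂μ) - (∫ x, Real.exp (θ / 2 * G x) ∂μ) ^ 2) *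
        (1 - Real.log σ) ≤
      (σ⁻¹ * D ^ 2 * η * W + 48 * L ^ 2 * M) * θ ^ 2 * ∫ x, Real.exp (θ / 2 * G x) ^ 2 ∂μ := by
  have : IsProbabilityMeasure μ := hμ ▸ inferInstance
  have hGm := measurable_of_continuous_of_dependsOn hG hs
  have hf_sq : Integrable (fun x => Real.exp (θ / 2 * G x) ^ 2) μ :=
    Integrable.of_mem_Icc 0 (Real.exp M ^ 2) (by fun_prop) (ae_of_all _ fun x => ⟨sq_nonneg _,
      pow_le_pow_left₀ (Real.exp_nonneg _) (exp_half_mul_le hθ (hG_nonneg x) (hG_le x)) 2⟩)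
  have hinfluence := h.sum_sq_integral_abs_upIncr_exp_le (μ := μ) hGm hG_nonneg hG_le hw hD_int hD
    hη_nonneg hη hW hθ hθa
  have henergy : ∫ x, G x * Real.exp (θ / 2 * G x) ^ 2 ∂μ ≤
      M * ∫ x, Real.exp (θ / 2 * G x) ^ 2 ∂μ := by
    rw [← integral_const_mul]
    exact integral_mono_of_nonneg
      (ae_of_all _ fun x => mul_nonneg (hG_nonneg x) (sq_nonneg _)) (hf_sq.const_mul M)
      (ae_of_all _ fun x => mul_le_mul_of_nonneg_right (hG_le x) (sq_nonneg _))
  have hvar := h.variance_exp_infinitePi_le hν hG hG_nonneg hG_le hs hsum hθ hσ hμ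
  calc _ ≤ _ := sub_le_iff_le_add.1 hvar
    _ ≤ 48 * θ ^ 2 * L ^ 2 * (M * ∫ x, Real.exp (θ / 2 * G x) ^ 2 ∂μ) +
        σ⁻¹ * (θ ^ 2 * D ^ 2 * (η * (W * ∫ x, Real.exp (θ / 2 * G x) ^ 2 ∂μ))) := by gcongr
    _ = _ := by ring

end InfiniteProduct

section Laplace

variable {Ω : Type*} [MeasurableSpace Ω] {μ : Measure Ω} [IsProbabilityMeasure μ] {X : Ω → ℝ}
  {B K θ : ℝ}

lemma integrable_exp_mul_of_abs_le (hX : Measurable X) (hB : ∀ ω, |X ω| ≤ B) (t : ℝ) :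
    Integrable (fun ω => Real.exp (t * X ω)) μ := by
  refine Integrable.of_bound (by fun_prop) (Real.exp (|t| * B)) (ae_of_all _ fun ω => ?_)
  rw [Real.norm_of_nonneg (Real.exp_nonneg _), Real.exp_le_exp]
  calc t * X ω ≤ |t| * |X ω| := (le_abs_self _).trans_eq (abs_mul _ _)
    _ ≤ |t| * B := mul_le_mul_of_nonneg_left (hB ω) (abs_nonneg t)

lemma integral_exp_mul_le_of_abs_mul_le_one (hX : Measurable X) (hB : ∀ ω, |X ω| ≤ B)
    (hmean : ∫ ω, X ω ∂μ = 0) (hθ : |θ| * B ≤ 1) :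
    ∫ ω, Real.exp (θ * X ω) ∂μ ≤ Real.exp (B ^ 2 * θ ^ 2) := by
  have hint : Integrable X μ := Integrable.of_bound hX.aestronglyMeasurable B (ae_of_all _ hB)
  have htaylor (ω : Ω) : Real.exp (θ * X ω) ≤ 1 + θ * X ω + B ^ 2 * θ ^ 2 := by
    have hle : |θ * X ω| ≤ 1 := by
      rw [abs_mul]
      exact (mul_le_mul_of_nonneg_left (hB ω) (abs_nonneg _)).trans hθ
    have hsq : X ω ^ 2 ≤ B ^ 2 := sq_le_sq' (abs_le.1 (hB ω)).1 (abs_le.1 (hB ω)).2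
    nlinarith [sq_nonneg θ, (le_abs_self _).trans (Real.abs_exp_sub_one_sub_id_le hle)]
  calc ∫ ω, Real.exp (θ * X ω) ∂μ ≤ ∫ ω, (1 + θ * X ω + B ^ 2 * θ ^ 2) ∂μ :=
        integral_mono (integrable_exp_mul_of_abs_le hX hB θ) (by fun_prop) htaylor
    _ = B ^ 2 * θ ^ 2 + 1 := by
        rw [integral_add (by fun_prop) (by fun_prop), integral_add (by fun_prop) (by fun_prop),
          integral_const_mul, hmean]
        simp [add_comm]
    _ ≤ Real.exp (B ^ 2 * θ ^ 2) := Real.add_one_le_exp _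

lemma le_exp_two_mul_mul_of_mul_one_sub_le {φ u b : ℝ} (hφ : 0 ≤ φ) (hu_nonneg : 0 ≤ u)
    (hu : u ≤ 1 / 2) (hb : φ * (1 - u) ≤ b) : φ ≤ Real.exp (2 * u) * b := by
  have hone : 1 ≤ Real.exp (2 * u) * (1 - u) := by
    nlinarith [Real.add_one_le_exp (2 * u)]
  calc φ ≤ φ * (Real.exp (2 * u) * (1 - u)) := le_mul_of_one_le_right hφ hone
    _ = Real.exp (2 * u) * (φ * (1 - u)) := by ring
    _ ≤ Real.exp (2 * u) * b := mul_le_mul_of_nonneg_left hb (Real.exp_nonneg _)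

/-- Each application of the variance hypothesis halves `θ`, until `|θ| B ≤ 1`. -/
lemma integral_exp_mul_le_of_abs_mul_le_two_pow (hX : Measurable X) (hB : ∀ ω, |X ω| ≤ B)
    (hmean : ∫ ω, X ω ∂μ = 0) {θ₁ : ℝ} (hK : 0 ≤ K)
    (hvar : ∀ θ : ℝ, |θ| ≤ θ₁ → (∫ ω, Real.exp (θ * X ω) ∂μ) -
      (∫ ω, Real.exp (θ / 2 * X ω) ∂μ) ^ 2 ≤ K * θ ^ 2 * ∫ ω, Real.exp (θ * X ω) ∂μ)
    (hθ : |θ| ≤ θ₁) (hKθ : K * θ ^ 2 ≤ 1 / 2) {n : ℕ} (hn : |θ| * B ≤ 2 ^ n) :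
    ∫ ω, Real.exp (θ * X ω) ∂μ ≤ Real.exp ((4 * K + B ^ 2 / 2 ^ n) * θ ^ 2) := by
  have hKθ_nonneg (θ : ℝ) : 0 ≤ K * θ ^ 2 := mul_nonneg hK (sq_nonneg θ)
  have hLaplace_nonneg (θ : ℝ) : 0 ≤ ∫ ω, Real.exp (θ * X ω) ∂μ :=
    integral_nonneg fun ω => (Real.exp_pos _).le
  induction n generalizing θ with
  | zero =>
    refine (integral_exp_mul_le_of_abs_mul_le_one hX hB hmean (by simpa using hn)).trans ?_
    rw [Real.exp_le_exp, pow_zero, div_one]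
    linarith [hKθ_nonneg θ]
  | succ n ih =>
    have habs : |θ / 2| = |θ| / 2 := by rw [abs_div, abs_two]
    have hhalf : ∫ ω, Real.exp (θ / 2 * X ω) ∂μ ≤
        Real.exp ((4 * K + B ^ 2 / 2 ^ n) * (θ / 2) ^ 2) :=
      ih (by rw [habs]; linarith [abs_nonneg θ]) (by linarith [hKθ_nonneg θ])
        (by rw [habs]; rw [pow_succ] at hn; linarith)
    refine (le_exp_two_mul_mul_of_mul_one_sub_le (hLaplace_nonneg θ) (hKθ_nonneg θ) hKθ
      (b := Real.exp ((4 * K + B ^ 2 / 2 ^ n) * (θ / 2) ^ 2) ^ 2) ?_).trans_eq ?_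
    · linarith [hvar θ hθ, pow_le_pow_left₀ (hLaplace_nonneg _) hhalf 2]
    · rw [← Real.exp_nat_mul, ← Real.exp_add, pow_succ]
      congr 1
      push_cast
      field_simp
      ring

theorem integral_exp_mul_le_of_variance_le (hX : Measurable X) (hB : ∀ ω, |X ω| ≤ B)
    (hmean : ∫ ω, X ω ∂μ = 0) {θ₁ : ℝ} (hK : 0 ≤ K)
    (hvar : ∀ θ : ℝ, |θ| ≤ θ₁ → (∫ ω, Real.exp (θ * X ω) ∂μ) -
      (∫ ω, Real.exp (θ / 2 * X ω) ∂μ) ^ 2 ≤ K * θ ^ 2 * ∫ ω, Real.exp (θ * X ω) ∂μ)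
    (hθ : |θ| ≤ θ₁) (hKθ : K * θ ^ 2 ≤ 1 / 2) :
    ∫ ω, Real.exp (θ * X ω) ∂μ ≤ Real.exp (4 * K * θ ^ 2) := by
  have htendsto : Tendsto (fun n : ℕ => Real.exp ((4 * K + B ^ 2 / 2 ^ n) * θ ^ 2)) atTop
      (𝓝 (Real.exp (4 * K * θ ^ 2))) := by
    refine (Real.continuous_exp.tendsto _).comp ?_
    have hzero : Tendsto (fun n : ℕ => B ^ 2 / (2 : ℝ) ^ n) atTop (𝓝 0) :=
      tendsto_const_nhds.div_atTop (tendsto_pow_atTop_atTop_of_one_lt one_lt_two)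
    simpa using (hzero.const_add (4 * K)).mul_const (θ ^ 2)
  have hlarge : ∀ᶠ n : ℕ in atTop, |θ| * B ≤ 2 ^ n :=
    (tendsto_pow_atTop_atTop_of_one_lt one_lt_two).eventually_ge_atTop _
  exact ge_of_tendsto htendsto (hlarge.mono fun n hn =>
    integral_exp_mul_le_of_abs_mul_le_two_pow hX hB hmean hK hvar hθ hKθ hn)

theorem integral_exp_mul_sub_integral_le_of_variance_le (hX : Measurable X)
    (hB : ∀ ω, |X ω| ≤ B) {θ₁ : ℝ} (hK : 0 ≤ K)
    (hvar : ∀ θ : ℝ, |θ| ≤ θ₁ → (∫ ω, Real.exp (θ * X ω) ∂μ) -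
      (∫ ω, Real.exp (θ / 2 * X ω) ∂μ) ^ 2 ≤ K * θ ^ 2 * ∫ ω, Real.exp (θ * X ω) ∂μ)
    (hθ : |θ| ≤ θ₁) (hKθ : K * θ ^ 2 ≤ 1 / 2) :
    ∫ ω, Real.exp (θ * (X ω - ∫ ω', X ω' ∂μ)) ∂μ ≤ Real.exp (4 * K * θ ^ 2) := by
  set M := ∫ ω, X ω ∂μ with hM
  have hint : Integrable X μ := Integrable.of_bound hX.aestronglyMeasurable B (ae_of_all _ hB)
  have hcenter (t : ℝ) : ∫ ω, Real.exp (t * (X ω - M)) ∂μ =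
      Real.exp (-(t * M)) * ∫ ω, Real.exp (t * X ω) ∂μ := by
    rw [← integral_const_mul]
    congr 1 with ω
    rw [← Real.exp_add]
    ring_nf
  have hsq (t : ℝ) : Real.exp (-(t / 2 * M)) ^ 2 = Real.exp (-(t * M)) := by
    rw [← Real.exp_nat_mul]
    push_cast
    ring_nf
  refine integral_exp_mul_le_of_variance_le (B := B + |M|) (hX.sub_const M)
    (fun ω => (abs_sub _ _).trans (add_le_add_left (hB ω) _)) ?mean hK (fun t ht => ?var) hθ hKθ
  case mean => rw [integral_sub hint (integrable_const _), integral_const, probReal_univ, one_smul,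
    ← hM, sub_self]
  case var =>
    rw [hcenter, hcenter, mul_pow, hsq, ← mul_sub, mul_left_comm]
    exact mul_le_mul_of_nonneg_left (hvar t ht) (Real.exp_pos _).le

end Laplace

/-! ### Capped minima over a finite family of edge sets -/

section EdgeSets

variable {ι : Type*} {P : Finset (Finset ι)} {c : ℝ} {x : ι → ℝ≥0}

/-- The total time of a finite set of edges. -/
def setTime (p : Finset ι) (x : ι → ℝ≥0) : ℝ := ∑ e ∈ p, (x e : ℝ)

/-- The minimal time of the sets of a finite family, capped at `c`. The cap makes it a bounded
function, and gives it a value on the empty family. -/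
def capMin (P : Finset (Finset ι)) (c : ℝ) (x : ι → ℝ≥0) : ℝ := P.fold min c fun p => setTime p x

/-- The sets of the family that realize the capped minimal time. There are none when every set of
the family is slower than the cap. -/
noncomputable def minimizers (P : Finset (Finset ι)) (c : ℝ) (x : ι → ℝ≥0) :
    Finset (Finset ι) :=
  open Classical in P.filter fun p => setTime p x ≤ capMin P c x

lemma setTime_nonneg (p : Finset ι) (x : ι → ℝ≥0) : 0 ≤ setTime p x :=
  Finset.sum_nonneg fun e _ => (x e).2

lemma continuous_setTime (p : Finset ι) : Continuous (setTime p) := by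
  unfold setTime; fun_prop

lemma measurable_setTime (p : Finset ι) : Measurable (setTime p) := by
  unfold setTime; fun_prop

lemma le_capMin_iff {a : ℝ} : a ≤ capMin P c x ↔ a ≤ c ∧ ∀ p ∈ P, a ≤ setTime p x :=
  Finset.le_fold_min a

lemma capMin_le_cap (x : ι → ℝ≥0) : capMin P c x ≤ c := (le_capMin_iff.1 le_rfl).1

lemma capMin_le {p : Finset ι} (hp : p ∈ P) (x : ι → ℝ≥0) : capMin P c x ≤ setTime p x :=
  (le_capMin_iff.1 le_rfl).2 p hp

lemma capMin_nonneg (hc : 0 ≤ c) (x : ι → ℝ≥0) : 0 ≤ capMin P c x :=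
  le_capMin_iff.2 ⟨hc, fun p _ => setTime_nonneg p x⟩

lemma mem_minimizers {p : Finset ι} :
    p ∈ minimizers P c x ↔ p ∈ P ∧ setTime p x ≤ capMin P c x := by
  simp [minimizers]

lemma setTime_eq_of_mem_minimizers {p : Finset ι} (hp : p ∈ minimizers P c x) :
    setTime p x = capMin P c x :=
  le_antisymm (mem_minimizers.1 hp).2 (capMin_le (mem_minimizers.1 hp).1 x)

lemma capMin_eq_cap_of_minimizers_eq_empty (h : minimizers P c x = ∅) : capMin P c x = c := by
  rcases (Finset.fold_min_le (b := c) (f := fun p => setTime p x) (s := P) (capMin P c x)).1 le_rfl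
    with hc | ⟨p, hp, hle⟩
  · exact le_antisymm (capMin_le_cap x) hc
  · exact absurd (mem_minimizers.2 ⟨hp, hle⟩) (h ▸ Finset.notMem_empty p)

lemma continuous_capMin (P : Finset (Finset ι)) (c : ℝ) : Continuous (capMin P c) := by
  classical
  induction P using Finset.induction_on with
  | empty => exact continuous_const
  | insert p P hp ih =>
    have hfold : capMin (insert p P) c = fun x => min (setTime p x) (capMin P c x) := by
      funext x; simp only [capMin, Finset.fold_insert hp]
    rw [hfold]
    exact (continuous_setTime p).min ih

lemma dependsOn_capMin [DecidableEq ι] (P : Finset (Finset ι)) (c : ℝ) :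
    DependsOn (capMin P c) (P.biUnion id : Finset ι) := by
  intro x y hxy
  refine Finset.fold_congr fun p hp => Finset.sum_congr rfl fun e he => ?_
  rw [hxy e (Finset.mem_coe.2 (Finset.mem_biUnion.2 ⟨p, hp, he⟩))]

lemma measurable_capMin (P : Finset (Finset ι)) (c : ℝ) : Measurable (capMin P c) := by
  classical
  exact measurable_of_continuous_of_dependsOn (continuous_capMin P c) (dependsOn_capMin P c)

variable [DecidableEq ι]

/-- The proportion of the minimizers that contain `e`, which serves as a slope of the capped minimum
in the direction `e`. It vanishes when there are no minimizers, by the convention `0 / 0 = 0`. -/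
noncomputable def minWeight (P : Finset (Finset ι)) (c : ℝ) (x : ι → ℝ≥0) (e : ι) : ℝ :=
  ((minimizers P c x).filter fun p => e ∈ p).card / (minimizers P c x).card

lemma setTime_update (p : Finset ι) (x : ι → ℝ≥0) (e : ι) (y : ℝ≥0) :
    setTime p (update x e y) = setTime p x + if e ∈ p then (y : ℝ) - x e else 0 := by
  unfold setTime
  split_ifs with he
  · rw [← Finset.add_sum_erase _ _ he, ← Finset.add_sum_erase p (fun e => (x e : ℝ)) he,
      update_self,
      Finset.sum_congr rfl fun i hi => by rw [update_of_ne (Finset.ne_of_mem_erase hi)]]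
    ring
  · rw [add_zero]
    exact Finset.sum_congr rfl fun i hi => by
      rw [update_of_ne (ne_of_mem_of_not_mem hi he)]

lemma measurable_minWeight (P : Finset (Finset ι)) (c : ℝ) (e : ι) :
    Measurable fun x => minWeight P c x e := by
  classical
  have hcard (Q : Finset (Finset ι)) : Measurable fun x : ι → ℝ≥0 =>
      ((Q.filter fun p => setTime p x ≤ capMin P c x).card : ℝ) := by
    simp only [Finset.card_filter, Nat.cast_sum, Nat.cast_ite, Nat.cast_one, Nat.cast_zero]
    exact Finset.measurable_fun_sum _ fun p _ => Measurable.ite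
      (measurableSet_le (measurable_setTime p) (measurable_capMin P c)) measurable_const
      measurable_const
  simp only [minWeight, minimizers, Finset.filter_comm _ (e ∈ ·)]
  exact (hcard (P.filter (e ∈ ·))).div (hcard P)

lemma sum_minWeight_le {κ : Type*} (Z : Finset κ) (u : κ → ι) (x : ι → ℝ≥0) {b : ℝ} (hb : 0 ≤ b)
    (h : ∀ p ∈ minimizers P c x, ((Z.filter fun z => u z ∈ p).card : ℝ) ≤ b) :
    ∑ z ∈ Z, minWeight P c x (u z) ≤ b := by
  simp only [minWeight]
  rw [← Finset.sum_div]
  refine div_le_of_le_mul₀ (Nat.cast_nonneg _) hb ?_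
  have hcount := Finset.sum_card_bipartiteAbove_eq_sum_card_bipartiteBelow
    (s := Z) (t := minimizers P c x) (fun z p => u z ∈ p)
  calc ∑ z ∈ Z, (((minimizers P c x).filter fun p => u z ∈ p).card : ℝ)
      = ∑ p ∈ minimizers P c x, ((Z.filter fun z => u z ∈ p).card : ℝ) := mod_cast hcount
    _ ≤ ∑ _p ∈ minimizers P c x, b := Finset.sum_le_sum h
    _ = b * (minimizers P c x).card := by rw [Finset.sum_const, nsmul_eq_mul, mul_comm]

lemma sum_minWeight_mul_le (hc : 0 ≤ c) (s : Finset ι) (x : ι → ℝ≥0) :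
    ∑ e ∈ s, minWeight P c x e * x e ≤ capMin P c x := by
  simp only [minWeight, div_mul_eq_mul_div]
  rw [← Finset.sum_div]
  refine div_le_of_le_mul₀ (Nat.cast_nonneg _) (capMin_nonneg hc x) ?_
  calc ∑ e ∈ s, (((minimizers P c x).filter fun p => e ∈ p).card : ℝ) * x e
      = ∑ e ∈ s, ∑ p ∈ minimizers P c x, if e ∈ p then (x e : ℝ) else 0 := by
        refine Finset.sum_congr rfl fun e _ => ?_
        rw [← Finset.sum_filter, Finset.sum_const, nsmul_eq_mul]
    _ = ∑ p ∈ minimizers P c x, ∑ e ∈ s, if e ∈ p then (x e : ℝ) else 0 := Finset.sum_comm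
    _ ≤ ∑ _p ∈ minimizers P c x, capMin P c x := by
        refine Finset.sum_le_sum fun p hp => ?_
        rw [← setTime_eq_of_mem_minimizers hp, ← Finset.sum_filter, setTime]
        exact Finset.sum_le_sum_of_subset_of_nonneg (fun e he => (Finset.mem_filter.1 he).2)
          fun e _ _ => (x e).2
    _ = capMin P c x * (minimizers P c x).card := by
        rw [Finset.sum_const, nsmul_eq_mul, mul_comm]

lemma capMin_update_le (P : Finset (Finset ι)) (c : ℝ) (x : ι → ℝ≥0) (e : ι) (y : ℝ≥0) :
    capMin P c (update x e y) ≤ capMin P c x + minWeight P c x e * (y - x e) := by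
  rcases (minimizers P c x).eq_empty_or_nonempty with hempty | hne
  · simpa [capMin_eq_cap_of_minimizers_eq_empty hempty, minWeight, hempty] using capMin_le_cap _
  have hcard : (0 : ℝ) < (minimizers P c x).card := mod_cast hne.card_pos
  -- average over the minimizers `p` the bound of the new minimum by the new time of `p`
  have hsum : ∑ _p ∈ minimizers P c x, capMin P c (update x e y) ≤
      ∑ p ∈ minimizers P c x, (capMin P c x + if e ∈ p then (y : ℝ) - x e else 0) := by
    refine Finset.sum_le_sum fun p hp => ?_
    rw [← setTime_eq_of_mem_minimizers hp, ← setTime_update]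
    exact capMin_le (mem_minimizers.1 hp).1 _
  rw [Finset.sum_const, Finset.sum_add_distrib, Finset.sum_const, nsmul_eq_mul, nsmul_eq_mul,
    ← Finset.sum_filter, Finset.sum_const, nsmul_eq_mul] at hsum
  rw [← mul_le_mul_iff_right₀ hcard]
  refine hsum.trans_eq ?_
  rw [minWeight]
  field_simp

lemma upperGradient_capMin (P : Finset (Finset ι)) (c : ℝ) :
    UpperGradient (capMin P c) (minWeight P c) c where
  nonneg x e := by unfold minWeight; positivity
  le_one x e := div_le_one_of_le₀ (mod_cast Finset.card_filter_le _ _) (Nat.cast_nonneg _)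
  le_bound x e hw := by
    have hne : ((minimizers P c x).filter fun p => e ∈ p).Nonempty := by
      rw [Finset.nonempty_iff_ne_empty]
      intro hempty
      exact hw (by simp [minWeight, hempty])
    obtain ⟨p, hp⟩ := hne
    obtain ⟨hp, he⟩ := Finset.mem_filter.1 hp
    calc (x e : ℝ) ≤ setTime p x :=
          Finset.single_le_sum (f := fun e => (x e : ℝ)) (fun i _ => (x i).2) he
      _ ≤ capMin P c x := (mem_minimizers.1 hp).2
      _ ≤ c := capMin_le_cap x
  mono x e y hy := by
    refine le_capMin_iff.2 ⟨capMin_le_cap x, fun p hp => (capMin_le hp x).trans ?_⟩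
    rw [setTime_update]
    refine le_add_of_nonneg_right ?_
    split_ifs
    exacts [sub_nonneg.2 (mod_cast hy), le_rfl]
  le_add x e y _ := capMin_update_le P c x e y

lemma UpperGradient.comp_perm {G : (ι → ℝ≥0) → ℝ} {w : (ι → ℝ≥0) → ι → ℝ} {M : ℝ}
    (h : UpperGradient G w M) (σ : Equiv.Perm ι) :
    UpperGradient (fun x => G (x ∘ σ)) (fun x e => w (x ∘ σ) (σ.symm e)) M where
  nonneg x e := h.nonneg _ _
  le_one x e := h.le_one _ _
  le_bound x e hw := by simpa using h.le_bound _ _ hw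
  mono x e y hy := by
    rw [update_comp_equiv]
    exact h.mono _ _ _ (by simpa using hy)
  le_add x e y hy := by
    rw [update_comp_equiv]
    simpa using h.le_add (x ∘ σ) (σ.symm e) y (by simpa using hy)

lemma UpperGradient.expect {κ : Type*} [Fintype κ] [Nonempty κ] {G : κ → (ι → ℝ≥0) → ℝ}
    {w : κ → (ι → ℝ≥0) → ι → ℝ} {M : ℝ} (h : ∀ z, UpperGradient (G z) (w z) M) :
    UpperGradient (fun x => 𝔼 z, G z x) (fun x e => 𝔼 z, w z x e) M where
  nonneg x e := Finset.expect_nonneg fun z _ => (h z).nonneg x e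
  le_one x e := by
    refine (Finset.expect_le_expect fun z _ => (h z).le_one x e).trans ?_
    simp
  le_bound x e hw := by
    obtain ⟨z, -, hz⟩ := Finset.exists_ne_zero_of_expect_ne_zero hw
    exact (h z).le_bound x e hz
  mono x e y hy := Finset.expect_le_expect fun z _ => (h z).mono x e y hy
  le_add x e y hy := by
    rw [Finset.expect_mul, ← Finset.expect_add_distrib]
    exact Finset.expect_le_expect fun z _ => (h z).le_add x e y hy

end EdgeSets

section Averaging

variable {ι : Type*} {ν : Measure ℝ≥0} [IsProbabilityMeasure ν]

lemma measurePreserving_comp_perm (τ : Equiv.Perm ι) :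
    MeasurePreserving (fun x : ι → ℝ≥0 => x ∘ τ) (Measure.infinitePi fun _ : ι => ν)
      (Measure.infinitePi fun _ : ι => ν) := by
  refine ⟨by fun_prop, ?_⟩
  convert Measure.infinitePi_map_piCongrLeft (fun _ : ι => ν) τ.symm using 2
  funext x i
  have hcongr := Equiv.piCongrLeft_apply_apply (fun _ : ι => ℝ≥0) τ.symm x (τ i)
  rw [Equiv.symm_apply_apply] at hcongr
  rw [MeasurableEquiv.coe_piCongrLeft, hcongr]
  rfl

variable [DecidableEq ι] {P : Finset (Finset ι)} {c : ℝ} {κ : Type*} [Fintype κ]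
  {τ : κ → Equiv.Perm ι} {μ : Measure (ι → ℝ≥0)}

lemma continuous_expect_capMin_comp_perm {ι : Type*} (P : Finset (Finset ι)) (c : ℝ)
    (τ : κ → Equiv.Perm ι) :
    Continuous fun x => 𝔼 z, capMin P c (x ∘ τ z) := by
  simp only [Fintype.expect_eq_sum_div_card]
  exact (continuous_finsetSum _ fun z _ => (continuous_capMin P c).comp (by fun_prop)).div_const _

lemma dependsOn_expect_capMin_comp_perm (P : Finset (Finset ι)) (c : ℝ) (τ : κ → Equiv.Perm ι) :
    DependsOn (fun x => 𝔼 z, capMin P c (x ∘ τ z))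
      (Finset.univ.biUnion fun z => (P.biUnion id).map (τ z).toEmbedding : Finset ι) :=
  fun _ _ hxy => Finset.expect_congr rfl fun z _ => dependsOn_capMin P c fun _ he => hxy _ <|
    Finset.mem_coe.2 <| Finset.mem_biUnion.2
      ⟨z, Finset.mem_univ z, Finset.mem_map_of_mem (τ z).toEmbedding he⟩

lemma integral_expect_minWeight_comp_perm (P : Finset (Finset ι)) (c : ℝ)
    (τ : κ → Equiv.Perm ι) (e : ι) (hμ : μ = Measure.infinitePi fun _ => ν) :
    ∫ x, 𝔼 z, minWeight P c (x ∘ τ z) ((τ z).symm e) ∂μ =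
      (∫ x, ∑ z, minWeight P c x ((τ z).symm e) ∂μ) / Fintype.card κ := by
  have : IsProbabilityMeasure μ := hμ ▸ inferInstance
  have hint (e : ι) : Integrable (fun x => minWeight P c x e) μ :=
    Integrable.of_mem_Icc 0 1 (measurable_minWeight P c e).aemeasurable <| ae_of_all _ fun x =>
      ⟨(upperGradient_capMin P c).nonneg x e, (upperGradient_capMin P c).le_one x e⟩
  have hτ (z : κ) : MeasurePreserving (fun x : ι → ℝ≥0 => x ∘ τ z) μ μ :=
    hμ ▸ measurePreserving_comp_perm (τ z)
  have hint_comp (z : κ) : Integrable (fun x => minWeight P c (x ∘ τ z) ((τ z).symm e)) μ :=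
    (hτ z).integrable_comp_of_integrable (hint _)
  simp only [Fintype.expect_eq_sum_div_card]
  rw [integral_div, integral_finsetSum _ fun z _ => hint _,
    integral_finsetSum _ fun z _ => hint_comp z]
  congr 1
  refine Finset.sum_congr rfl fun z _ => ?_
  conv_rhs => rw [← (hτ z).map_eq]
  exact (integral_map (hτ z).measurable.aemeasurable
    (measurable_minWeight P c _).aestronglyMeasurable).symm

theorem variance_exp_expect_capMin_le {L : ℝ≥0} (hν : IsLipschitzSqGaussian L ν) (hc : 0 ≤ c)
    [Nonempty κ] {D b W a : ℝ} (hμ : μ = Measure.infinitePi fun _ => ν)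
    (hD_int : Integrable (fun y : ℝ≥0 => (y : ℝ) * Real.exp (a * y)) ν)
    (hD : ∫ y : ℝ≥0, (y : ℝ) * Real.exp (a * y) ∂ν ≤ D)
    (hb_nonneg : 0 ≤ b) (hb : ∀ e, ∫ x, ∑ z, minWeight P c x ((τ z).symm e) ∂μ ≤ b)
    (hW_nonneg : 0 ≤ W) (hW : ∀ p ∈ P, (p.card : ℝ) ≤ W) {θ : ℝ} (hθ : |θ| ≤ 1)
    (hθa : |θ| / 2 ≤ a) {σ : ℝ} (hσ : 0 < σ) :
    ((∫ x, Real.exp (θ / 2 * 𝔼 z, capMin P c (x ∘ τ z)) ^ 2 ∂μ) -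
        (∫ x, Real.exp (θ / 2 * 𝔼 z, capMin P c (x ∘ τ z)) ∂μ) ^ 2) * (1 - Real.log σ) ≤
      (σ⁻¹ * D ^ 2 * (b / Fintype.card κ) * W + 48 * L ^ 2 * c) * θ ^ 2 *
        ∫ x, Real.exp (θ / 2 * 𝔼 z, capMin P c (x ∘ τ z)) ^ 2 ∂μ := by
  have hgrad := UpperGradient.expect fun z => (upperGradient_capMin P c).comp_perm (τ z)
  have hsum (z : κ) (s : Finset ι) (x : ι → ℝ≥0) :
      ∑ e ∈ s, minWeight P c (x ∘ τ z) ((τ z).symm e) * x e ≤ capMin P c (x ∘ τ z) := by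
    simpa only [Finset.sum_map, Equiv.coe_toEmbedding, comp_apply, Equiv.apply_symm_apply] using
      sum_minWeight_mul_le hc (s.map (τ z).symm.toEmbedding) (x ∘ τ z)
  refine hgrad.variance_exp_le_of_influence hν (continuous_expect_capMin_comp_perm P c τ)
    (fun x => Finset.expect_nonneg fun z _ => capMin_nonneg hc _)
    (fun x => (Finset.expect_le_expect fun z _ => capMin_le_cap _).trans (by simp))
    (dependsOn_expect_capMin_comp_perm P c τ) (fun x => ?_) (fun e => ?_) hμ hD_int hD
    (by positivity) (fun e => ?_) (fun x => ?_) hθ hθa hσ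
  · simp only [Finset.expect_mul]
    rw [← Finset.expect_sum_comm]
    exact Finset.expect_le_expect fun z _ => hsum z _ x
  · simp only [Fintype.expect_eq_sum_div_card]
    exact (Finset.measurable_fun_sum _ fun z _ =>
      (measurable_minWeight P c ((τ z).symm e)).comp (by fun_prop)).div_const _
  · rw [integral_expect_minWeight_comp_perm P c τ e hμ]
    exact div_le_div_of_nonneg_right (hb e) (Nat.cast_nonneg _)
  · rw [← Finset.expect_sum_comm]
    refine (Finset.expect_le_expect fun z _ => ?_).trans (Fintype.expect_const W).le
    refine sum_minWeight_le _ (τ z).symm _ hW_nonneg fun p hp => (Nat.cast_le.2 ?_).trans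
      (hW p (mem_minimizers.1 hp).1)
    exact Finset.card_le_card_of_injOn (τ z).symm (fun e he => (Finset.mem_filter.1 he).2)
      (τ z).symm.injective.injOn

end Averaging

/-! ### Paths of the lattice -/

section WalkSegments

variable {V : Type*} {G : SimpleGraph V}

lemma exists_append_of_mem_support (S : Set V) {u v : V} (p : G.Walk u v)
    (h : ∃ a ∈ p.support, a ∈ S) :
    ∃ a ∈ S, ∃ (q : G.Walk u a) (r : G.Walk a v), p = q.append r ∧
      ∀ b ∈ p.support, b ∈ S → b ∈ r.support := by
  induction p with
  | @nil u =>
    obtain ⟨a, ha, haS⟩ := h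
    obtain rfl := List.mem_singleton.1 ha
    exact ⟨a, haS, .nil, .nil, rfl, fun _ hb _ => hb⟩
  | @cons u b v hadj p ih =>
    by_cases hu : u ∈ S
    · exact ⟨u, hu, .nil, .cons hadj p, rfl, fun _ hb _ => hb⟩
    have htail {a : V} (ha : a ∈ (SimpleGraph.Walk.cons hadj p).support) (haS : a ∈ S) :
        a ∈ p.support :=
      (List.mem_cons.1 ha).resolve_left fun hau => hu (hau ▸ haS)
    obtain ⟨a, ha, haS⟩ := h
    obtain ⟨a', ha', q, r, hp, hr⟩ := ih ⟨a, htail ha haS, haS⟩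
    exact ⟨a', ha', .cons hadj q, r, by rw [hp]; rfl, fun b hb hbS => hr b (htail hb hbS) hbS⟩

lemma exists_segment_of_mem_support (S : Set V) {u v : V} (p : G.Walk u v)
    (h : ∃ a ∈ p.support, a ∈ S) :
    ∃ a ∈ S, ∃ b ∈ S, ∃ (q : G.Walk u a) (β : G.Walk a b) (r : G.Walk b v),
      p = q.append (β.append r) ∧ ∀ w ∈ p.support, w ∈ S → w ∈ β.support := by
  obtain ⟨a, ha, q, p', hp, hp'⟩ := exists_append_of_mem_support S p h
  obtain ⟨b, hb, r, s, hr, hs⟩ := exists_append_of_mem_support S p'.reverse ⟨a, by simp, ha⟩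
  refine ⟨a, ha, b, hb, q, s.reverse, r.reverse, ?_, fun w hw hwS => ?_⟩
  · rw [hp, ← SimpleGraph.Walk.reverse_append, ← hr, SimpleGraph.Walk.reverse_reverse]
  · simpa using hs w (by simpa using hp' w hw hwS) hwS

end WalkSegments

section Lattice

variable {d : ℕ} {u v : Fin d → ℤ}

/-- The edges of a walk, in order. -/
def edgeList (α : (lattice d).Walk u v) : List (Edge d) :=
  α.darts.map fun a => ⟨a.edge, a.edge_mem⟩

/-- The set of edges of a walk. -/
def edgeFin (α : (lattice d).Walk u v) : Finset (Edge d) := (edgeList α).toFinset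

lemma pathTime_eq_sum_edgeList (x : Config d) (α : (lattice d).Walk u v) :
    pathTime x α = ((edgeList α).map fun e => (x e : ℝ)).sum := by
  simp [pathTime, edgeList, Function.comp_def]

lemma length_edgeList (α : (lattice d).Walk u v) : (edgeList α).length = α.length := by
  simp [edgeList]

lemma pathTime_append {w : Fin d → ℤ} (x : Config d) (α : (lattice d).Walk u v)
    (β : (lattice d).Walk v w) : pathTime x (α.append β) = pathTime x α + pathTime x β := by
  simp [pathTime, SimpleGraph.Walk.darts_append]

lemma pathTime_nonneg (x : Config d) (α : (lattice d).Walk u v) : 0 ≤ pathTime x α := by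
  refine List.sum_nonneg fun a ha => ?_
  obtain ⟨e, -, rfl⟩ := List.mem_map.1 ha
  exact (x _).2

lemma map_val_edgeList (α : (lattice d).Walk u v) : (edgeList α).map Subtype.val = α.edges := by
  simp [edgeList, SimpleGraph.Walk.edges, Function.comp_def]

lemma nodup_edgeList {α : (lattice d).Walk u v} (h : α.IsPath) : (edgeList α).Nodup :=
  List.Nodup.of_map Subtype.val (map_val_edgeList α ▸ h.isTrail.edges_nodup)

lemma pathTime_eq_setTime (x : Config d) {α : (lattice d).Walk u v} (h : α.IsPath) :
    pathTime x α = setTime (edgeFin α) x := by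
  rw [pathTime_eq_sum_edgeList, setTime, edgeFin, List.sum_toFinset _ (nodup_edgeList h)]

lemma card_edgeFin {α : (lattice d).Walk u v} (h : α.IsPath) :
    (edgeFin α).card = α.length := by
  rw [edgeFin, List.toFinset_card_of_nodup (nodup_edgeList h), length_edgeList]

lemma mem_edgeFin {α : (lattice d).Walk u v} {e : Edge d} : e ∈ edgeFin α ↔ e.1 ∈ α.edges := by
  rw [edgeFin, List.mem_toFinset, ← map_val_edgeList]
  simp

lemma setTime_toFinset_le {ι : Type*} [DecidableEq ι] (l : List ι) (x : ι → ℝ≥0) :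
    setTime l.toFinset x ≤ (l.map fun e => (x e : ℝ)).sum := by
  induction l with
  | nil => simp [setTime]
  | cons e l ih =>
    rw [List.toFinset_cons, List.map_cons, List.sum_cons]
    by_cases he : e ∈ l.toFinset
    · rw [Finset.insert_eq_of_mem he]
      exact ih.trans (le_add_of_nonneg_left (x e).2)
    · rw [setTime, Finset.sum_insert he]
      exact add_le_add_right ih _

lemma setTime_bypass_le (x : Config d) (α : (lattice d).Walk u v) :
    setTime (edgeFin α.bypass) x ≤ pathTime x α :=
  calc setTime (edgeFin α.bypass) x ≤ setTime (edgeFin α) x :=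
        Finset.sum_le_sum_of_subset_of_nonneg
          (fun _ he => mem_edgeFin.2 (α.edges_bypass_subset_edges (mem_edgeFin.1 he)))
          fun e _ _ => (x e).2
    _ ≤ ((edgeList α).map fun e => (x e : ℝ)).sum := setTime_toFinset_le _ x
    _ = pathTime x α := (pathTime_eq_sum_edgeList x α).symm

lemma l1norm_neg (v : Fin d → ℤ) : l1norm (-v) = l1norm v := by simp [l1norm]

lemma l1norm_sub_comm (u v : Fin d → ℤ) : l1norm (u - v) = l1norm (v - u) := by
  rw [← l1norm_neg, neg_sub]

lemma eq_zero_of_l1norm_eq_zero (h : l1norm v = 0) : v = 0 := by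
  funext i
  simpa [l1norm] using (Finset.sum_eq_zero_iff.1 h) i (Finset.mem_univ i)

/-- The unit vector in the direction of the coordinate `s.1`, with the sign `s.2`. -/
def dirVec (s : Fin d × Bool) : Fin d → ℤ := Pi.single s.1 (if s.2 then 1 else -1)

lemma l1norm_dirVec (s : Fin d × Bool) : l1norm (dirVec s) = 1 := by
  unfold l1norm dirVec
  rw [Finset.sum_eq_single s.1]
  · rw [Pi.single_eq_same]; split_ifs <;> rfl
  · intro j _ hj; simp [Pi.single_eq_of_ne hj]
  · simp

lemma adj_add_dirVec (u : Fin d → ℤ) (s : Fin d × Bool) : (lattice d).Adj u (u + dirVec s) := by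
  change l1norm (u - (u + dirVec s)) = 1
  rw [sub_add_cancel_left, l1norm_neg, l1norm_dirVec]

lemma exists_l1norm_sub_dirVec_add_one_eq (h : l1norm v ≠ 0) :
    ∃ s : Fin d × Bool, l1norm (v - dirVec s) + 1 = l1norm v := by
  obtain ⟨i, hi⟩ : ∃ i, v i ≠ 0 := by
    by_contra! hzero
    exact h (by simp [l1norm, hzero])
  refine ⟨(i, decide (0 < v i)), ?_⟩
  unfold l1norm
  rw [← Finset.add_sum_erase _ _ (Finset.mem_univ i),
    ← Finset.add_sum_erase Finset.univ (fun j => (v j).natAbs) (Finset.mem_univ i)]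
  have hother : ∑ j ∈ Finset.univ.erase i, ((v - dirVec (i, decide (0 < v i))) j).natAbs =
      ∑ j ∈ Finset.univ.erase i, (v j).natAbs := by
    refine Finset.sum_congr rfl fun j hj => ?_
    simp [dirVec, Pi.single_eq_of_ne (Finset.ne_of_mem_erase hj)]
  have hcoord : ((v - dirVec (i, decide (0 < v i))) i).natAbs + 1 = (v i).natAbs := by
    simp only [dirVec, Pi.sub_apply, Pi.single_eq_same, decide_eq_true_eq]
    split_ifs <;> omega
  omega

lemma exists_eq_add_dirVec_of_adj (h : (lattice d).Adj u v) : ∃ s, v = u + dirVec s := by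
  have hone : l1norm (v - u) = 1 := l1norm_sub_comm u v ▸ h
  obtain ⟨s, hs⟩ := exists_l1norm_sub_dirVec_add_one_eq (v := v - u) (by omega)
  have hzero : v - u - dirVec s = 0 := eq_zero_of_l1norm_eq_zero (by omega)
  exact ⟨s, sub_eq_zero.1 (sub_sub v u _ ▸ hzero)⟩

lemma exists_walk_length_eq (u v : Fin d → ℤ) :
    ∃ α : (lattice d).Walk u v, α.length = l1norm (v - u) := by
  induction hn : l1norm (v - u) generalizing u with
  | zero =>
    obtain rfl := sub_eq_zero.1 (eq_zero_of_l1norm_eq_zero hn)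
    exact ⟨.nil, rfl⟩
  | succ n ih =>
    obtain ⟨s, hs⟩ := exists_l1norm_sub_dirVec_add_one_eq (v := v - u) (by omega)
    obtain ⟨α, hα⟩ := ih (u + dirVec s) (by rw [← sub_sub]; omega)
    exact ⟨.cons (adj_add_dirVec u s) α, by simp [hα]⟩

lemma exists_isPath_length_le (u v : Fin d → ℤ) :
    ∃ α : (lattice d).Walk u v, α.IsPath ∧ α.length ≤ l1norm (v - u) := by
  obtain ⟨α, hα⟩ := exists_walk_length_eq u v
  exact ⟨α.bypass, α.bypass_isPath, hα ▸ α.length_bypass_le_length⟩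

/-- A self-avoiding path of minimal length between two vertices. -/
noncomputable def shortPath (u v : Fin d → ℤ) : (lattice d).Walk u v :=
  (exists_isPath_length_le u v).choose

lemma shortPath_isPath (u v : Fin d → ℤ) : (shortPath u v).IsPath :=
  (exists_isPath_length_le u v).choose_spec.1

lemma length_shortPath_le (u v : Fin d → ℤ) : (shortPath u v).length ≤ l1norm (v - u) :=
  (exists_isPath_length_le u v).choose_spec.2

/-- The edge lists of the walks with `j` steps from `u`. -/
def walkLists : ℕ → (Fin d → ℤ) → Finset (List (Edge d))
  | 0, _ => {[]}
  | j + 1, u => Finset.univ.biUnion fun s : Fin d × Bool =>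
      (walkLists j (u + dirVec s)).image fun l =>
        (⟨s(u, u + dirVec s), adj_add_dirVec u s⟩ : Edge d) :: l

lemma card_walkLists_le (j : ℕ) (u : Fin d → ℤ) : (walkLists j u).card ≤ (2 * d) ^ j := by
  induction j generalizing u with
  | zero => simp [walkLists]
  | succ j ih =>
    rw [walkLists]
    refine Finset.card_biUnion_le.trans ?_
    calc _ ≤ ∑ _s : Fin d × Bool, (2 * d) ^ j :=
          Finset.sum_le_sum fun s _ => Finset.card_image_le.trans (ih _)
      _ = (2 * d) ^ (j + 1) := by simp; ring

lemma length_of_mem_walkLists {j : ℕ} {l : List (Edge d)} (h : l ∈ walkLists j u) :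
    l.length = j := by
  induction j generalizing u l with
  | zero => simpa [walkLists] using h
  | succ j ih =>
    simp only [walkLists, Finset.mem_biUnion, Finset.mem_univ, true_and, Finset.mem_image] at h
    obtain ⟨s, l', hl', rfl⟩ := h
    simp [ih hl']

lemma edgeList_mem_walkLists (α : (lattice d).Walk u v) : edgeList α ∈ walkLists α.length u := by
  induction α with
  | nil => simp [edgeList, walkLists]
  | @cons u b v h p ih =>
    obtain ⟨s, rfl⟩ := exists_eq_add_dirVec_of_adj h
    simp only [SimpleGraph.Walk.length_cons, walkLists, Finset.mem_biUnion, Finset.mem_univ,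
      true_and, Finset.mem_image]
    exact ⟨s, edgeList p, ih, by simp [edgeList]⟩

/-- The edge sets of the walks with `j` steps from `u` that do not repeat an edge. -/
def trailSets (j : ℕ) (u : Fin d → ℤ) : Finset (Finset (Edge d)) :=
  ((walkLists j u).filter List.Nodup).image List.toFinset

lemma card_trailSets_le (j : ℕ) (u : Fin d → ℤ) : (trailSets j u).card ≤ (2 * d) ^ j :=
  Finset.card_image_le.trans ((Finset.card_filter_le _ _).trans (card_walkLists_le j u))

lemma card_of_mem_trailSets {j : ℕ} {p : Finset (Edge d)} (hp : p ∈ trailSets j u) :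
    p.card = j := by
  obtain ⟨l, hl, rfl⟩ := Finset.mem_image.1 hp
  obtain ⟨hl, hnodup⟩ := Finset.mem_filter.1 hl
  rw [List.toFinset_card_of_nodup hnodup, length_of_mem_walkLists hl]

lemma edgeFin_mem_trailSets {α : (lattice d).Walk u v} (hα : α.IsPath) :
    edgeFin α ∈ trailSets α.length u :=
  Finset.mem_image_of_mem _ (Finset.mem_filter.2 ⟨edgeList_mem_walkLists α, nodup_edgeList hα⟩)

open Classical in
/-- The edge sets of the self-avoiding paths of length at most `K` from `u` to `v`. -/
noncomputable def pathSets (K : ℕ) (u v : Fin d → ℤ) : Finset (Finset (Edge d)) :=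
  ((Finset.range (K + 1)).biUnion fun j => trailSets j u).filter
    fun p => ∃ α : (lattice d).Walk u v, α.IsPath ∧ α.length ≤ K ∧ edgeFin α = p

lemma mem_pathSets {K : ℕ} {p : Finset (Edge d)} : p ∈ pathSets K u v ↔
    ∃ α : (lattice d).Walk u v, α.IsPath ∧ α.length ≤ K ∧ edgeFin α = p := by
  simp only [pathSets, Finset.mem_filter, Finset.mem_biUnion, Finset.mem_range,
    and_iff_right_iff_imp]
  rintro ⟨α, hα, hK, rfl⟩
  exact ⟨α.length, by omega, edgeFin_mem_trailSets hα⟩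

lemma capMin_pathSets_le_pathTime {K : ℕ} {a : ℝ} (x : Config d) {α : (lattice d).Walk u v}
    (hα : α.length ≤ K) : capMin (pathSets K u v) a x ≤ pathTime x α :=
  (capMin_le (mem_pathSets.2 ⟨α.bypass, α.bypass_isPath,
    α.length_bypass_le_length.trans hα, rfl⟩) x).trans (setTime_bypass_le x α)

/-- The event that a self-avoiding path from `u` of some length `j ≥ k` has time at most `c j`. -/
def fastPaths (c : ℝ) (u : Fin d → ℤ) (k : ℕ) : Set (Config d) :=
  {x | ∃ (v : Fin d → ℤ) (α : (lattice d).Walk u v),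
    α.IsPath ∧ k ≤ α.length ∧ pathTime x α ≤ c * α.length}

/-- Between its first and its last visit to `S`, a minimizing path is at most as slow as the detour
along a short path. -/
lemma card_filter_mem_support_le {K k : ℕ} {c a : ℝ} (hc : 0 ≤ c) {x : Config d}
    (S : Finset (Fin d → ℤ)) {α : (lattice d).Walk u v} (hα : α.IsPath) (hK : α.length ≤ K)
    (hmin : edgeFin α ∈ minimizers (pathSets K u v) a x)
    (hdist : ∀ w ∈ S, ∀ w' ∈ S, l1norm (w' - w) ≤ k)
    (hfast : ∀ w ∈ S, x ∉ fastPaths c w k)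
    (hslow : ∀ w ∈ S, ∀ w' ∈ S, pathTime x (shortPath w w') ≤ c * k) :
    (S.filter (· ∈ α.support)).card ≤ k := by
  by_contra! hcard
  obtain ⟨w, hw⟩ := Finset.card_pos.1 (hcard.trans_le' (Nat.zero_le k))
  obtain ⟨hwS, hwα⟩ := Finset.mem_filter.1 hw
  obtain ⟨w, hwS, w', hwS', q, β, r, hαβ, hvisits⟩ :=
    exists_segment_of_mem_support (S : Set (Fin d → ℤ)) α ⟨w, hwα, hwS⟩
  have hβ : β.IsPath := by
    rw [hαβ] at hα
    exact hα.of_append_right.of_append_left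
  have hkβ : k ≤ β.length := by
    have hsub : S.filter (· ∈ α.support) ⊆ β.support.toFinset := fun b hb =>
      List.mem_toFinset.2 (hvisits b (Finset.mem_filter.1 hb).2 (Finset.mem_filter.1 hb).1)
    have hle := (Finset.card_le_card hsub).trans (List.toFinset_card_le _)
    rw [SimpleGraph.Walk.length_support] at hle
    omega
  have hdetour : pathTime x β ≤ pathTime x (shortPath w w') := by
    have hlen : (q.append ((shortPath w w').append r)).length ≤ K := by
      have hshort := (length_shortPath_le w w').trans (hdist w hwS w' hwS')
      refine le_trans ?_ hK
      simp only [hαβ, SimpleGraph.Walk.length_append]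
      omega
    have hle : pathTime x α ≤ pathTime x (q.append ((shortPath w w').append r)) := by
      rw [pathTime_eq_setTime x hα, setTime_eq_of_mem_minimizers hmin]
      exact capMin_pathSets_le_pathTime x hlen
    simp only [hαβ, pathTime_append] at hle
    linarith
  refine hfast w hwS ⟨w', β, hβ, hkβ, hdetour.trans ((hslow w hwS w' hwS').trans ?_)⟩
  exact mul_le_mul_of_nonneg_left (mod_cast hkβ) hc

end Lattice

section PassageTime

variable {d : ℕ} {u v : Fin d → ℤ}

lemma passageTime_le_pathTime (x : Config d) (α : (lattice d).Walk u v) :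
    passageTime x u v ≤ pathTime x α :=
  ciInf_le ⟨0, by rintro _ ⟨β, rfl⟩; exact pathTime_nonneg x β⟩ α

lemma le_passageTime {x : Config d} {a : ℝ} (h : ∀ α : (lattice d).Walk u v, a ≤ pathTime x α) :
    a ≤ passageTime x u v := by
  have : Nonempty ((lattice d).Walk u v) := ⟨shortPath u v⟩
  exact le_ciInf h

lemma passageTime_nonneg (x : Config d) (u v : Fin d → ℤ) : 0 ≤ passageTime x u v :=
  le_passageTime fun α => pathTime_nonneg x α

lemma passageTime_le_add_pathTime (x : Config d) (u v w : Fin d → ℤ) :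
    passageTime x u w ≤ passageTime x u v + pathTime x (shortPath v w) := by
  rw [← sub_le_iff_le_add]
  refine le_passageTime fun α => ?_
  rw [sub_le_iff_le_add, ← pathTime_append]
  exact passageTime_le_pathTime x _

lemma pathTime_reverse (x : Config d) (α : (lattice d).Walk u v) :
    pathTime x α.reverse = pathTime x α := by
  unfold pathTime
  rw [SimpleGraph.Walk.darts_reverse, List.map_reverse, List.sum_reverse, List.map_map]
  congr 1
  exact List.map_congr_left fun a _ => by simp

lemma passageTime_comm (x : Config d) (u v : Fin d → ℤ) :
    passageTime x u v = passageTime x v u := by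
  have hle (u v : Fin d → ℤ) : passageTime x u v ≤ passageTime x v u :=
    le_passageTime fun α =>
      (passageTime_le_pathTime x α.reverse).trans (pathTime_reverse x α).le
  exact le_antisymm (hle u v) (hle v u)

lemma capMin_eq_passageTime {K : ℕ} {c : ℝ} {x : Config d}
    (hc : 0 ≤ c) (hfast : x ∉ fastPaths c u K)
    (hslow : pathTime x (shortPath u v) ≤ c * K) :
    capMin (pathSets K u v) (c * K) x = passageTime x u v := by
  refine le_antisymm (le_passageTime fun α => ?_) (le_capMin_iff.2 ⟨?_, fun p hp => ?_⟩)
  · by_cases hlen : α.bypass.length ≤ K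
    · exact (capMin_le (mem_pathSets.2 ⟨α.bypass, α.bypass_isPath, hlen, rfl⟩) x).trans
        (setTime_bypass_le x α)
    · calc capMin (pathSets K u v) (c * K) x ≤ c * K := capMin_le_cap x
        _ ≤ c * α.bypass.length :=
            mul_le_mul_of_nonneg_left (mod_cast (not_le.1 hlen).le) hc
        _ ≤ pathTime x α.bypass := not_lt.1 fun hlt =>
            hfast ⟨v, α.bypass, α.bypass_isPath, (not_le.1 hlen).le, hlt.le⟩
        _ ≤ pathTime x α := by
            rw [pathTime_eq_setTime x α.bypass_isPath]
            exact setTime_bypass_le x α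
  · exact (passageTime_le_pathTime x _).trans hslow
  · obtain ⟨α, hα, -, rfl⟩ := mem_pathSets.1 hp
    rw [← pathTime_eq_setTime x hα]
    exact passageTime_le_pathTime x α

lemma abs_passageTime_sub_capMin_le {K : ℕ} {c : ℝ} (x : Config d) (hc : 0 ≤ c)
    (hK : l1norm (v - u) ≤ K) :
    |passageTime x u v - capMin (pathSets K u v) c x| ≤ pathTime x (shortPath u v) := by
  have hcap := capMin_pathSets_le_pathTime (a := c) x ((length_shortPath_le u v).trans hK)
  have hpass := passageTime_le_pathTime x (shortPath u v)
  have hcap_nonneg := capMin_nonneg (P := pathSets K u v) hc x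
  have hpass_nonneg := passageTime_nonneg x u v
  exact abs_le.2 ⟨by linarith, by linarith⟩

/-- Translation by `z`, as an automorphism of the lattice. -/
def shiftIso (z : Fin d → ℤ) : lattice d ≃g lattice d where
  toEquiv := Equiv.addRight z
  map_rel_iff' := by
    intro u v
    change l1norm (u + z - (v + z)) = 1 ↔ l1norm (u - v) = 1
    rw [add_sub_add_right_eq_sub]

/-- Translation of the edges by `z`. -/
def shift (z : Fin d → ℤ) : Equiv.Perm (Edge d) := (shiftIso z).mapEdgeSet

lemma shift_symm_val (z a b : Fin d → ℤ) (h : s(a, b) ∈ (lattice d).edgeSet) :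
    ((shift z).symm ⟨s(a, b), h⟩).1 = s(a - z, b - z) := by
  change Sym2.map _ s(a, b) = _
  simp [shiftIso, sub_eq_add_neg]

lemma comp_shift_comp_shift_neg (x : Config d) (z : Fin d → ℤ) :
    (x ∘ shift z) ∘ shift (-z) = x := by
  funext ⟨e, he⟩
  induction e using Sym2.ind with
  | _ a b =>
    refine congrArg x (Subtype.ext ?_)
    change Sym2.map _ (Sym2.map _ s(a, b)) = s(a, b)
    simp [shiftIso]

lemma pathTime_map_shift (x : Config d) (z : Fin d → ℤ) (α : (lattice d).Walk u v) :
    pathTime x (α.map (shiftIso z).toHom) = pathTime (x ∘ shift z) α := by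
  unfold pathTime
  rw [SimpleGraph.Walk.darts_map, List.map_map]
  rfl

lemma passageTime_shift (x : Config d) (z u v : Fin d → ℤ) :
    passageTime (x ∘ shift z) u v = passageTime x (u + z) (v + z) := by
  have hle (x : Config d) (z u v : Fin d → ℤ) :
      passageTime x (u + z) (v + z) ≤ passageTime (x ∘ shift z) u v :=
    le_passageTime fun α => by
      rw [← pathTime_map_shift]
      exact passageTime_le_pathTime x _
  refine le_antisymm ?_ (hle x z u v)
  simpa [comp_shift_comp_shift_neg] using hle (x ∘ shift z) (-z) (u + z) (v + z)

end PassageTime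

/-! ### Large deviations of path times -/

section ExponentialMoments

variable {ι : Type*} {ν : Measure ℝ≥0}

lemma exp_mul_setTime (p : Finset ι) (t : ℝ) (x : ι → ℝ≥0) :
    Real.exp (t * setTime p x) = ∏ e, Real.exp (t * p.restrict x e) := by
  rw [← Real.exp_sum, ← Finset.mul_sum, setTime, ← Finset.sum_coe_sort p fun e => (x e : ℝ)]
  rfl

variable [IsProbabilityMeasure ν]

lemma integrable_exp_setTime (p : Finset ι) {t : ℝ}
    (ht : Integrable (fun y : ℝ≥0 => Real.exp (t * y)) ν) :
    Integrable (fun x => Real.exp (t * setTime p x)) (Measure.infinitePi fun _ : ι => ν) := by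
  simp only [exp_mul_setTime]
  refine Integrable.comp_measurable (f := p.restrict (π := fun _ => ℝ≥0))
    (g := fun x => ∏ e, Real.exp (t * x e)) ?_ (by fun_prop)
  rw [Measure.infinitePi_map_restrict]
  exact Integrable.fintype_prod (f := fun _ (y : ℝ≥0) => Real.exp (t * y)) fun _ => ht

lemma integral_exp_setTime (p : Finset ι) (t : ℝ) :
    ∫ x, Real.exp (t * setTime p x) ∂(Measure.infinitePi fun _ : ι => ν) =
      (∫ y : ℝ≥0, Real.exp (t * y) ∂ν) ^ p.card := by
  have hmeas : Measurable fun x : p → ℝ≥0 => ∏ e, Real.exp (t * x e) := by fun_prop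
  simp only [exp_mul_setTime]
  rw [integral_restrict_infinitePi (fun _ : ι => ν) hmeas.aestronglyMeasurable,
    integral_fintype_prod_eq_pow (fun y : ℝ≥0 => Real.exp (t * y)), Fintype.card_coe]

lemma one_le_integral_exp {δ : ℝ} (hδ : 0 ≤ δ)
    (hexp : Integrable (fun y : ℝ≥0 => Real.exp (δ * y)) ν) :
    1 ≤ ∫ y : ℝ≥0, Real.exp (δ * y) ∂ν := by
  have hmono : ∫ _y : ℝ≥0, (1 : ℝ) ∂ν ≤ ∫ y : ℝ≥0, Real.exp (δ * y) ∂ν :=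
    integral_mono (integrable_const _) hexp fun y => Real.one_le_exp (by positivity)
  simpa using hmono

lemma exp_neg_mul_le_one {c : ℝ} (hc : 0 ≤ c) (y : ℝ≥0) : Real.exp (-c * y) ≤ 1 :=
  Real.exp_le_one_iff.2 (by rw [neg_mul, neg_nonpos]; positivity)

lemma integrable_exp_neg_mul {c : ℝ} (hc : 0 ≤ c) :
    Integrable (fun y : ℝ≥0 => Real.exp (-c * y)) ν :=
  Integrable.of_bound (by fun_prop) 1 <| ae_of_all _ fun y => by
    rw [Real.norm_of_nonneg (Real.exp_pos _).le]
    exact exp_neg_mul_le_one hc y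

lemma tendsto_integral_exp_neg_mul (hν : ν {0} = 0) :
    Tendsto (fun n : ℕ => ∫ y : ℝ≥0, Real.exp (-(n : ℝ) * y) ∂ν) atTop (𝓝 0) := by
  have hlim : ∀ᵐ y : ℝ≥0 ∂ν,
      Tendsto (fun n : ℕ => Real.exp (-(n : ℝ) * y)) atTop (𝓝 0) := by
    have hne : ∀ᵐ y : ℝ≥0 ∂ν, y ≠ 0 := by
      rw [ae_iff]; simpa using hν
    filter_upwards [hne] with y hy
    have hpos : (0 : ℝ) < y := mod_cast pos_iff_ne_zero.2 hy
    simp only [neg_mul]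
    exact Real.tendsto_exp_neg_atTop_nhds_zero.comp
      (tendsto_natCast_atTop_atTop.atTop_mul_const hpos)
  simpa using tendsto_integral_of_dominated_convergence (fun _ => (1 : ℝ))
    (fun n => (integrable_exp_neg_mul n.cast_nonneg).aestronglyMeasurable) (integrable_const _)
    (fun n => ae_of_all _ fun y => by
      rw [Real.norm_of_nonneg (Real.exp_pos _).le]
      exact exp_neg_mul_le_one n.cast_nonneg y) hlim

lemma exists_mul_integral_exp_neg_inv_mul_le (hν : ν {0} = 0) (d : ℕ) : ∃ c : ℝ, 0 < c ∧
    2 * d * Real.exp 1 * ∫ y : ℝ≥0, Real.exp (-c⁻¹ * y) ∂ν ≤ Real.exp (-1) := by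
  have hlim := (tendsto_integral_exp_neg_mul hν).const_mul (2 * d * Real.exp 1)
  rw [mul_zero] at hlim
  obtain ⟨n, hn, hpos⟩ := ((hlim.eventually_lt_const (Real.exp_pos (-1))).and
    (eventually_gt_atTop 0)).exists
  exact ⟨(n : ℝ)⁻¹, inv_pos.2 (mod_cast hpos), by rw [inv_inv]; exact hn.le⟩

end ExponentialMoments

section LatticeProbability

variable {d : ℕ} {ν : Measure ℝ≥0} [IsProbabilityMeasure ν]

instance isProbabilityMeasure_edgeLaw : IsProbabilityMeasure (edgeLaw d ν) := by
  unfold edgeLaw; infer_instance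

lemma measurable_pathTime {u v : Fin d → ℤ} (α : (lattice d).Walk u v) :
    Measurable fun x : Config d => pathTime x α := by
  simp only [pathTime_eq_sum_edgeList]
  generalize edgeList α = l
  induction l with
  | nil => simp
  | cons e l ih =>
    simp only [List.map_cons, List.sum_cons]
    exact Measurable.add (by fun_prop) ih

lemma fastPaths_eq_iUnion (c : ℝ) (u : Fin d → ℤ) (k : ℕ) :
    fastPaths c u k = ⋃ p ∈ {p | ∃ (v : Fin d → ℤ) (α : (lattice d).Walk u v),
      α.IsPath ∧ k ≤ α.length ∧ edgeFin α = p}, {x | setTime p x ≤ c * p.card} := by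
  ext x
  simp only [fastPaths, Set.mem_ofPred_eq, Set.mem_iUnion, exists_prop]
  constructor
  · rintro ⟨v, α, hα, hk, hfast⟩
    exact ⟨_, ⟨v, α, hα, hk, rfl⟩, by rwa [← pathTime_eq_setTime x hα, card_edgeFin hα]⟩
  · rintro ⟨_, ⟨v, α, hα, hk, rfl⟩, hfast⟩
    exact ⟨v, α, hα, hk, by rwa [pathTime_eq_setTime x hα, ← card_edgeFin hα]⟩

lemma measurableSet_fastPaths (c : ℝ) (u : Fin d → ℤ) (k : ℕ) :
    MeasurableSet (fastPaths c u k) := by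
  rw [fastPaths_eq_iUnion]
  exact MeasurableSet.biUnion (Set.to_countable _) fun p _ =>
    measurableSet_le (measurable_setTime p) measurable_const

lemma measureReal_setTime_le_le (p : Finset (Edge d)) {c : ℝ} (hc : 0 < c) :
    (edgeLaw d ν).real {x | setTime p x ≤ c * p.card} ≤
      (Real.exp 1 * ∫ y : ℝ≥0, Real.exp (-c⁻¹ * y) ∂ν) ^ p.card := by
  have hchernoff := measure_le_le_exp_mul_mgf (μ := edgeLaw d ν) (X := setTime p) (c * p.card)
    (t := -c⁻¹) (neg_nonpos.2 (inv_pos.2 hc).le)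
    (integrable_exp_setTime p (integrable_exp_neg_mul (inv_pos.2 hc).le))
  refine hchernoff.trans_eq ?_
  rw [mgf, edgeLaw, integral_exp_setTime, mul_pow, ← Real.exp_nat_mul]
  congr 2
  field_simp

lemma measureReal_iUnion_trailSets_le {c : ℝ} (hc : 0 < c)
    (hρ : 2 * d * Real.exp 1 * ∫ y : ℝ≥0, Real.exp (-c⁻¹ * y) ∂ν ≤ Real.exp (-1))
    (u : Fin d → ℤ) (j : ℕ) :
    (edgeLaw d ν).real (⋃ p ∈ trailSets j u, {x | setTime p x ≤ c * j}) ≤ Real.exp (-1) ^ j := by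
  set ρ := Real.exp 1 * ∫ y : ℝ≥0, Real.exp (-c⁻¹ * y) ∂ν with hρ_def
  have hρ_nonneg : 0 ≤ ρ :=
    mul_nonneg (Real.exp_pos _).le (integral_nonneg fun y => (Real.exp_pos _).le)
  have hone : ∀ p ∈ trailSets j u, (edgeLaw d ν).real {x | setTime p x ≤ c * j} ≤ ρ ^ j := by
    intro p hp
    obtain rfl := card_of_mem_trailSets hp
    exact measureReal_setTime_le_le p hc
  calc (edgeLaw d ν).real (⋃ p ∈ trailSets j u, {x | setTime p x ≤ c * j})
      ≤ (trailSets j u).card * ρ ^ j := by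
        refine (measureReal_biUnion_finset_le _ _).trans ((Finset.sum_le_sum hone).trans_eq ?_)
        rw [Finset.sum_const, nsmul_eq_mul]
    _ ≤ (2 * d : ℝ) ^ j * ρ ^ j :=
        mul_le_mul_of_nonneg_right (mod_cast card_trailSets_le j u) (pow_nonneg hρ_nonneg j)
    _ = (2 * d * ρ) ^ j := (mul_pow _ _ _).symm
    _ ≤ Real.exp (-1) ^ j :=
        pow_le_pow_left₀ (by positivity) (by rwa [hρ_def, ← mul_assoc]) j

lemma exp_neg_one_le_half : Real.exp (-1) ≤ 1 / 2 := by
  rw [Real.exp_neg, one_div]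
  exact inv_anti₀ two_pos (by linarith [Real.add_one_le_exp (1 : ℝ)])

lemma measureReal_fastPaths_le {c : ℝ} (hc : 0 < c)
    (hρ : 2 * d * Real.exp 1 * ∫ y : ℝ≥0, Real.exp (-c⁻¹ * y) ∂ν ≤ Real.exp (-1))
    (u : Fin d → ℤ) (k : ℕ) : (edgeLaw d ν).real (fastPaths c u k) ≤ 2 * Real.exp (-k) := by
  have hsub : fastPaths c u k ⊆
      ⋃ i : ℕ, ⋃ p ∈ trailSets (k + i) u, {x | setTime p x ≤ c * (k + i : ℕ)} := by
    rintro x ⟨v, α, hα, hk, hfast⟩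
    simp only [Set.mem_iUnion, exists_prop]
    refine ⟨α.length - k, edgeFin α, ?_, ?_⟩ <;> rw [Nat.add_sub_cancel' hk]
    · exact edgeFin_mem_trailSets hα
    · rwa [Set.mem_ofPred_eq, ← pathTime_eq_setTime x hα]
  have hgeom : HasSum (fun i : ℕ => Real.exp (-1) ^ (k + i))
      (Real.exp (-1) ^ k * (1 - Real.exp (-1))⁻¹) := by
    simp only [pow_add]
    exact (hasSum_geometric_of_lt_one (Real.exp_pos _).le (by simp)).mul_left _
  have hle : edgeLaw d ν (fastPaths c u k) ≤
      ENNReal.ofReal (Real.exp (-1) ^ k * (1 - Real.exp (-1))⁻¹) := by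
    rw [← hgeom.tsum_eq, ENNReal.ofReal_tsum_of_nonneg (fun i => by positivity) hgeom.summable]
    refine (measure_mono hsub).trans ((measure_iUnion_le _).trans
      (ENNReal.tsum_le_tsum fun i => ?_))
    rw [← ofReal_measureReal (measure_ne_top _ _)]
    exact ENNReal.ofReal_le_ofReal (measureReal_iUnion_trailSets_le hc hρ u (k + i))
  calc (edgeLaw d ν).real (fastPaths c u k)
      ≤ Real.exp (-1) ^ k * (1 - Real.exp (-1))⁻¹ :=
        ENNReal.toReal_le_of_le_ofReal (hgeom.nonneg fun i => by positivity) hle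
    _ ≤ Real.exp (-1) ^ k * 2 := by
        have hinv : (1 - Real.exp (-1))⁻¹ ≤ 2 := by
          rw [inv_le_comm₀ (by linarith [exp_neg_one_le_half]) two_pos]
          linarith [exp_neg_one_le_half]
        exact mul_le_mul_of_nonneg_left hinv (by positivity)
    _ = 2 * Real.exp (-k) := by
        rw [← Real.exp_nat_mul, mul_comm, mul_neg_one]

lemma integrable_exp_pathTime {δ : ℝ} (hexp : Integrable (fun y : ℝ≥0 => Real.exp (δ * y)) ν)
    (u v : Fin d → ℤ) :
    Integrable (fun x => Real.exp (δ * pathTime x (shortPath u v))) (edgeLaw d ν) := by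
  simp only [fun x => pathTime_eq_setTime x (shortPath_isPath u v)]
  exact integrable_exp_setTime _ hexp

lemma integral_exp_pathTime_le {δ : ℝ} (hδ : 0 ≤ δ)
    (hexp : Integrable (fun y : ℝ≥0 => Real.exp (δ * y)) ν)
    (u v : Fin d → ℤ) {n : ℕ} (hn : l1norm (v - u) ≤ n) :
    ∫ x, Real.exp (δ * pathTime x (shortPath u v)) ∂(edgeLaw d ν) ≤
      (∫ y : ℝ≥0, Real.exp (δ * y) ∂ν) ^ n := by
  simp only [fun x => pathTime_eq_setTime x (shortPath_isPath u v)]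
  rw [edgeLaw, integral_exp_setTime, card_edgeFin (shortPath_isPath u v)]
  exact pow_le_pow_right₀ (one_le_integral_exp hδ hexp) ((length_shortPath_le u v).trans hn)

lemma measureReal_lt_pathTime_le {δ : ℝ} (hδ : 0 ≤ δ)
    (hexp : Integrable (fun y : ℝ≥0 => Real.exp (δ * y)) ν)
    (u v : Fin d → ℤ) {n : ℕ} (hn : l1norm (v - u) ≤ n) (a : ℝ) :
    (edgeLaw d ν).real {x | a < pathTime x (shortPath u v)} ≤
      Real.exp (-δ * a) * (∫ y : ℝ≥0, Real.exp (δ * y) ∂ν) ^ n :=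
  calc (edgeLaw d ν).real {x | a < pathTime x (shortPath u v)}
      ≤ (edgeLaw d ν).real {x | a ≤ pathTime x (shortPath u v)} :=
        measureReal_mono fun x (hx : a < _) => hx.le
    _ ≤ Real.exp (-δ * a) * mgf (fun x => pathTime x (shortPath u v)) (edgeLaw d ν) δ :=
        measure_ge_le_exp_mul_mgf a hδ (integrable_exp_pathTime hexp u v)
    _ ≤ Real.exp (-δ * a) * (∫ y : ℝ≥0, Real.exp (δ * y) ∂ν) ^ n :=
        mul_le_mul_of_nonneg_left (integral_exp_pathTime_le hδ hexp u v hn) (Real.exp_pos _).le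

/-- The vector of `ℤ^d` with coordinates in `{0, …, m - 1}` given by `z`. -/
def boxVec {m : ℕ} (z : Fin d → Fin m) : Fin d → ℤ := fun i => ((z i : ℕ) : ℤ)

lemma l1norm_boxVec_sub_le {m : ℕ} (z z' : Fin d → Fin m) :
    l1norm (boxVec z - boxVec z') ≤ d * m :=
  calc l1norm (boxVec z - boxVec z') ≤ ∑ _i : Fin d, m := Finset.sum_le_sum fun i _ => by
        have hlt := (z i).2
        have hlt' := (z' i).2
        simp only [boxVec, Pi.sub_apply]
        omega
    _ = d * m := by simp

lemma l1norm_boxVec_le {m : ℕ} (z : Fin d → Fin m) : l1norm (boxVec z) ≤ d * m :=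
  calc l1norm (boxVec z) ≤ ∑ _i : Fin d, m := Finset.sum_le_sum fun i _ => by
        simp only [boxVec, Int.natAbs_natCast]
        exact (z i).2.le
    _ = d * m := by simp

lemma boxVec_injective {m : ℕ} : Injective (boxVec : (Fin d → Fin m) → Fin d → ℤ) :=
  fun _ _ h => funext fun i => Fin.ext (Int.ofNat_inj.1 (congrFun h i))

/-- The event that a long path from a site of the box `w - {0, …, m - 1}^d` is fast, or that a
short path between two of its sites is slow. -/
def badBox (c : ℝ) (k m : ℕ) (w : Fin d → ℤ) : Set (Config d) :=
  (⋃ z : Fin d → Fin m, fastPaths c (w - boxVec z) k) ∪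
    ⋃ z : Fin d → Fin m, ⋃ z' : Fin d → Fin m,
      {x | c * k < pathTime x (shortPath (w - boxVec z) (w - boxVec z'))}

lemma measurableSet_badBox (c : ℝ) (k m : ℕ) (w : Fin d → ℤ) :
    MeasurableSet (badBox c k m w) :=
  (MeasurableSet.iUnion fun _ => measurableSet_fastPaths c _ k).union
    (MeasurableSet.iUnion fun _ => MeasurableSet.iUnion fun _ =>
      measurableSet_lt measurable_const (measurable_pathTime _))

lemma l1norm_sub_boxVec_sub_le {m : ℕ} (w : Fin d → ℤ) (z z' : Fin d → Fin m) :
    l1norm (w - boxVec z' - (w - boxVec z)) ≤ d * m := by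
  rw [sub_sub_sub_cancel_left]
  exact l1norm_boxVec_sub_le z z'

lemma card_box (d m : ℕ) : (Fintype.card (Fin d → Fin m) : ℝ) = (m : ℝ) ^ d := by simp

lemma measureReal_badBox_le {δ : ℝ} (hδ : 0 ≤ δ)
    (hexp : Integrable (fun y : ℝ≥0 => Real.exp (δ * y)) ν) {c : ℝ} (hc : 0 < c)
    (hρ : 2 * d * Real.exp 1 * ∫ y : ℝ≥0, Real.exp (-c⁻¹ * y) ∂ν ≤ Real.exp (-1))
    (k m : ℕ) (w : Fin d → ℤ) :
    (edgeLaw d ν).real (badBox c k m w) ≤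
      (m : ℝ) ^ d * (2 * Real.exp (-k)) + (m : ℝ) ^ d * ((m : ℝ) ^ d *
        (Real.exp (-δ * (c * k)) * (∫ y : ℝ≥0, Real.exp (δ * y) ∂ν) ^ (d * m))) := by
  have hunion {A : (Fin d → Fin m) → Set (Config d)} {b : ℝ}
      (hb : ∀ z, (edgeLaw d ν).real (A z) ≤ b) :
      (edgeLaw d ν).real (⋃ z, A z) ≤ (m : ℝ) ^ d * b := by
    refine (measureReal_iUnion_fintype_le _).trans
      ((Finset.sum_le_sum fun z _ => hb z).trans_eq ?_)
    rw [Finset.sum_const, nsmul_eq_mul, Finset.card_univ, card_box]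
  exact (measureReal_union_le _ _).trans (add_le_add
    (hunion fun z => measureReal_fastPaths_le hc hρ _ _)
    (hunion fun z => hunion fun z' =>
      measureReal_lt_pathTime_le hδ hexp _ _ (l1norm_sub_boxVec_sub_le w z z') _))

lemma sum_minWeight_shift_le {c a : ℝ} (hc : 0 ≤ c) {K k m : ℕ} (hk : d * m ≤ k)
    {u v w w' : Fin d → ℤ} (he : s(w, w') ∈ (lattice d).edgeSet) {x : Config d}
    (hx : x ∉ badBox c k m w) :
    ∑ z : Fin d → Fin m, minWeight (pathSets K u v) a x ((shift (boxVec z)).symm ⟨s(w, w'), he⟩) ≤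
      k := by
  classical
  simp only [badBox, Set.mem_union, Set.mem_iUnion, not_or, not_exists] at hx
  obtain ⟨hfast, hslow⟩ := hx
  set site : (Fin d → Fin m) → Fin d → ℤ := fun z => w - boxVec z
  have hsite_inj : Injective site := fun z z' h => boxVec_injective (sub_right_injective h)
  refine sum_minWeight_le Finset.univ _ x (Nat.cast_nonneg k) fun p hp => ?_
  obtain ⟨α, hα, hK, rfl⟩ := mem_pathSets.1 (mem_minimizers.1 hp).1
  rw [Nat.cast_le]
  refine le_trans ?_ (card_filter_mem_support_le hc (Finset.univ.image site) hα hK hp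
    ?dist ?fast ?slow)
  case dist =>
    simp only [Finset.forall_mem_image]
    exact fun z _ z' _ => (l1norm_sub_boxVec_sub_le w z z').trans hk
  case fast =>
    simp only [Finset.forall_mem_image]
    exact fun z _ => hfast z
  case slow =>
    simp only [Finset.forall_mem_image]
    exact fun z _ z' _ => not_lt.1 (hslow z z')
  refine Finset.card_le_card_of_injOn site (fun z hz => ?_) hsite_inj.injOn
  have hedge := (Finset.mem_filter.1 (Finset.mem_coe.1 hz)).2
  rw [mem_edgeFin, shift_symm_val] at hedge
  exact Finset.mem_coe.2 (Finset.mem_filter.2 ⟨Finset.mem_image_of_mem _ (Finset.mem_univ z),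
    α.fst_mem_support_of_mem_edges hedge⟩)

/-- Off the bad event a minimizing path visits at most `k` sites of a box; on it, the trivial bound
`m ^ d` is used. -/
lemma integral_sum_minWeight_shift_le {δ : ℝ} (hδ : 0 ≤ δ)
    (hexp : Integrable (fun y : ℝ≥0 => Real.exp (δ * y)) ν) {c : ℝ} (hc : 0 < c)
    (hρ : 2 * d * Real.exp 1 * ∫ y : ℝ≥0, Real.exp (-c⁻¹ * y) ∂ν ≤ Real.exp (-1))
    (K : ℕ) (a : ℝ) (u v : Fin d → ℤ) {m k : ℕ} (hk : d * m ≤ k) (e : Edge d) :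
    ∫ x, ∑ z : Fin d → Fin m, minWeight (pathSets K u v) a x ((shift (boxVec z)).symm e)
      ∂(edgeLaw d ν) ≤
    k + (m : ℝ) ^ d * ((m : ℝ) ^ d * (2 * Real.exp (-k)) + (m : ℝ) ^ d * ((m : ℝ) ^ d *
      (Real.exp (-δ * (c * k)) * (∫ y : ℝ≥0, Real.exp (δ * y) ∂ν) ^ (d * m)))) := by
  obtain ⟨e, he⟩ := e
  induction e using Sym2.ind with
  | _ w w' =>
  set B := badBox c k m w
  have hB : MeasurableSet B := measurableSet_badBox c k m w
  have hpoint (x : Config d) : ∑ z : Fin d → Fin m,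
      minWeight (pathSets K u v) a x ((shift (boxVec z)).symm ⟨s(w, w'), he⟩) ≤
      k + (m : ℝ) ^ d * B.indicator 1 x := by
    by_cases hx : x ∈ B
    · rw [Set.indicator_of_mem hx, Pi.one_apply]
      calc _ ≤ ∑ _z : Fin d → Fin m, (1 : ℝ) :=
            Finset.sum_le_sum fun z _ => (upperGradient_capMin _ a).le_one x _
        _ = (m : ℝ) ^ d * 1 := by rw [Finset.sum_const, nsmul_eq_mul, Finset.card_univ, card_box]
        _ ≤ k + (m : ℝ) ^ d * 1 := le_add_of_nonneg_left k.cast_nonneg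
    · rw [Set.indicator_of_notMem hx, mul_zero, add_zero]
      exact sum_minWeight_shift_le hc.le hk he hx
  have hB_int : Integrable (B.indicator (1 : Config d → ℝ)) (edgeLaw d ν) :=
    (integrable_const (1 : ℝ)).indicator hB
  calc _ ≤ ∫ x, (k + (m : ℝ) ^ d * B.indicator 1 x) ∂(edgeLaw d ν) :=
        integral_mono_of_nonneg (ae_of_all _ fun x => Finset.sum_nonneg fun z _ =>
          (upperGradient_capMin _ a).nonneg x _)
          ((integrable_const _).add (hB_int.const_mul _)) (ae_of_all _ hpoint)
    _ = k + (m : ℝ) ^ d * (edgeLaw d ν).real B := by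
        rw [integral_add (integrable_const _) (hB_int.const_mul _), integral_const_mul,
          integral_indicator_one hB, integral_const, probReal_univ, one_smul]
    _ ≤ _ := by
        gcongr
        exact measureReal_badBox_le hδ hexp hc hρ k m w

end LatticeProbability

/-! ### The averaged passage time -/

section SmoothTime

lemma pow_mul_exp_neg_le_factorial {x : ℝ} (hx : 0 ≤ x) (N : ℕ) :
    x ^ N * Real.exp (-x) ≤ N.factorial := by
  rw [Real.exp_neg, ← div_eq_mul_inv, div_le_iff₀ (Real.exp_pos x), mul_comm,
    ← div_le_iff₀ (by positivity)]
  exact Real.pow_div_factorial_le_exp x hx N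

lemma exp_neg_mul_pow_le {D a r : ℝ} {n : ℕ} (hD : 0 < D) (h : n * Real.log D + r ≤ a) :
    Real.exp (-a) * D ^ n ≤ Real.exp (-r) := by
  rw [← Real.exp_log hD, ← Real.exp_nat_mul, ← Real.exp_add, Real.exp_le_exp]
  linarith

lemma integrable_mul_exp_half_mul {ν : Measure ℝ≥0} {δ : ℝ} (hδ : 0 < δ)
    (hexp : Integrable (fun y : ℝ≥0 => Real.exp (δ * y)) ν) :
    Integrable (fun y : ℝ≥0 => (y : ℝ) * Real.exp (δ / 2 * y)) ν := by
  refine (hexp.const_mul (2 / δ)).mono' (by fun_prop) (ae_of_all _ fun y => ?_)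
  have hle : (y : ℝ) ≤ 2 / δ * Real.exp (δ / 2 * y) :=
    calc (y : ℝ) = 2 / δ * (δ / 2 * y) := by field_simp
      _ ≤ 2 / δ * Real.exp (δ / 2 * y) := by gcongr; linarith [Real.add_one_le_exp (δ / 2 * y)]
  rw [Real.norm_of_nonneg (by positivity)]
  calc (y : ℝ) * Real.exp (δ / 2 * y)
      ≤ 2 / δ * Real.exp (δ / 2 * y) * Real.exp (δ / 2 * y) := by gcongr
    _ = 2 / δ * Real.exp (δ * y) := by rw [mul_assoc, ← Real.exp_add]; ring_nf

variable {d : ℕ} {ν : Measure ℝ≥0} [IsProbabilityMeasure ν] {δ c : ℝ}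

lemma exists_integral_sum_minWeight_shift_le (hδ : 0 < δ)
    (hexp : Integrable (fun y : ℝ≥0 => Real.exp (δ * y)) ν) (hc : 0 < c)
    (hρ : 2 * d * Real.exp 1 * ∫ y : ℝ≥0, Real.exp (-c⁻¹ * y) ∂ν ≤ Real.exp (-1)) :
    ∃ C : ℝ, 0 ≤ C ∧ ∀ (K : ℕ) (a : ℝ) (u v : Fin d → ℤ) (m : ℕ), 1 ≤ m → ∀ e : Edge d,
      ∫ x, ∑ z : Fin d → Fin m, minWeight (pathSets K u v) a x ((shift (boxVec z)).symm e)
        ∂(edgeLaw d ν) ≤ C * m := by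
  set D := ∫ y : ℝ≥0, Real.exp (δ * y) ∂ν
  have hD : 1 ≤ D := one_le_integral_exp hδ.le hexp
  obtain ⟨N, hN⟩ := exists_nat_ge ((d * Real.log D + 1) / (δ * c))
  rw [div_le_iff₀ (by positivity)] at hN
  refine ⟨N + d + 1 + 2 * (2 * d).factorial + (3 * d).factorial, by positivity,
    fun K a u v m hm e => ?_⟩
  have hm_one : (1 : ℝ) ≤ m := mod_cast hm
  set k := (N + d + 1) * m with hk
  have hk_cast : (k : ℝ) = (N + d + 1) * m := by rw [hk]; push_cast; ring
  have hbox : d * m ≤ k := Nat.mul_le_mul_right m (by lia)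
  have hlong : Real.exp (-k) ≤ Real.exp (-m) :=
    Real.exp_le_exp.2 (neg_le_neg (mod_cast Nat.le_mul_of_pos_left m (Nat.succ_pos _)))
  have hslow : Real.exp (-δ * (c * k)) * D ^ (d * m) ≤ Real.exp (-m) := by
    rw [neg_mul]
    refine exp_neg_mul_pow_le (by linarith) ?_
    calc ((d * m : ℕ) : ℝ) * Real.log D + m = (d * Real.log D + 1) * m := by push_cast; ring
      _ ≤ N * (δ * c) * m := by gcongr
      _ ≤ (N + d + 1) * (δ * c) * m := by gcongr; linarith [d.cast_nonneg (α := ℝ)]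
      _ = δ * (c * k) := by rw [hk_cast]; ring
  have hpoly (j : ℕ) : (m : ℝ) ^ j * Real.exp (-m) ≤ j.factorial * m :=
    (pow_mul_exp_neg_le_factorial m.cast_nonneg j).trans
      (le_mul_of_one_le_right (Nat.cast_nonneg _) hm_one)
  calc _ ≤ _ := integral_sum_minWeight_shift_le hδ.le hexp hc hρ K a u v
        hbox e
    _ ≤ k + (m : ℝ) ^ d * ((m : ℝ) ^ d * (2 * Real.exp (-m)) +
        (m : ℝ) ^ d * ((m : ℝ) ^ d * Real.exp (-m))) := by gcongr
    _ = k + 2 * ((m : ℝ) ^ (2 * d) * Real.exp (-m)) + (m : ℝ) ^ (3 * d) * Real.exp (-m) := by ring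
    _ ≤ k + 2 * ((2 * d).factorial * m) + (3 * d).factorial * m :=
        add_le_add (by linarith [hpoly (2 * d)]) (hpoly (3 * d))
    _ = _ := by rw [hk_cast]; ring

/-- The average over the translations by a box of side `m` of the minimal time of the paths of
length at most `K` from `0` to `v`, capped at `c * K`. Averaging spreads the influence of an edge
evenly over the box. -/
noncomputable def smoothTime (c : ℝ) (K m : ℕ) (v : Fin d → ℤ) (x : Config d) : ℝ :=
  𝔼 z : Fin d → Fin m, capMin (pathSets K 0 v) (c * K) (x ∘ shift (boxVec z))

lemma measurable_smoothTime (c : ℝ) (K m : ℕ) (v : Fin d → ℤ) :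
    Measurable (smoothTime c K m v) := by
  unfold smoothTime
  simp only [Fintype.expect_eq_sum_div_card]
  exact (Finset.measurable_fun_sum _ fun z _ =>
    (measurable_capMin _ _).comp (by fun_prop)).div_const _

lemma smoothTime_nonneg (hc : 0 ≤ c) (K m : ℕ) (v : Fin d → ℤ) (x : Config d) :
    0 ≤ smoothTime c K m v x :=
  Finset.expect_nonneg fun _ _ => capMin_nonneg (by positivity) _

lemma smoothTime_le (c : ℝ) (K : ℕ) {m : ℕ} (hm : 1 ≤ m) (v : Fin d → ℤ) (x : Config d) :
    smoothTime c K m v x ≤ c * K := by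
  have : NeZero m := ⟨by lia⟩
  exact (Finset.expect_le_expect fun z _ => capMin_le_cap _).trans_eq (Fintype.expect_const _)

lemma abs_smoothTime_le (hc : 0 ≤ c) (K : ℕ) {m : ℕ} (hm : 1 ≤ m) (v : Fin d → ℤ) (x : Config d) :
    |smoothTime c K m v x| ≤ c * K :=
  (abs_of_nonneg (smoothTime_nonneg hc K m v x)).trans_le (smoothTime_le c K hm v x)

/-- In dimension `d ≥ 2` the influence `C m / m ^ d` of each edge is at most `C / m`, which yields
the logarithmic gain. -/
theorem exists_variance_exp_smoothTime_le (hd : 2 ≤ d) {L : ℝ≥0} (hν : IsLipschitzSqGaussian L ν)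
    (hδ : 0 < δ) (hexp : Integrable (fun y : ℝ≥0 => Real.exp (δ * y)) ν) (hc : 0 < c)
    (hρ : 2 * d * Real.exp 1 * ∫ y : ℝ≥0, Real.exp (-c⁻¹ * y) ∂ν ≤ Real.exp (-1)) :
    ∃ A : ℝ, 0 ≤ A ∧ ∀ (K m : ℕ) (v : Fin d → ℤ), 1 ≤ m → ∀ θ : ℝ, |θ| ≤ min 1 δ →
      ((∫ x, Real.exp (θ * smoothTime c K m v x) ∂(edgeLaw d ν)) -
        (∫ x, Real.exp (θ / 2 * smoothTime c K m v x) ∂(edgeLaw d ν)) ^ 2) * (1 + Real.log m) ≤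
      A * K * θ ^ 2 * ∫ x, Real.exp (θ * smoothTime c K m v x) ∂(edgeLaw d ν) := by
  obtain ⟨C, hC, hinfluence⟩ := exists_integral_sum_minWeight_shift_le (d := d) hδ hexp hc hρ
  set D := ∫ y : ℝ≥0, (y : ℝ) * Real.exp (δ / 2 * y) ∂ν
  refine ⟨D ^ 2 * C + 48 * L ^ 2 * c, by positivity, fun K m v hm θ hθ => ?_⟩
  have : NeZero m := ⟨by lia⟩
  have hm_one : (1 : ℝ) ≤ m := mod_cast hm
  have hsq (x : Config d) : Real.exp (θ * smoothTime c K m v x) =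
      Real.exp (θ / 2 * smoothTime c K m v x) ^ 2 := by
    rw [← Real.exp_nat_mul]
    push_cast
    ring_nf
  have hvar := variance_exp_expect_capMin_le hν (c := c * K) (P := pathSets K 0 v)
    (by positivity) (τ := fun z : Fin d → Fin m => shift (boxVec z)) rfl
    (integrable_mul_exp_half_mul hδ hexp) le_rfl (b := C * m) (by positivity)
    (fun e => hinfluence K (c * K) 0 v m hm e) (W := K) K.cast_nonneg
    (fun p hp => by
      obtain ⟨α, hα, hK, rfl⟩ := mem_pathSets.1 hp
      rw [card_edgeFin hα]
      exact mod_cast hK)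
    (hθ.trans (min_le_left _ _)) (by linarith [hθ.trans (min_le_right _ _)])
    (σ := (m : ℝ)⁻¹) (by positivity)
  have hbox : (m : ℝ) * (C * m / Fintype.card (Fin d → Fin m)) ≤ C := by
    rw [card_box, ← mul_div_assoc, div_le_iff₀ (by positivity)]
    calc (m : ℝ) * (C * m) = C * m ^ 2 := by ring
      _ ≤ C * m ^ d := by gcongr
  rw [Real.log_inv, sub_neg_eq_add, inv_inv] at hvar
  simp only [hsq]
  refine hvar.trans (mul_le_mul_of_nonneg_right (mul_le_mul_of_nonneg_right ?_ (sq_nonneg θ))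
    (integral_nonneg fun x => sq_nonneg _))
  calc (m : ℝ) * D ^ 2 * (C * m / Fintype.card (Fin d → Fin m)) * K + 48 * L ^ 2 * (c * K)
      = D ^ 2 * K * (m * (C * m / Fintype.card (Fin d → Fin m))) + 48 * L ^ 2 * (c * K) := by ring
    _ ≤ D ^ 2 * K * C + 48 * L ^ 2 * (c * K) := by gcongr
    _ = (D ^ 2 * C + 48 * L ^ 2 * c) * K := by ring

end SmoothTime

section Scale

/-- The order `√(n / log n)` of the fluctuations of the passage time at distance `n`. -/
noncomputable def fluctuationScale (n : ℕ) : ℝ := √(n / Real.log n)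

/-- The side `⌊n ^ (1/4)⌋` of the box over which the passage time at distance `n` is averaged: a
power of `n`, but small compared with `fluctuationScale n`. -/
def boxSide (n : ℕ) : ℕ := Nat.sqrt (Nat.sqrt n)

lemma log_pos_of_two_le {n : ℕ} (hn : 2 ≤ n) : 0 < Real.log n := Real.log_pos (mod_cast hn)

lemma sq_fluctuationScale (n : ℕ) : fluctuationScale n ^ 2 = n / Real.log n :=
  Real.sq_sqrt (div_nonneg n.cast_nonneg (Real.log_natCast_nonneg n))

lemma one_le_fluctuationScale {n : ℕ} (hn : 2 ≤ n) : 1 ≤ fluctuationScale n := by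
  rw [fluctuationScale, Real.one_le_sqrt, one_le_div (log_pos_of_two_le hn)]
  exact Real.log_le_self n.cast_nonneg

lemma one_le_boxSide {n : ℕ} (hn : 1 ≤ n) : 1 ≤ boxSide n := Nat.sqrt_pos.2 (Nat.sqrt_pos.2 hn)

lemma boxSide_pow_four_le (n : ℕ) : boxSide n ^ 4 ≤ n :=
  calc boxSide n ^ 4 = (boxSide n ^ 2) ^ 2 := by ring
    _ ≤ Nat.sqrt n ^ 2 := Nat.pow_le_pow_left (Nat.sqrt_le' _) 2
    _ ≤ n := Nat.sqrt_le' n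

lemma le_two_mul_boxSide_pow_four {n : ℕ} (hn : 1 ≤ n) : n ≤ (2 * boxSide n) ^ 4 := by
  have hside := one_le_boxSide hn
  have hsqrt : Nat.sqrt n + 1 ≤ (2 * boxSide n) ^ 2 := by
    have hlt : Nat.sqrt n < (boxSide n + 1) ^ 2 := Nat.lt_succ_sqrt' _
    nlinarith
  calc n ≤ (Nat.sqrt n + 1) ^ 2 := (Nat.lt_succ_sqrt' n).le
    _ ≤ ((2 * boxSide n) ^ 2) ^ 2 := Nat.pow_le_pow_left hsqrt 2
    _ = (2 * boxSide n) ^ 4 := by ring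

lemma log_le_four_mul_one_add_log_boxSide {n : ℕ} (hn : 1 ≤ n) :
    Real.log n ≤ 4 * (1 + Real.log (boxSide n)) := by
  have hside : (boxSide n : ℝ) ≠ 0 :=
    Nat.cast_ne_zero.2 (Nat.one_le_iff_ne_zero.1 (one_le_boxSide hn))
  have hlog : Real.log n ≤ Real.log ((2 * boxSide n : ℝ) ^ 4) :=
    Real.log_le_log (mod_cast hn) (mod_cast le_two_mul_boxSide_pow_four hn)
  rw [Real.log_pow, Real.log_mul two_ne_zero hside] at hlog
  push_cast at hlog
  linarith [Real.log_two_lt_d9]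

lemma le_mul_sq_fluctuationScale {n : ℕ} (hn : 2 ≤ n) :
    n ≤ 4 * (1 + Real.log (boxSide n)) * fluctuationScale n ^ 2 := by
  rw [sq_fluctuationScale, ← mul_div_assoc, le_div_iff₀ (log_pos_of_two_le hn), mul_comm]
  exact mul_le_mul_of_nonneg_right (log_le_four_mul_one_add_log_boxSide (by lia)) n.cast_nonneg

lemma boxSide_le_two_mul_fluctuationScale {n : ℕ} (hn : 2 ≤ n) :
    boxSide n ≤ 2 * fluctuationScale n := by
  have hlog : Real.log n ≤ 2 * √n := by
    linarith [Real.log_sqrt n.cast_nonneg, Real.log_le_self (Real.sqrt_nonneg (n : ℝ))]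
  have hside : (boxSide n : ℝ) ^ 2 ≤ √n :=
    Real.le_sqrt_of_sq_le (by rw [← pow_mul]; exact mod_cast boxSide_pow_four_le n)
  have hsq : (boxSide n : ℝ) ^ 2 ≤ (2 * fluctuationScale n) ^ 2 := by
    rw [mul_pow, sq_fluctuationScale, ← mul_div_assoc, le_div_iff₀ (log_pos_of_two_le hn)]
    calc (boxSide n : ℝ) ^ 2 * Real.log n ≤ √n * (2 * √n) := by gcongr
      _ = 2 * n := by rw [mul_left_comm, Real.mul_self_sqrt n.cast_nonneg]
      _ ≤ 2 ^ 2 * n := by linarith [n.cast_nonneg (α := ℝ)]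
  exact le_of_sq_le_sq hsq (by linarith [one_le_fluctuationScale hn])

end Scale

section SmoothTimeMoments

variable {d : ℕ} {ν : Measure ℝ≥0} [IsProbabilityMeasure ν] {δ c : ℝ}

theorem exists_variance_exp_smoothTime_boxSide_le (hd : 2 ≤ d) {L : ℝ≥0}
    (hν : IsLipschitzSqGaussian L ν) (hδ : 0 < δ)
    (hexp : Integrable (fun y : ℝ≥0 => Real.exp (δ * y)) ν) (hc : 0 < c)
    (hρ : 2 * d * Real.exp 1 * ∫ y : ℝ≥0, Real.exp (-c⁻¹ * y) ∂ν ≤ Real.exp (-1)) (C : ℕ) :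
    ∃ B : ℝ, 0 < B ∧ ∀ (n : ℕ) (v : Fin d → ℤ), 2 ≤ n → ∀ θ : ℝ, |θ| ≤ min 1 δ →
      (∫ x, Real.exp (θ * smoothTime c (C * n) (boxSide n) v x) ∂(edgeLaw d ν)) -
        (∫ x, Real.exp (θ / 2 * smoothTime c (C * n) (boxSide n) v x) ∂(edgeLaw d ν)) ^ 2 ≤
      B * fluctuationScale n ^ 2 * θ ^ 2 *
        ∫ x, Real.exp (θ * smoothTime c (C * n) (boxSide n) v x) ∂(edgeLaw d ν) := by
  obtain ⟨A, hA, hvar⟩ := exists_variance_exp_smoothTime_le hd hν hδ hexp hc hρ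
  refine ⟨4 * A * C + 1, by positivity, fun n v hn θ hθ => ?_⟩
  set m := boxSide n
  set q := fluctuationScale n
  have hlog : 0 < 1 + Real.log m := by linarith [Real.log_natCast_nonneg m]
  have hscale : A * (C * n : ℕ) ≤ (4 * A * C + 1) * q ^ 2 * (1 + Real.log m) :=
    calc A * (C * n : ℕ) = A * C * n := by push_cast; ring
      _ ≤ A * C * (4 * (1 + Real.log m) * q ^ 2) := by
          gcongr
          exact le_mul_sq_fluctuationScale hn
      _ = 4 * A * C * q ^ 2 * (1 + Real.log m) := by ring
      _ ≤ (4 * A * C + 1) * q ^ 2 * (1 + Real.log m) := by gcongr; linarith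
  refine le_of_mul_le_mul_right
    ((hvar (C * n) m v (one_le_boxSide (by lia)) θ hθ).trans ?_) hlog
  set J := ∫ x, Real.exp (θ * smoothTime c (C * n) m v x) ∂(edgeLaw d ν)
  calc A * (C * n : ℕ) * θ ^ 2 * J
      ≤ (4 * A * C + 1) * q ^ 2 * (1 + Real.log m) * θ ^ 2 * J := by gcongr
    _ = (4 * A * C + 1) * q ^ 2 * θ ^ 2 * J * (1 + Real.log m) := by ring

theorem exists_integral_exp_smoothTime_sub_le (hd : 2 ≤ d) {L : ℝ≥0}
    (hν : IsLipschitzSqGaussian L ν) (hδ : 0 < δ)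
    (hexp : Integrable (fun y : ℝ≥0 => Real.exp (δ * y)) ν) (hc : 0 < c)
    (hρ : 2 * d * Real.exp 1 * ∫ y : ℝ≥0, Real.exp (-c⁻¹ * y) ∂ν ≤ Real.exp (-1)) (C : ℕ) :
    ∃ η : ℝ, 0 < η ∧ ∀ (n : ℕ) (v : Fin d → ℤ), 2 ≤ n →
      ∀ θ : ℝ, |θ| ≤ η / fluctuationScale n →
      ∫ x, Real.exp (θ * (smoothTime c (C * n) (boxSide n) v x -
        ∫ y, smoothTime c (C * n) (boxSide n) v y ∂(edgeLaw d ν))) ∂(edgeLaw d ν) ≤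
        Real.exp 2 := by
  obtain ⟨B, hB, hvar⟩ := exists_variance_exp_smoothTime_boxSide_le hd hν hδ hexp hc hρ C
  set η : ℝ := min (min 1 δ) (√(2 * B))⁻¹
  have hη : 0 < η := by positivity
  have hBη : B * η ^ 2 ≤ 1 / 2 :=
    calc B * η ^ 2 ≤ B * (√(2 * B))⁻¹ ^ 2 := by gcongr; exact min_le_right _ _
      _ = 1 / 2 := by rw [inv_pow, Real.sq_sqrt (by positivity)]; field_simp
  refine ⟨η, hη, fun n v hn θ hθ => ?_⟩
  set q := fluctuationScale n
  have hq : 1 ≤ q := one_le_fluctuationScale hn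
  have hθ_le : |θ| ≤ min 1 δ := (hθ.trans (div_le_self hη.le hq)).trans (min_le_left _ _)
  have hBθ : B * q ^ 2 * θ ^ 2 ≤ 1 / 2 := by
    rw [le_div_iff₀ (by linarith)] at hθ
    calc B * q ^ 2 * θ ^ 2 = B * (|θ| * q) ^ 2 := by rw [mul_pow, sq_abs]; ring
      _ ≤ B * η ^ 2 := by gcongr
      _ ≤ 1 / 2 := hBη
  exact (integral_exp_mul_sub_integral_le_of_variance_le (measurable_smoothTime _ _ _ v)
    (abs_smoothTime_le hc.le (C * n) (one_le_boxSide (by lia)) v) (K := B * q ^ 2) (by positivity)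
    (hvar n v hn) hθ_le hBθ).trans (Real.exp_le_exp.2 (by linarith))

end SmoothTimeMoments

/-! ### Comparison of the passage time with its average -/

section ExponentialBounds

lemma exp_add_le_half_add (a b : ℝ) :
    Real.exp (a + b) ≤ (Real.exp (2 * a) + Real.exp (2 * b)) / 2 := by
  rw [Real.exp_add, two_mul, two_mul, Real.exp_add, Real.exp_add]
  nlinarith [sq_nonneg (Real.exp a - Real.exp b)]

lemma exp_expect_le {κ : Type*} [Fintype κ] [Nonempty κ] (f : κ → ℝ) :
    Real.exp (𝔼 z, f z) ≤ 𝔼 z, Real.exp (f z) := by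
  set a := 𝔼 z, f z with ha
  have htangent (z : κ) : Real.exp a * (f z - a + 1) ≤ Real.exp (f z) :=
    calc Real.exp a * (f z - a + 1) ≤ Real.exp a * Real.exp (f z - a) := by
          gcongr; exact Real.add_one_le_exp _
      _ = Real.exp (f z) := by rw [← Real.exp_add, add_sub_cancel]
  calc Real.exp a = 𝔼 z, Real.exp a * (f z - a + 1) := by
        rw [← Finset.mul_expect, Finset.expect_add_distrib, Finset.expect_sub_distrib,
          Fintype.expect_const, Fintype.expect_const, ← ha]
        ring
    _ ≤ 𝔼 z, Real.exp (f z) := Finset.expect_le_expect fun z _ => htangent z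

variable {Ω : Type*} [MeasurableSpace Ω] {μ : Measure Ω}

lemma integral_exp_abs_sub_expect_le {κ : Type*} [Fintype κ] [Nonempty κ] {T : Ω → ℝ}
    {f : κ → Ω → ℝ} {s R : ℝ} (hs : 0 ≤ s) (hT : Measurable T) (hf : ∀ z, Measurable (f z))
    (hint : ∀ z, Integrable (fun ω => Real.exp (s * |T ω - f z ω|)) μ)
    (hR : ∀ z, ∫ ω, Real.exp (s * |T ω - f z ω|) ∂μ ≤ R) :
    Integrable (fun ω => Real.exp (s * |T ω - 𝔼 z, f z ω|)) μ ∧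
      ∫ ω, Real.exp (s * |T ω - 𝔼 z, f z ω|) ∂μ ≤ R := by
  have hpoint (ω : Ω) : Real.exp (s * |T ω - 𝔼 z, f z ω|) ≤
      𝔼 z, Real.exp (s * |T ω - f z ω|) := by
    refine le_trans (Real.exp_le_exp.2 ?_) (exp_expect_le _)
    rw [← Finset.mul_expect]
    refine mul_le_mul_of_nonneg_left ?_ hs
    calc |T ω - 𝔼 z, f z ω| = |𝔼 z, (T ω - f z ω)| := by
          rw [Finset.expect_sub_distrib, Fintype.expect_const]
      _ ≤ 𝔼 z, |T ω - f z ω| := Finset.abs_expect_le _ _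
  have hint_avg : Integrable (fun ω => 𝔼 z, Real.exp (s * |T ω - f z ω|)) μ := by
    simp only [Fintype.expect_eq_sum_div_card]
    exact (integrable_finsetSum _ fun z _ => hint z).div_const _
  have hint_exp : Integrable (fun ω => Real.exp (s * |T ω - 𝔼 z, f z ω|)) μ := by
    refine hint_avg.mono' ?_ (ae_of_all _ fun ω => ?_)
    · simp only [Fintype.expect_eq_sum_div_card]
      exact Measurable.aestronglyMeasurable (by fun_prop)
    · rw [Real.norm_of_nonneg (Real.exp_pos _).le]
      exact hpoint ω
  refine ⟨hint_exp, (integral_mono hint_exp hint_avg hpoint).trans ?_⟩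
  calc ∫ ω, 𝔼 z, Real.exp (s * |T ω - f z ω|) ∂μ
      = 𝔼 z, ∫ ω, Real.exp (s * |T ω - f z ω|) ∂μ := by
        simp only [Fintype.expect_eq_sum_div_card]
        rw [integral_div, integral_finsetSum _ fun z _ => hint z]
    _ ≤ 𝔼 _z : κ, R := Finset.expect_le_expect fun z _ => hR z
    _ = R := Fintype.expect_const R

lemma exp_le_half_add_inv_mul_exp {R : ℝ} (hR : 0 < R) (a : ℝ) :
    Real.exp a ≤ R / 2 + (2 * R)⁻¹ * Real.exp (2 * a) := by
  rw [two_mul a, Real.exp_add]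
  have hamgm : 0 ≤ (2 * R)⁻¹ * (R - Real.exp a) ^ 2 := by positivity
  have hexpand : (2 * R)⁻¹ * (R - Real.exp a) ^ 2 =
      R / 2 + (2 * R)⁻¹ * (Real.exp a * Real.exp a) - Real.exp a := by
    field_simp
    ring
  linarith

lemma integral_exp_half_mul_le_two [IsProbabilityMeasure μ] {X T : Ω → ℝ} {bad : Set Ω} {δ R : ℝ}
    (hδ : 0 ≤ δ) (hR : 0 < R) (hX : Measurable X) (hbad : MeasurableSet bad)
    (hXT : ∀ ω, X ω ≤ T ω) (hXbad : ∀ ω ∉ bad, X ω = 0)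
    (hT : Integrable (fun ω => Real.exp (δ * T ω)) μ) (hTR : ∫ ω, Real.exp (δ * T ω) ∂μ ≤ R)
    (hprob : μ.real bad * R ≤ 1) :
    Integrable (fun ω => Real.exp (δ / 2 * X ω)) μ ∧
      ∫ ω, Real.exp (δ / 2 * X ω) ∂μ ≤ 2 := by
  set bound : Ω → ℝ := fun ω =>
    1 + R / 2 * bad.indicator (fun _ => 1) ω + (2 * R)⁻¹ * Real.exp (δ * T ω)
  have hpoint (ω : Ω) : Real.exp (δ / 2 * X ω) ≤ bound ω := by
    by_cases hω : ω ∈ bad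
    · simp only [bound, Set.indicator_of_mem hω]
      calc Real.exp (δ / 2 * X ω) ≤ Real.exp (δ / 2 * T ω) := by gcongr; exact hXT ω
        _ ≤ R / 2 + (2 * R)⁻¹ * Real.exp (2 * (δ / 2 * T ω)) := exp_le_half_add_inv_mul_exp hR _
        _ ≤ 1 + (R / 2 + (2 * R)⁻¹ * Real.exp (2 * (δ / 2 * T ω))) :=
            le_add_of_nonneg_left zero_le_one
        _ = 1 + R / 2 * 1 + (2 * R)⁻¹ * Real.exp (δ * T ω) := by ring_nf
    · simp only [bound, Set.indicator_of_notMem hω, hXbad ω hω, mul_zero, Real.exp_zero, add_zero]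
      exact le_add_of_nonneg_right (by positivity)
  have hind_int : Integrable (bad.indicator (fun _ => (1 : ℝ))) μ :=
    (integrable_const (1 : ℝ)).indicator hbad
  have hfirst_int : Integrable (fun ω => 1 + R / 2 * bad.indicator (fun _ => 1) ω) μ :=
    (integrable_const _).add (hind_int.const_mul _)
  have hbound_int : Integrable bound μ := hfirst_int.add (hT.const_mul _)
  have hX_int : Integrable (fun ω => Real.exp (δ / 2 * X ω)) μ :=
    hbound_int.mono' (by fun_prop) (ae_of_all _ fun ω => by
      rw [Real.norm_of_nonneg (Real.exp_pos _).le]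
      exact hpoint ω)
  refine ⟨hX_int, (integral_mono hX_int hbound_int hpoint).trans ?_⟩
  rw [integral_add hfirst_int (hT.const_mul _), integral_add (integrable_const _)
    (hind_int.const_mul _), integral_const_mul, integral_const_mul,
    integral_indicator_const _ hbad, integral_const, probReal_univ, one_smul, smul_eq_mul, mul_one]
  have hlast : (2 * R)⁻¹ * ∫ ω, Real.exp (δ * T ω) ∂μ ≤ 1 / 2 := by
    rw [inv_mul_le_iff₀ (by positivity)]
    linarith
  linarith

end ExponentialBounds

section Comparison

variable {d : ℕ} {ν : Measure ℝ≥0} [IsProbabilityMeasure ν] {δ c : ℝ}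

instance countable_walk (u v : Fin d → ℤ) : Countable ((lattice d).Walk u v) :=
  Injective.countable (f := SimpleGraph.Walk.support) fun _ _ h => SimpleGraph.Walk.ext_support h

lemma measurable_passageTime (u v : Fin d → ℤ) :
    Measurable fun x : Config d => passageTime x u v :=
  Measurable.iInf fun α => measurable_pathTime α

lemma integrable_pathTime (hδ : 0 < δ) (hexp : Integrable (fun y : ℝ≥0 => Real.exp (δ * y)) ν)
    (u v : Fin d → ℤ) :
    Integrable (fun x => pathTime x (shortPath u v)) (edgeLaw d ν) := by
  refine ((integrable_exp_pathTime hexp u v).const_mul δ⁻¹).mono'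
    (measurable_pathTime _).aestronglyMeasurable (ae_of_all _ fun x => ?_)
  rw [Real.norm_of_nonneg (pathTime_nonneg x _), inv_mul_eq_div, le_div_iff₀ hδ]
  linarith [Real.add_one_le_exp (δ * pathTime x (shortPath u v))]

lemma integrable_passageTime (hδ : 0 < δ)
    (hexp : Integrable (fun y : ℝ≥0 => Real.exp (δ * y)) ν) (u v : Fin d → ℤ) :
    Integrable (fun x => passageTime x u v) (edgeLaw d ν) :=
  (integrable_pathTime hδ hexp u v).mono' (measurable_passageTime u v).aestronglyMeasurable
    (ae_of_all _ fun x => by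
      rw [Real.norm_of_nonneg (passageTime_nonneg x u v)]
      exact passageTime_le_pathTime x _)

lemma abs_passageTime_sub_passageTime_le (x : Config d) (u v w : Fin d → ℤ) :
    |passageTime x u v - passageTime x u w| ≤ pathTime x (shortPath v w) := by
  have hback : passageTime x u v ≤ passageTime x u w + pathTime x (shortPath v w) := by
    rw [← sub_le_iff_le_add]
    refine le_passageTime fun α => ?_
    rw [sub_le_iff_le_add, ← pathTime_reverse x (shortPath v w), ← pathTime_append]
    exact passageTime_le_pathTime x _
  rw [abs_sub_le_iff]
  exact ⟨by linarith, by linarith [passageTime_le_add_pathTime x u v w]⟩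

/-- The rates `1` and `δ c` at which the two events become unlikely with `C` beat the growth
`(∫ exp (δ y)) ^ |v|` of the exponential moments once `C` is large. -/
lemma exists_measureReal_fastPaths_union_mul_le (hδ : 0 < δ)
    (hexp : Integrable (fun y : ℝ≥0 => Real.exp (δ * y)) ν) (hc : 0 < c)
    (hρ : 2 * d * Real.exp 1 * ∫ y : ℝ≥0, Real.exp (-c⁻¹ * y) ∂ν ≤ Real.exp (-1)) :
    ∃ C : ℕ, 1 ≤ C ∧ ∀ v : Fin d → ℤ, 1 ≤ l1norm v →
      (edgeLaw d ν).real (fastPaths c 0 (C * l1norm v) ∪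
        {x | c * (C * l1norm v : ℕ) < pathTime x (shortPath 0 v)}) *
      (∫ y : ℝ≥0, Real.exp (δ * y) ∂ν) ^ l1norm v ≤ 1 := by
  set D := ∫ y : ℝ≥0, Real.exp (δ * y) ∂ν
  have hD : 0 < D := zero_lt_one.trans_le (one_le_integral_exp hδ.le hexp)
  obtain ⟨N₁, hN₁⟩ := exists_nat_ge (Real.log D + 2)
  obtain ⟨N₂, hN₂⟩ := exists_nat_ge ((2 * Real.log D + 1) / (δ * c))
  rw [div_le_iff₀ (by positivity)] at hN₂
  refine ⟨N₁ + N₂ + 1, by lia, fun v hv => ?_⟩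
  set n := l1norm v
  set K := (N₁ + N₂ + 1) * n with hK
  have hn : (1 : ℝ) ≤ n := mod_cast hv
  have hK_cast : (K : ℝ) = (N₁ + N₂ + 1) * n := by rw [hK]; push_cast; ring
  have hfast : Real.exp (-K) * D ^ n ≤ Real.exp (-2) := by
    refine exp_neg_mul_pow_le hD ?_
    calc n * Real.log D + 2 ≤ (Real.log D + 2) * n := by linarith
      _ ≤ N₁ * n := by gcongr
      _ ≤ K := by rw [hK_cast]; gcongr; linarith [N₂.cast_nonneg (α := ℝ)]
  have hslow : Real.exp (-δ * (c * K)) * D ^ n * D ^ n ≤ Real.exp (-1) := by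
    rw [mul_assoc, ← pow_add, neg_mul]
    refine exp_neg_mul_pow_le hD ?_
    calc ((n + n : ℕ) : ℝ) * Real.log D + 1 ≤ (2 * Real.log D + 1) * n := by push_cast; linarith
      _ ≤ N₂ * (δ * c) * n := by gcongr
      _ = δ * (c * (N₂ * n)) := by ring
      _ ≤ δ * (c * K) := by rw [hK_cast]; gcongr; linarith [N₁.cast_nonneg (α := ℝ)]
  have hsmall : Real.exp (-2) ≤ 1 / 2 * (1 / 2) := by
    rw [show (-2 : ℝ) = -1 + -1 by norm_num, Real.exp_add]
    gcongr <;> exact exp_neg_one_le_half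
  calc _ ≤ (2 * Real.exp (-K) + Real.exp (-δ * (c * K)) * D ^ n) * D ^ n := by
        gcongr
        exact (measureReal_union_le _ _).trans (add_le_add (measureReal_fastPaths_le hc hρ 0 K)
          (measureReal_lt_pathTime_le hδ.le hexp 0 v (by rw [sub_zero]) _))
    _ = 2 * (Real.exp (-K) * D ^ n) + Real.exp (-δ * (c * K)) * D ^ n * D ^ n := by ring
    _ ≤ 1 := by linarith [exp_neg_one_le_half]

lemma exists_integral_exp_passageTime_sub_capMin_le (hδ : 0 < δ)
    (hexp : Integrable (fun y : ℝ≥0 => Real.exp (δ * y)) ν) (hc : 0 < c)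
    (hρ : 2 * d * Real.exp 1 * ∫ y : ℝ≥0, Real.exp (-c⁻¹ * y) ∂ν ≤ Real.exp (-1)) :
    ∃ C : ℕ, ∀ v : Fin d → ℤ, 1 ≤ l1norm v →
      Integrable (fun x => Real.exp (δ / 2 * |passageTime x 0 v -
        capMin (pathSets (C * l1norm v) 0 v) (c * (C * l1norm v : ℕ)) x|)) (edgeLaw d ν) ∧
      ∫ x, Real.exp (δ / 2 * |passageTime x 0 v -
        capMin (pathSets (C * l1norm v) 0 v) (c * (C * l1norm v : ℕ)) x|) ∂(edgeLaw d ν) ≤ 2 := by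
  obtain ⟨C, hC, hprob⟩ := exists_measureReal_fastPaths_union_mul_le (d := d) hδ hexp hc hρ
  refine ⟨C, fun v hv => integral_exp_half_mul_le_two hδ.le
    (pow_pos (zero_lt_one.trans_le (one_le_integral_exp hδ.le hexp)) (l1norm v))
    (((measurable_passageTime 0 v).sub (measurable_capMin _ _)).abs)
    ((measurableSet_fastPaths c 0 _).union
      (measurableSet_lt measurable_const (measurable_pathTime _)))
    (fun x => abs_passageTime_sub_capMin_le x (by positivity) ?_) (fun x hx => ?_)
    (integrable_exp_pathTime hexp 0 v)
    (integral_exp_pathTime_le hδ.le hexp 0 v (by rw [sub_zero])) (hprob v hv)⟩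
  · rw [sub_zero]
    exact Nat.le_mul_of_pos_left _ hC
  · obtain ⟨hfast, hslow⟩ := not_or.1 hx
    rw [capMin_eq_passageTime hc.le hfast (not_lt.1 hslow), sub_self, abs_zero]

lemma abs_passageTime_sub_shift_le (f : Config d → ℝ) (v w : Fin d → ℤ) (x : Config d) :
    |passageTime x 0 v - f (x ∘ shift w)| ≤ pathTime x (shortPath v (v + w)) +
      pathTime x (shortPath 0 w) + |passageTime (x ∘ shift w) 0 v - f (x ∘ shift w)| := by
  have hend := abs_passageTime_sub_passageTime_le x 0 v (v + w)
  have hstart := abs_passageTime_sub_passageTime_le x (v + w) 0 w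
  rw [passageTime_comm x (v + w) 0, passageTime_comm x (v + w) w] at hstart
  rw [passageTime_shift, zero_add]
  linarith [abs_sub_le (passageTime x 0 v) (passageTime x 0 (v + w)) (f (x ∘ shift w)),
    abs_sub_le (passageTime x 0 (v + w)) (passageTime x w (v + w)) (f (x ∘ shift w))]

lemma exp_abs_passageTime_sub_shift_le (hδ : 0 ≤ δ) (f : Config d → ℝ) (v w : Fin d → ℤ)
    (x : Config d) :
    Real.exp (δ / 4 * |passageTime x 0 v - f (x ∘ shift w)|) ≤
      1 / 4 * (Real.exp (δ * pathTime x (shortPath v (v + w))) +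
        Real.exp (δ * pathTime x (shortPath 0 w))) +
      1 / 2 * Real.exp (δ / 2 * |passageTime (x ∘ shift w) 0 v - f (x ∘ shift w)|) := by
  have htriangle := abs_passageTime_sub_shift_le f v w x
  set a := pathTime x (shortPath v (v + w))
  set b := pathTime x (shortPath 0 w)
  set r := |passageTime (x ∘ shift w) 0 v - f (x ∘ shift w)|
  calc Real.exp (δ / 4 * |passageTime x 0 v - f (x ∘ shift w)|)
      ≤ Real.exp (δ / 4 * (a + b) + δ / 4 * r) := by rw [← mul_add]; gcongr
    _ ≤ (Real.exp (δ / 2 * a + δ / 2 * b) + Real.exp (δ / 2 * r)) / 2 :=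
        (exp_add_le_half_add _ _).trans_eq (by ring_nf)
    _ ≤ ((Real.exp (δ * a) + Real.exp (δ * b)) / 2 + Real.exp (δ / 2 * r)) / 2 := by
        gcongr
        exact (exp_add_le_half_add _ _).trans_eq (by ring_nf)
    _ = _ := by ring

lemma integral_exp_passageTime_sub_shift_le (hδ : 0 ≤ δ)
    (hexp : Integrable (fun y : ℝ≥0 => Real.exp (δ * y)) ν) {f : Config d → ℝ} (hf : Measurable f)
    {v : Fin d → ℤ}
    (hint : Integrable (fun x => Real.exp (δ / 2 * |passageTime x 0 v - f x|)) (edgeLaw d ν))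
    (hle : ∫ x, Real.exp (δ / 2 * |passageTime x 0 v - f x|) ∂(edgeLaw d ν) ≤ 2)
    {w : Fin d → ℤ} {n : ℕ} (hw : l1norm w ≤ n) :
    Integrable (fun x => Real.exp (δ / 4 * |passageTime x 0 v - f (x ∘ shift w)|))
      (edgeLaw d ν) ∧
    ∫ x, Real.exp (δ / 4 * |passageTime x 0 v - f (x ∘ shift w)|) ∂(edgeLaw d ν) ≤
      2 * (∫ y : ℝ≥0, Real.exp (δ * y) ∂ν) ^ n := by
  have hshift : MeasurePreserving (fun x : Config d => x ∘ shift w) (edgeLaw d ν) (edgeLaw d ν) :=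
    measurePreserving_comp_perm (shift w)
  have hend_int := integrable_exp_pathTime hexp v (v + w)
  have hstart_int := integrable_exp_pathTime hexp 0 w
  have herror_int := hshift.integrable_comp_of_integrable hint
  have hbound_int :=
    ((hend_int.add hstart_int).const_mul (1 / 4)).add (herror_int.const_mul (1 / 2))
  have hexp_int : Integrable (fun x => Real.exp (δ / 4 * |passageTime x 0 v - f (x ∘ shift w)|))
      (edgeLaw d ν) := by
    have hT := measurable_passageTime (d := d) 0 v
    refine hbound_int.mono' (Measurable.aestronglyMeasurable (by fun_prop))
      (ae_of_all _ fun x => ?_)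
    rw [Real.norm_of_nonneg (Real.exp_pos _).le]
    exact exp_abs_passageTime_sub_shift_le hδ f v w x
  refine ⟨hexp_int, (integral_mono hexp_int hbound_int
    (exp_abs_passageTime_sub_shift_le hδ f v w)).trans ?_⟩
  have herror : ∫ x, Real.exp (δ / 2 * |passageTime (x ∘ shift w) 0 v - f (x ∘ shift w)|)
      ∂(edgeLaw d ν) ≤ 2 := by
    have hmap := integral_map hshift.aemeasurable (hshift.map_eq.symm ▸ hint.aestronglyMeasurable)
    rw [hshift.map_eq] at hmap
    exact hmap.symm.trans_le hle
  have hend := integral_exp_pathTime_le hδ hexp v (v + w) (n := n) (by rwa [add_sub_cancel_left])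
  have hstart := integral_exp_pathTime_le hδ hexp 0 w (n := n) (by rwa [sub_zero])
  rw [integral_add' ((hend_int.add hstart_int).const_mul _) (herror_int.const_mul _),
    integral_const_mul, integral_const_mul, integral_add' hend_int hstart_int]
  simp only [Function.comp_apply]
  linarith [one_le_pow₀ (n := n) (one_le_integral_exp hδ hexp)]

lemma exists_integral_exp_passageTime_sub_smoothTime_le (hδ : 0 < δ)
    (hexp : Integrable (fun y : ℝ≥0 => Real.exp (δ * y)) ν) (hc : 0 < c)
    (hρ : 2 * d * Real.exp 1 * ∫ y : ℝ≥0, Real.exp (-c⁻¹ * y) ∂ν ≤ Real.exp (-1)) :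
    ∃ C : ℕ, ∀ (v : Fin d → ℤ) (m : ℕ), 1 ≤ l1norm v → 1 ≤ m →
      Integrable (fun x => Real.exp (δ / 4 *
        |passageTime x 0 v - smoothTime c (C * l1norm v) m v x|)) (edgeLaw d ν) ∧
      ∫ x, Real.exp (δ / 4 *
        |passageTime x 0 v - smoothTime c (C * l1norm v) m v x|) ∂(edgeLaw d ν) ≤
        2 * (∫ y : ℝ≥0, Real.exp (δ * y) ∂ν) ^ (d * m) := by
  obtain ⟨C, hcap⟩ := exists_integral_exp_passageTime_sub_capMin_le (d := d) hδ hexp hc hρ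
  refine ⟨C, fun v m hv hm => ?_⟩
  have : NeZero m := ⟨by lia⟩
  have hshift (z : Fin d → Fin m) := integral_exp_passageTime_sub_shift_le hδ.le hexp
    (measurable_capMin _ _) (hcap v hv).1 (hcap v hv).2 (l1norm_boxVec_le z)
  exact integral_exp_abs_sub_expect_le (by positivity) (measurable_passageTime 0 v)
    (fun z => (measurable_capMin _ _).comp (by fun_prop)) (fun z => (hshift z).1)
    (fun z => (hshift z).2)

end Comparison

/-! ### Concentration through an approximation -/

section Concentration

variable {Ω : Type*} [MeasurableSpace Ω] {μ : Measure Ω} [IsProbabilityMeasure μ] {T F : Ω → ℝ}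

lemma abs_integral_sub_integral_le_of_integral_exp_le {s b : ℝ} (hs : 0 < s)
    (hT : Integrable T μ) (hF : Integrable F μ)
    (hint : Integrable (fun ω => Real.exp (s * |T ω - F ω|)) μ)
    (hle : ∫ ω, Real.exp (s * |T ω - F ω|) ∂μ ≤ 2 * Real.exp b) :
    |∫ ω, T ω ∂μ - ∫ ω, F ω ∂μ| ≤ (1 + b) / s := by
  have htangent (ω : Ω) :
      s * |T ω - F ω| ≤ (2 * Real.exp b)⁻¹ * Real.exp (s * |T ω - F ω|) + b := by
    have htangent_at := Real.add_one_le_exp (s * |T ω - F ω| - (Real.log 2 + b))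
    rw [Real.exp_sub, Real.exp_add, Real.exp_log two_pos, div_eq_inv_mul] at htangent_at
    linarith [Real.log_two_lt_d9]
  rw [le_div_iff₀' hs, ← integral_sub hT hF]
  calc s * |∫ ω, (T ω - F ω) ∂μ| ≤ s * ∫ ω, |T ω - F ω| ∂μ := by
        gcongr; exact abs_integral_le_integral_abs
    _ = ∫ ω, s * |T ω - F ω| ∂μ := (integral_const_mul _ _).symm
    _ ≤ ∫ ω, ((2 * Real.exp b)⁻¹ * Real.exp (s * |T ω - F ω|) + b) ∂μ :=
        integral_mono ((hT.sub hF).abs.const_mul s)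
          ((hint.const_mul _).add (integrable_const b)) htangent
    _ = (2 * Real.exp b)⁻¹ * ∫ ω, Real.exp (s * |T ω - F ω|) ∂μ + b := by
        rw [integral_add (hint.const_mul _) (integrable_const b), integral_const_mul,
          integral_const, probReal_univ, one_smul]
    _ ≤ 1 + b := by
        gcongr
        rwa [inv_mul_le_iff₀ (by positivity), mul_one]

lemma measureReal_le_abs_le_of_integral_exp_le {a R : ℝ} (ha : 0 ≤ a)
    (hint : ∀ θ : ℝ, |θ| = a → Integrable (fun ω => Real.exp (θ * F ω)) μ)
    (hle : ∀ θ : ℝ, |θ| = a → ∫ ω, Real.exp (θ * F ω) ∂μ ≤ R) (r : ℝ) :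
    μ.real {ω | r ≤ |F ω|} ≤ 2 * (Real.exp (-a * r) * R) := by
  have hpos := measure_ge_le_exp_mul_mgf r ha (hint a (abs_of_nonneg ha))
  have hneg := measure_le_le_exp_mul_mgf (-r) (neg_nonpos.2 ha)
    (hint (-a) (by rw [abs_neg, abs_of_nonneg ha]))
  rw [mgf, neg_neg, mul_neg, ← neg_mul] at hneg
  calc μ.real {ω | r ≤ |F ω|} ≤ μ.real ({ω | r ≤ F ω} ∪ {ω | F ω ≤ -r}) :=
        measureReal_mono fun ω (hω : r ≤ |F ω|) => (le_abs.1 hω).imp (fun h => h) le_neg_of_le_neg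
    _ ≤ Real.exp (-a * r) * R + Real.exp (-a * r) * R := by
        refine (measureReal_union_le _ _).trans (add_le_add
          (hpos.trans (mul_le_mul_of_nonneg_left (hle a (abs_of_nonneg ha)) (Real.exp_pos _).le))
          (hneg.trans (mul_le_mul_of_nonneg_left (hle (-a) ?_) (Real.exp_pos _).le)))
        rw [abs_neg, abs_of_nonneg ha]
    _ = 2 * (Real.exp (-a * r) * R) := (two_mul _).symm

lemma measureReal_lt_abs_sub_integral_le {a s b r R : ℝ} (ha : 0 ≤ a) (hs : 0 < s)
    (hT : Integrable T μ) (hF : Integrable F μ)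
    (hF_exp : ∀ θ : ℝ, |θ| = a →
      Integrable (fun ω => Real.exp (θ * (F ω - ∫ ω', F ω' ∂μ))) μ)
    (hF_le : ∀ θ : ℝ, |θ| = a → ∫ ω, Real.exp (θ * (F ω - ∫ ω', F ω' ∂μ)) ∂μ ≤ R)
    (hTF_exp : Integrable (fun ω => Real.exp (s * |T ω - F ω|)) μ)
    (hTF_le : ∫ ω, Real.exp (s * |T ω - F ω|) ∂μ ≤ 2 * Real.exp b)
    (hr : (1 + b) / s ≤ r / 4) :
    μ.real {ω | r < |T ω - ∫ ω', T ω' ∂μ|} ≤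
      2 * (Real.exp (-a * (r / 2)) * R) + Real.exp (-s * (r / 4)) * (2 * Real.exp b) := by
  have hmean := (abs_integral_sub_integral_le_of_integral_exp_le hs hT hF hTF_exp hTF_le).trans hr
  set M := ∫ ω, F ω ∂μ
  have hsub : {ω | r < |T ω - ∫ ω', T ω' ∂μ|} ⊆
      {ω | r / 2 ≤ |F ω - M|} ∪ {ω | r / 4 ≤ |T ω - F ω|} := by
    intro ω (hω : r < _)
    by_contra! hfar
    simp only [Set.mem_union, Set.mem_ofPred_eq, not_or, not_le] at hfar
    rw [abs_sub_comm] at hmean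
    linarith [hfar.1, hfar.2, abs_sub_le (T ω) (F ω) (∫ ω', T ω' ∂μ),
      abs_sub_le (F ω) M (∫ ω', T ω' ∂μ)]
  calc μ.real {ω | r < |T ω - ∫ ω', T ω' ∂μ|}
      ≤ μ.real {ω | r / 2 ≤ |F ω - M|} + μ.real {ω | r / 4 ≤ |T ω - F ω|} :=
        (measureReal_mono hsub).trans (measureReal_union_le _ _)
    _ ≤ _ := add_le_add (measureReal_le_abs_le_of_integral_exp_le ha hF_exp hF_le _)
        ((measure_ge_le_exp_mul_mgf (r / 4) hs.le hTF_exp).trans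
          (mul_le_mul_of_nonneg_left hTF_le (Real.exp_pos _).le))

lemma exp_add_exp_le_mul_exp_min {η s B q t : ℝ} (hs : 0 ≤ s) (hq : 1 ≤ q) (ht : 0 ≤ t)
    (hBq : B * q ≤ s * (t * q) / 8) :
    2 * (Real.exp (-(η / q) * (t * q / 2)) * Real.exp 2) +
        Real.exp (-s * (t * q / 4)) * (2 * Real.exp (B * q)) ≤
      (2 * Real.exp 2 + 2) * Real.exp (-(min (η / 2) (s / 8) * t)) := by
  have : 0 < q := by linarith
  have hfirst : Real.exp (-(η / q) * (t * q / 2)) ≤ Real.exp (-(min (η / 2) (s / 8) * t)) := by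
    rw [show -(η / q) * (t * q / 2) = -(η / 2 * t) by field_simp]
    gcongr
    exact min_le_left _ _
  have hsecond : Real.exp (-s * (t * q / 4)) * Real.exp (B * q) ≤
      Real.exp (-(min (η / 2) (s / 8) * t)) := by
    rw [← Real.exp_add, Real.exp_le_exp]
    have hmin : min (η / 2) (s / 8) * t ≤ s / 8 * t := by gcongr; exact min_le_right _ _
    have hscale : s * t ≤ s * (t * q) := by gcongr; exact le_mul_of_one_le_right ht hq
    linarith
  linarith [mul_le_mul_of_nonneg_left hfirst (Real.exp_pos 2).le]

theorem exists_measureReal_lt_abs_sub_integral_le (μ : Measure Ω) [IsProbabilityMeasure μ]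
    {η s B : ℝ} (hη : 0 < η) (hs : 0 < s) (hB : 0 ≤ B) :
    ∃ C₁ C₂ : ℝ, 0 < C₁ ∧ 0 < C₂ ∧ ∀ (T F : Ω → ℝ) (q : ℝ), 1 ≤ q →
      Integrable T μ → Integrable F μ →
      (∀ θ : ℝ, Integrable (fun ω => Real.exp (θ * (F ω - ∫ ω', F ω' ∂μ))) μ) →
      (∀ θ : ℝ, |θ| ≤ η / q → ∫ ω, Real.exp (θ * (F ω - ∫ ω', F ω' ∂μ)) ∂μ ≤ Real.exp 2) →
      Integrable (fun ω => Real.exp (s * |T ω - F ω|)) μ →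
      ∫ ω, Real.exp (s * |T ω - F ω|) ∂μ ≤ 2 * Real.exp (B * q) →
      ∀ t : ℝ, μ.real {ω | t * q < |T ω - ∫ ω', T ω' ∂μ|} ≤ C₁ * Real.exp (-(C₂ * t)) := by
  set t₀ := 8 * (1 + B) / s
  set C₂ := min (η / 2) (s / 8)
  have hC₂ : 0 < C₂ := by positivity
  refine ⟨2 * Real.exp 2 + 2 + Real.exp (C₂ * t₀), C₂, by positivity, hC₂,
    fun T F q hq hT hF hF_exp hF_le hTF_exp hTF_le t => ?_⟩
  rcases lt_or_ge t t₀ with ht | ht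
  · calc _ ≤ 1 := measureReal_le_one
      _ ≤ Real.exp (C₂ * t₀) * Real.exp (-(C₂ * t)) := by
          rw [← Real.exp_add, ← sub_eq_add_neg, ← mul_sub]
          exact Real.one_le_exp (mul_nonneg hC₂.le (by linarith))
      _ ≤ _ := by gcongr; linarith [Real.exp_pos 2]
  have ht_nonneg : 0 ≤ t := le_trans (by positivity) ht
  have hq_pos : 0 < q := by linarith
  have hBq : 1 + B * q ≤ s * (t * q) / 8 :=
    calc 1 + B * q ≤ (1 + B) * q := by linarith
      _ = s * (t₀ * q) / 8 := by simp only [t₀]; field_simp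
      _ ≤ s * (t * q) / 8 := by gcongr
  have hbias : (1 + B * q) / s ≤ t * q / 4 := by
    rw [div_le_iff₀ hs]
    linarith [mul_nonneg hs.le (mul_nonneg ht_nonneg hq_pos.le)]
  calc _ ≤ _ := measureReal_lt_abs_sub_integral_le (by positivity) hs hT hF (fun θ _ => hF_exp θ)
        (fun θ hθ => hF_le θ hθ.le) hTF_exp hTF_le hbias
    _ ≤ (2 * Real.exp 2 + 2) * Real.exp (-(C₂ * t)) :=
        exp_add_exp_le_mul_exp_min hs.le hq ht_nonneg (by linarith)
    _ ≤ _ := mul_le_mul_of_nonneg_right (le_add_of_nonneg_right (Real.exp_pos _).le)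
        (Real.exp_pos _).le

variable {d : ℕ} {ν : Measure ℝ≥0} [IsProbabilityMeasure ν] {δ c : ℝ}

lemma integrable_smoothTime (hc : 0 ≤ c) (K : ℕ) {m : ℕ} (hm : 1 ≤ m) (v : Fin d → ℤ) :
    Integrable (smoothTime c K m v) (edgeLaw d ν) :=
  Integrable.of_bound (measurable_smoothTime c K m v).aestronglyMeasurable _
    (ae_of_all _ (abs_smoothTime_le hc K hm v))

lemma integrable_exp_mul_smoothTime_sub (hc : 0 ≤ c) (K : ℕ) {m : ℕ} (hm : 1 ≤ m) (v : Fin d → ℤ)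
    (a θ : ℝ) :
    Integrable (fun x => Real.exp (θ * (smoothTime c K m v x - a))) (edgeLaw d ν) :=
  integrable_exp_mul_of_abs_le ((measurable_smoothTime c K m v).sub_const a)
    (fun x => (abs_sub _ _).trans (add_le_add_left (abs_smoothTime_le hc K hm v x) _)) θ

lemma pow_mul_boxSide_le_exp {D : ℝ} (hD : 1 ≤ D) {n : ℕ} (hn : 2 ≤ n) :
    D ^ (d * boxSide n) ≤ Real.exp (2 * d * Real.log D * fluctuationScale n) := by
  calc D ^ (d * boxSide n) = Real.exp (d * Real.log D * boxSide n) := by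
        rw [← Real.exp_log (zero_lt_one.trans_le hD), ← Real.exp_nat_mul, Real.log_exp]
        push_cast
        ring_nf
    _ ≤ Real.exp (d * Real.log D * (2 * fluctuationScale n)) := by
        have := Real.log_nonneg hD
        gcongr
        exact boxSide_le_two_mul_fluctuationScale hn
    _ = Real.exp (2 * d * Real.log D * fluctuationScale n) := by ring_nf

end Concentration

end FPP

theorem mainTheorem1_general (d : ℕ) (hd : 2 ≤ d) (ν : Measure ℝ≥0) [IsProbabilityMeasure ν]
    {L : ℝ≥0} (hν : FPP.IsLipschitzSqGaussian L ν) (hν0 : ν {0} = 0)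
    (hexp : ∃ δ : ℝ, 0 < δ ∧ Integrable (fun x : ℝ≥0 => Real.exp (δ * (x : ℝ))) ν) :
    ∃ C₁ C₂ : ℝ, 0 < C₁ ∧ 0 < C₂ ∧
      ∀ v : Fin d → ℤ, 2 ≤ FPP.l1norm v →
        Integrable (fun x => FPP.passageTime x 0 v) (FPP.edgeLaw d ν) ∧
        ∀ t : ℝ,
          (FPP.edgeLaw d ν).real
            {x | t * Real.sqrt ((FPP.l1norm v : ℝ) / Real.log (FPP.l1norm v : ℝ)) <
              |FPP.passageTime x 0 v - ∫ y, FPP.passageTime y 0 v ∂(FPP.edgeLaw d ν)|}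
            ≤ C₁ * Real.exp (-(C₂ * t)) := by
  obtain ⟨δ, hδ, hexp⟩ := hexp
  have hD := FPP.one_le_integral_exp hδ.le hexp
  obtain ⟨c, hc, hρ⟩ := FPP.exists_mul_integral_exp_neg_inv_mul_le hν0 d
  obtain ⟨C, happrox⟩ :=
    FPP.exists_integral_exp_passageTime_sub_smoothTime_le (d := d) hδ hexp hc hρ
  obtain ⟨η, hη, hmoment⟩ := FPP.exists_integral_exp_smoothTime_sub_le hd hν hδ hexp hc hρ C
  obtain ⟨C₁, C₂, hC₁, hC₂, htail⟩ :=
    FPP.exists_measureReal_lt_abs_sub_integral_le (FPP.edgeLaw d ν) hη (div_pos hδ four_pos)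
      (mul_nonneg (by positivity : (0 : ℝ) ≤ 2 * d) (Real.log_nonneg hD))
  refine ⟨C₁, C₂, hC₁, hC₂, fun v hv => ?_⟩
  have hv_pos : 1 ≤ FPP.l1norm v := one_le_two.trans hv
  have hbox := FPP.one_le_boxSide hv_pos
  have hT := FPP.integrable_passageTime (d := d) hδ hexp 0 v
  obtain ⟨hint, hle⟩ := happrox v (FPP.boxSide (FPP.l1norm v)) hv_pos hbox
  exact ⟨hT, htail _ _ _ (FPP.one_le_fluctuationScale hv) hT
    (FPP.integrable_smoothTime hc.le _ hbox v)
    (fun θ => FPP.integrable_exp_mul_smoothTime_sub hc.le _ hbox v _ θ)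
    (hmoment _ v hv) hint
    (hle.trans (mul_le_mul_of_nonneg_left (FPP.pow_mul_boxSide_le_exp hD hv) two_pos.le))⟩

theorem mainTheorem1 (d : ℕ) (hd : 2 ≤ d) (ν : Measure ℝ≥0) [IsProbabilityMeasure ν]
    (hν : FPP.IsNearlyGamma ν)
    (hexp : ∃ δ : ℝ, 0 < δ ∧ Integrable (fun x : ℝ≥0 => Real.exp (δ * (x : ℝ))) ν) :
    ∃ C₁ C₂ : ℝ, 0 < C₁ ∧ 0 < C₂ ∧
      ∀ v : Fin d → ℤ, 2 ≤ FPP.l1norm v →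
        Integrable (fun x => FPP.passageTime x 0 v) (FPP.edgeLaw d ν) ∧
        ∀ t : ℝ, 0 < t → t ≤ (FPP.l1norm v : ℝ) →
          (FPP.edgeLaw d ν).real
            {x | t * Real.sqrt ((FPP.l1norm v : ℝ) / Real.log (FPP.l1norm v : ℝ)) <
              |FPP.passageTime x 0 v - ∫ y, FPP.passageTime y 0 v ∂(FPP.edgeLaw d ν)|}
            ≤ C₁ * Real.exp (-(C₂ * t)) := by
  obtain ⟨L, hL⟩ := hν.exists_isLipschitzSqGaussian
  obtain ⟨C₁, C₂, hC₁, hC₂, htail⟩ := mainTheorem1_general d hd ν hL hν.measure_zero hexp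
  exact ⟨C₁, C₂, hC₁, hC₂, fun v hv => ⟨(htail v hv).1, fun t _ _ => (htail v hv).2 t⟩⟩
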